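/- Conventions. A \emph{surface} is a connected Hausdorff space locally homeomorphic to $\mathbb R^2$. A \emph{foliation} of a surface $S$ is a maximal atlas of charts into $\mathbb R\times\mathbb R$ whose coordinate changes are locally of the form $(x,y)\mapsto(g(x,y),h(y))$ with $h$ an embedding. The components of the level sets $\{y=\mathrm{const}\}$ of its charts (the plaques) generate the leaf topology on $S$; its path components, with the topology induced by the leaf topology, are the \emph{leaves}. A leaf is \emph{short} if it is homeomorphic to the circle or to $\mathbb R$, and \emph{long} otherwise. It is \emph{embedded} if its inclusion into $S$ is a topological embedding. A foliation is \emph{minimal} if every leaf is dense in $S$. The \emph{closed long ray} $\mathbb L_{\ge 0}$ is $\omega_1\times[0,1)$ with the lexicographic order topology (its points are written $x=\alpha+r$), and the \emph{long ray} is $\mathbb L_+=\mathbb L_{\ge 0}\setminus\{0\}$. Nyikosization. Let $f=\langle f_\alpha\rangle_{\alpha<\omega_1}$ be strictly increasing functions $\omega\to\omega$ such that $f_\alpha(n)<f_\beta(n)$ for all large $n$ whenever $\alpha<\beta$, $f_0(n)=n$, $f_0<f_\alpha$ everywhere for $\alpha>0$, and $f_{\alpha+1}=f_\alpha+1$. For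 $x=\alpha+r\in\mathbb L_{\ge 0}$ put $f_x=f_\alpha+r$, and let $g_x:\mathbb R\to(-\infty,0]$ be the function with $g_x(0)=0$ and $g_x(\pm\frac1n)=-\frac1{f_x(n)}$ for $n\ge1$ that is linear on each $\pm[\frac1{n+1},\frac1n]$ and constant on each of $\{s\ge1\}$, $\{s\le-1\}$. Let $X$ be a surface, $p\in X$, and $\varphi:\mathbb R^2\to X$ a homeomorphism onto an open set with $\varphi(0)=p$. The Nyikosization of $X$ at $p$ through $\varphi$ is the set $(X\setminus\{p\})\sqcup\mathbb L_{\ge 0}$ with the topology generated by the open subsets of $X\setminus\{p\}$, the sets $\varphi(\{(s,t):|s|<\varepsilon,\ g_x(s)<t<g_y(s)\})\cup(x,y)$ for $\varepsilon>0$ and $x<y$ in $\mathbb L_+$, and the sets $\varphi(\{(s,t):|s|<\varepsilon,\ -\varepsilon<t<g_\varepsilon(s)\})\cup[0,\varepsilon)$ for $0<\varepsilon<1$. \textbf{Theorem.} Let $a$ be an irrational number, and let $p\in\mathbb T^2=\mathbb R^2/\mathbb Z^2$. There are a sequence $f$ as above and a homeomorphism $\varphi$ of $\mathbb R^2$ onto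 an open subset of $\mathbb T^2$ with $\varphi(0,0)=p$, of the form $\varphi(s,t)=p+(u(s),0)+v(t)\,(1,a)$ with $u,v:\mathbb R\to\mathbb R$ continuous, strictly increasing and zero at $0$ (so that $\varphi$ maps horizontals to horizontals and verticals into leaves of the Kronecker foliation of slope $a$), such that the Nyikosization $S$ of $\mathbb T^2$ at $p$ through $\varphi$ is a non-metrisable surface with a minimal foliation that has exactly one long leaf. The long leaf is homeomorphic to the long ray $\mathbb L_+$ and is not embedded, and all other leaves are homeomorphic to $\mathbb R$. More precisely, the leaves are $\{p+t(1,a):t<0\}\cup\mathbb L_{\ge 0}$ (the long leaf), $\{p+t(1,a):t>0\}$, and the Kronecker leaves $\{q+t(1,a):t\in\mathbb R\}$ that do not contain $p$. In particular, there is a non-metrisable surface with a minimal foliation that has exactly one long leaf, which is a long ray and is not embedded, all other leaves being real lines. -/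

import Mathlib

noncomputable section

/-! ### Surfaces -/

/-- A surface: a connected Hausdorff space that is locally homeomorphic to the plane. -/
structure IsSurface (M : Type*) [TopologicalSpace M] : Prop where
  connected : ConnectedSpace M
  hausdorff : T2Space M
  locallyEuclidean : Nonempty (ChartedSpace (EuclideanSpace ℝ (Fin 2)) M)

/-! ### One-dimensional foliations of surfaces -/

/-- Two charts are compatible if the coordinate change has, near each point of its domain, the form
`(x, y) ↦ (g (x, y), h y)`, with `h` an embedding of an open subset of `ℝ` into `ℝ` (a continuous
injective map on an open subset of `ℝ` is an embedding). -/
def FoliatedCompatible {M : Type*} [TopologicalSpace M]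
    (e e' : OpenPartialHomeomorph M (ℝ × ℝ)) : Prop :=
  ∀ z ∈ (e.symm.trans e').source, ∃ V : Set (ℝ × ℝ), IsOpen V ∧ z ∈ V ∧
    V ⊆ (e.symm.trans e').source ∧
    ∃ h : ℝ → ℝ, ContinuousOn h (Prod.snd '' V) ∧ Set.InjOn h (Prod.snd '' V) ∧
      ∀ w ∈ V, ((e.symm.trans e') w).2 = h w.2

/-- A foliation (of dimension one, on a surface `M`): a maximal atlas of pairwise compatible
foliated charts. The leaf direction is the first coordinate. -/
structure Foliation (M : Type*) [TopologicalSpace M] where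
  atlas : Set (OpenPartialHomeomorph M (ℝ × ℝ))
  cover : ∀ x : M, ∃ e ∈ atlas, x ∈ e.source
  compatible : ∀ e ∈ atlas, ∀ e' ∈ atlas, FoliatedCompatible e e'
  maximal : ∀ e : OpenPartialHomeomorph M (ℝ × ℝ),
    (∀ e' ∈ atlas, FoliatedCompatible e e' ∧ FoliatedCompatible e' e) → e ∈ atlas

namespace Foliation

variable {M : Type*} [TopologicalSpace M] (F : Foliation M)

/-- A plaque: a connected component of a level set `{y = const}` of a foliated chart. -/
def IsPlaque (P : Set M) : Prop :=
  ∃ e ∈ F.atlas, ∃ x ∈ e.source,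
    P = connectedComponentIn {z | z ∈ e.source ∧ (e z).2 = (e x).2} x

/-- The leaf topology on `M`, generated by the plaques. -/
abbrev leafTopology : TopologicalSpace M :=
  TopologicalSpace.generateFrom {P | F.IsPlaque P}

/-- The leaves are the path components of the leaf topology. -/
def IsLeaf (l : Set M) : Prop :=
  ∃ x : M, l = @pathComponent M F.leafTopology x

/-- The intrinsic topology of a subset (in practice, a leaf): the one induced by the leaf
topology. -/
abbrev intrinsicTopology (l : Set M) : TopologicalSpace l :=
  F.leafTopology.induced Subtype.val

/-- The leaf `l`, with its intrinsic topology, is homeomorphic to `X`. -/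
def LeafHomeomorphic (l : Set M) (X : Type*) [TopologicalSpace X] : Prop :=
  Nonempty (@Homeomorph l X (F.intrinsicTopology l) _)

/-- A leaf is short if it is a circle or a real line, and long otherwise. -/
def IsLong (l : Set M) : Prop :=
  ¬ F.LeafHomeomorphic l Circle ∧ ¬ F.LeafHomeomorphic l ℝ

/-- A leaf is embedded if its inclusion into `M`, which is an injective immersion for the intrinsic
topology, is a topological embedding. -/
def IsEmbedded (l : Set M) : Prop :=
  @Topology.IsEmbedding l M (F.intrinsicTopology l) _ Subtype.val

/-- A foliation is minimal if every leaf is dense in `M`. -/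
def IsMinimal : Prop :=
  ∀ l : Set M, F.IsLeaf l → Dense l

end Foliation

/-! ### The long ray -/

/-- The set of countable ordinals. -/
abbrev CountableOrdinal : Type :=
  (Ordinal.omega 1 : Ordinal.{0}).ToType

/-- The closed long ray: `ω₁ × [0, 1)` with the lexicographic order and the order topology. -/
abbrev ClosedLongRay : Type :=
  CountableOrdinal ×ₗ Set.Ico (0 : ℝ) 1

instance ClosedLongRay.instTopologicalSpace : TopologicalSpace ClosedLongRay :=
  Preorder.topology ClosedLongRay

/-- The open long ray: the closed long ray without its first point. -/
abbrev OpenLongRay : Type :=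
  {x : ClosedLongRay // ¬ IsMin x}

/-! ### Nyikosization -/

/-- An `ω₁`-sequence of increasing functions `f α : ω → ω` such that `f α <* f β` for `α < β`,
`f 0 = id`, `f 0 < f α` everywhere for `α > 0`, and `f (α + 1) = f α + 1`. -/
structure IsNyikosSequence (f : CountableOrdinal → ℕ → ℕ) : Prop where
  strictMono : ∀ α, StrictMono (f α)
  eventually_lt : ∀ α β, α < β → ∀ᶠ n in Filter.atTop, f α n < f β n
  zero : ∀ α, IsMin α → ∀ n, f α n = n
  zero_lt : ∀ α, ¬ IsMin α → ∀ n, n < f α n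
  succ : ∀ α β, α ⋖ β → ∀ n, f β n = f α n + 1

/-- The extension of a sequence `f` to all points of the closed long ray:
`f_x (n) = f_α (n) + r` for `x = (α, r) = α + r`. -/
def longExtension (f : CountableOrdinal → ℕ → ℕ) (x : ClosedLongRay) (n : ℕ) : ℝ :=
  (f (ofLex x).1 n : ℝ) + ((ofLex x).2 : ℝ)

/-- The function `g : ℝ → (-∞, 0]` with `g 0 = 0` and `g (± 1 / n) = - 1 / h n` for `n ≥ 1`, linear
on each interval `± [1 / (n + 1), 1 / n]`, and constant for `|s| ≥ 1`. -/
def nyikosCurve (h : ℕ → ℝ) (s : ℝ) : ℝ :=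
  if s = 0 then 0
  else if 1 ≤ |s| then - (1 / h 1)
  else
    let n : ℕ := ⌊1 / |s|⌋₊
    let c : ℝ := (|s| - 1 / (n + 1)) * (n * (n + 1))
    c * (-(1 / h n)) + (1 - c) * (-(1 / h (n + 1)))

/-- The underlying set of the Nyikosization of `X` at the point `p`, in the open set `range φ`,
through the map `φ : ℝ² → X` with `φ 0 = p`: the disjoint union of `X ∖ {p}` and the closed long
ray. The map `φ` and the sequence `f` enter in the topology. -/
def Nyikosization {X : Type*} (p : X) (_φ : ℝ × ℝ → X) (_f : CountableOrdinal → ℕ → ℕ) : Type _ :=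
  {x : X // x ≠ p} ⊕ ClosedLongRay

namespace Nyikosization

variable {X : Type*} {p : X} {φ : ℝ × ℝ → X} {f : CountableOrdinal → ℕ → ℕ}

/-- The subset `(A ∖ {p}) ∪ B` of the Nyikosization, for `A ⊆ X` and `B` a set of points of the
closed long ray. -/
def union (A : Set X) (B : Set ClosedLongRay) : Set (Nyikosization p φ f) :=
  {z | Sum.elim (fun q : {x : X // x ≠ p} => (q : X) ∈ A) (fun w : ClosedLongRay => w ∈ B) z}

/-- The set `U (ε, x, y)`: the points `(s, t)` with `|s| < ε` between the curves of `x` and `y`,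
together with the open interval `(x, y)` of the long ray. -/
def basicU (ε : ℝ) (x y : ClosedLongRay) : Set (Nyikosization p φ f) :=
  union
    (φ '' {z : ℝ × ℝ | |z.1| < ε ∧ nyikosCurve (longExtension f x) z.1 < z.2 ∧
      z.2 < nyikosCurve (longExtension f y) z.1})
    (Set.Ioo x y)

/-- The set `V_ε`, where `w = (0, ε)` is the point `ε` of the closed long ray: the points `(s, t)`
with `|s| < ε` and `-ε < t` below the curve of `ε`, together with the interval `[0, ε)` of the
closed long ray. -/
def basicV (w : ClosedLongRay) : Set (Nyikosization p φ f) :=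
  union
    (φ '' {z : ℝ × ℝ | |z.1| < ((ofLex w).2 : ℝ) ∧ - ((ofLex w).2 : ℝ) < z.2 ∧
      z.2 < nyikosCurve (longExtension f w) z.1})
    (Set.Iio w)

/-- The topology of the Nyikosization, generated by the open subsets of `X ∖ {p}`, the sets
`U (ε, x, y)` with `ε > 0` and `x < y` in the open long ray, and the sets `V_ε` with
`0 < ε < 1`. -/
instance instTopologicalSpace [TopologicalSpace X] :
    TopologicalSpace (Nyikosization p φ f) :=
  TopologicalSpace.generateFrom
    ({S | ∃ A : Set X, IsOpen A ∧ S = union A ∅} ∪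
      {S | ∃ (ε : ℝ) (x y : ClosedLongRay), 0 < ε ∧ ¬ IsMin x ∧ x < y ∧ S = basicU ε x y} ∪
      {S | ∃ w : ClosedLongRay, IsMin (ofLex w).1 ∧ 0 < ((ofLex w).2 : ℝ) ∧ S = basicV w})

end Nyikosization

/-! ### Kronecker foliations of the torus -/

/-- The torus `ℝ² / ℤ²`. -/
abbrev Torus : Type :=
  UnitAddCircle × UnitAddCircle

/-- The point `q + t (1, a)` of the torus: the leaves of the Kronecker foliation of slope `a` are
the sets `{q + t (1, a) : t ∈ ℝ}`. -/
def kroneckerFlow (a t : ℝ) (q : Torus) : Torus :=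
  q + (((t : ℝ) : UnitAddCircle), ((a * t : ℝ) : UnitAddCircle))

/-- `φ` is a homeomorphism of the plane onto an open neighbourhood of `p` (a parallelogram with two
horizontal sides and two sides of slope `a`), with `φ 0 = p`, that maps horizontal lines into
horizontal circles and vertical lines into leaves of the Kronecker foliation of slope `a`,
preserving orientations:
`φ (s, t) = p + (u s, 0) + v t • (1, a)` with `u`, `v` continuous and increasing. -/
structure IsKroneckerBox (a : ℝ) (p : Torus) (φ : ℝ × ℝ → Torus) : Prop where
  isOpenEmbedding : Topology.IsOpenEmbedding φ
  map_zero : φ (0, 0) = p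
  form : ∃ u v : ℝ → ℝ, Continuous u ∧ StrictMono u ∧ u 0 = 0 ∧
    Continuous v ∧ StrictMono v ∧ v 0 = 0 ∧
    ∀ s t : ℝ, φ (s, t) = kroneckerFlow a (v t) (p + (((u s : ℝ) : UnitAddCircle), 0))

end

noncomputable section

open Set Filter Topology

/-! ### Countable ordinals -/

namespace CountableOrdinal

/-! The point is that the Nyikosization is foliated by the verticals of the box even along the
inserted long ray, so that the ray simply prolongs the vertical ending at `p` from below.

A chart around the part of the ray below a countable ordinal `α` is written down in one go, without
induction on `α`. Its transverse coordinate is the abscissa of the box. For each `β`, the position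
of a point in the strip between the curves of `β` and `β + 1`, clipped to `[0, 1]` (`stripCoord`),
extends continuously to the ray by the coordinate of the block of `β` (`unitCoord`); this is
`continuousAt_stripFun`. Since `α` is countable there are summable weights that are positive below
`α`. The leafwise coordinate is `v t` plus the weighted sum of the strip coordinates: summability
gives continuity, `v` makes it strictly increasing along verticals of the box, and the weights make
it strictly increasing on the ray below `α` (`injOn_rayMap`). Intermediate values, on the verticals
and on the ray, show that the map is open (`image_rayMap_mem_nhds`).

Away from the ray, charts are local inverses of the covering of the torus by the plane in flow
coordinates. Their transverse coordinates differ locally by constants from each other and from those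
of the ray charts, so all these charts generate one foliation (`baseAtlas_compatible`).

A parametrization that is locally a horizontal of a foliated chart is an open embedding for the leaf
topology (`IsLeafParam.isOpenEmbedding`). The listed sets all have such parametrizations, by `ℝ` or
by the long ray, and they partition the surface; being open and path connected they are the path
components (`pathComponent_eq_of_partition`). The long leaf is a negative half line followed by a
closed long ray; halving the first unit interval of the open long ray makes room for the half line.

Half orbits of an irrational flow are dense in the torus, and the punctured torus is dense in the
Nyikosization, whence minimality. The density of the far negative end of the long leaf prevents it
from being embedded. The surface is not metrisable and the long leaf is neither a line nor a circle
for the same reason: a map from the countable ordinals to a metric space that is continuous along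
increasing sequences is not injective. -/

theorem countable_Iio (α : CountableOrdinal) : (Iio α).Countable := by
  rw [← Cardinal.le_aleph0_iff_set_countable, ← Cardinal.lt_aleph_one_iff]
  have h := Cardinal.mk_Iio_lt α (by simp [← Cardinal.ord_aleph])
  simpa [← Cardinal.ord_aleph] using h

instance : Nonempty CountableOrdinal := by
  rw [Ordinal.nonempty_toType_iff]
  exact (Ordinal.omega_pos 1).ne'

instance : NoMaxOrder CountableOrdinal := by
  have := Cardinal.noMaxOrder (c := Cardinal.aleph 1) (Cardinal.aleph0_le_aleph 1)
  rwa [Cardinal.ord_aleph] at this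

theorem bddAbove_range (s : ℕ → CountableOrdinal) : BddAbove (range s) := by
  have h : ⨆ n, (Ordinal.ToType.toOrd (s n) : Ordinal) < Ordinal.omega 1 :=
    Ordinal.iSup_lt_omega_one fun n => (Ordinal.ToType.toOrd (s n)).2
  refine ⟨Ordinal.ToType.mk ⟨_, h⟩, ?_⟩
  rintro _ ⟨n, rfl⟩
  rw [← OrderIso.symm_apply_le]
  exact Ordinal.le_iSup (fun n => (Ordinal.ToType.toOrd (s n) : Ordinal)) n

theorem exists_isLUB_range (s : ℕ → CountableOrdinal) : ∃ b, IsLUB (range s) b := by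
  obtain ⟨b, hb, hmin⟩ := wellFounded_lt.has_min (upperBounds (range s)) (bddAbove_range s)
  exact ⟨b, hb, fun c hc => not_lt.1 (hmin c hc)⟩

theorem exists_isMin : ∃ α : CountableOrdinal, IsMin α := by
  obtain ⟨b, -, hmin⟩ := wellFounded_lt.has_min (univ : Set CountableOrdinal) univ_nonempty
  exact ⟨b, fun c _ => not_lt.1 (hmin c trivial)⟩

theorem eq_of_isMin {α β : CountableOrdinal} (hα : IsMin α) (hβ : IsMin β) : α = β :=
  le_antisymm ((le_total α β).elim id fun h => hα h) ((le_total β α).elim id fun h => hβ h)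

/-- A map from the countable ordinals to a metric space that is continuous along strictly
increasing sequences is not injective. -/
theorem not_injective_of_tendsto {Y : Type*} [MetricSpace Y] (F : CountableOrdinal → Y)
    (hF : ∀ (s : ℕ → CountableOrdinal) (b : CountableOrdinal), StrictMono s → IsLUB (range s) b →
      Tendsto (fun n => F (s n)) atTop (𝓝 (F b))) : ¬ Function.Injective F := by
  intro hinj
  -- Otherwise there are pairs with images `ε` apart beyond every ordinal. Interlacing such pairs
  -- gives two increasing sequences with the same supremum `b`, so both image sequences converge to
  -- `F b`, a contradiction.
  have key : ∀ ε > 0, ∃ α, ∀ x > α, ∀ y > α, dist (F x) (F y) < ε := by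
    intro ε hε
    by_contra! hcon
    choose x hx y hy hxy using hcon
    have hstep : ∀ α, ∃ β, x α < β ∧ y α < β := fun α =>
      (exists_gt (max (x α) (y α))).imp fun β hβ => max_lt_iff.1 hβ
    choose nxt hnx hny using hstep
    obtain ⟨α₀⟩ : Nonempty CountableOrdinal := inferInstance
    let a : ℕ → CountableOrdinal := fun n => nxt^[n] α₀
    have ha : ∀ n, a (n + 1) = nxt (a n) := fun n => Function.iterate_succ_apply' _ _ _
    have h1 : ∀ n, a n < x (a n) := fun n => hx _
    have h2 : ∀ n, a n < y (a n) := fun n => hy _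
    have h3 : ∀ n, x (a n) < a (n + 1) := fun n => ha n ▸ hnx _
    have h4 : ∀ n, y (a n) < a (n + 1) := fun n => ha n ▸ hny _
    obtain ⟨b, hb⟩ := exists_isLUB_range a
    have lub : ∀ z : ℕ → CountableOrdinal, (∀ n, a n < z n) → (∀ n, z n < a (n + 1)) →
        Tendsto (fun n => F (z n)) atTop (𝓝 (F b)) := by
      intro z hz1 hz2
      refine hF z b (strictMono_nat_of_lt_succ fun n => (hz2 n).trans (hz1 _)) ⟨?_, ?_⟩
      · rintro _ ⟨n, rfl⟩
        exact (hz2 n).le.trans (hb.1 ⟨_, rfl⟩)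
      · intro c hc
        refine hb.2 ?_
        rintro _ ⟨n, rfl⟩
        exact (hz1 n).le.trans (hc ⟨_, rfl⟩)
    have ht := (lub _ h1 h3).dist (lub _ h2 h4)
    rw [dist_self] at ht
    obtain ⟨n, hn⟩ := (ht.eventually (gt_mem_nhds hε)).exists
    exact absurd hn (not_lt.2 (hxy _))
  -- Countably many thresholds are bounded, and `F` is constant beyond a common bound.
  choose α hα using fun n : ℕ => key (1 / ((n : ℝ) + 1)) (by positivity)
  obtain ⟨b, hb⟩ := bddAbove_range α
  obtain ⟨x, hx⟩ := exists_gt b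
  obtain ⟨y, hy⟩ := exists_gt x
  refine hy.ne (hinj (dist_le_zero.1 (le_of_forall_pos_le_add fun ε hε => ?_)))
  obtain ⟨n, hn⟩ := exists_nat_one_div_lt hε
  have hbn : α n ≤ b := hb ⟨n, rfl⟩
  have := hα n x (hbn.trans_lt hx) y (hbn.trans_lt (hx.trans hy))
  linarith

/-- Positive weights with a finite sum on a proper initial segment of the countable ordinals. -/
theorem exists_weights (α : CountableOrdinal) : ∃ w : CountableOrdinal → ℝ,
    Summable w ∧ (∀ β, 0 ≤ w β) ∧ ∀ β < α, 0 < w β := by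
  have := (countable_Iio α).to_subtype
  have := Encodable.ofCountable (Iio α)
  obtain ⟨w, hw, c, hc, -⟩ := posSumOfEncodable one_pos (Iio α)
  classical
  -- The initial segment is countable, so it carries positive weights with a finite sum; they are
  -- extended by zero.
  refine ⟨fun β => if h : β < α then w ⟨β, h⟩ else 0, ?_, fun β => ?_, fun β h => ?_⟩
  · have h : Summable ((fun β => if h : β < α then w ⟨β, h⟩ else 0) ∘ ((↑) : Iio α → _)) := by
      convert hc.summable using 1
      ext ⟨β, hβ⟩
      exact dif_pos hβ
    rw [summable_subtype_iff_indicator] at h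
    convert h using 1
    ext β
    by_cases hβ : β < α <;> simp [indicator, hβ]
  · dsimp only
    split_ifs
    exacts [(hw _).le, le_rfl]
  · simp [h, hw]

end CountableOrdinal

/-! ### Existence of Nyikos sequences -/

/-- Diagonal argument: with an enumeration `e` of the family, the sum of all `e m k` with `m, k ≤ n`
bounds `e m n` as soon as `n ≥ m`. Summing over `k` as well keeps the bound monotone, and the term
`n + 1` makes it strictly increasing and larger than `n`. -/
theorem exists_strictMono_eventually_gt {A : Set (ℕ → ℕ)} (hA : A.Countable) :
    ∃ g : ℕ → ℕ, StrictMono g ∧ (∀ n, n < g n) ∧ ∀ h ∈ A, ∀ᶠ n in atTop, h n < g n := by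
  obtain rfl | hne := A.eq_empty_or_nonempty
  · exact ⟨fun n => n + 1, fun a b h => Nat.succ_lt_succ h, fun n => n.lt_succ_self, by simp⟩
  obtain ⟨e, rfl⟩ := hA.exists_eq_range hne
  refine ⟨fun n => n + 1 + ∑ m ∈ Finset.range (n + 1), ∑ k ∈ Finset.range (n + 1), e m k,
    strictMono_nat_of_lt_succ fun n => ?_, fun n => by dsimp only; omega, ?_⟩
  · refine add_lt_add_of_lt_of_le (by omega) ?_
    refine (Finset.sum_le_sum fun m _ => ?_).trans
      (Finset.sum_le_sum_of_subset (Finset.range_mono (by omega)))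
    exact Finset.sum_le_sum_of_subset (Finset.range_mono (by omega))
  · rintro _ ⟨m, rfl⟩
    filter_upwards [eventually_ge_atTop m] with n hn
    have h1 : e m n ≤ ∑ k ∈ Finset.range (n + 1), e m k :=
      Finset.single_le_sum (f := fun k => e m k) (fun _ _ => Nat.zero_le _)
        (Finset.mem_range.2 n.lt_succ_self)
    have h2 : ∑ k ∈ Finset.range (n + 1), e m k ≤
        ∑ m ∈ Finset.range (n + 1), ∑ k ∈ Finset.range (n + 1), e m k :=
      Finset.single_le_sum (f := fun m => ∑ k ∈ Finset.range (n + 1), e m k)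
        (fun _ _ => Nat.zero_le _) (Finset.mem_range.2 (by omega))
    omega

/-- Transfinite recursion: the identity at the least ordinal, adding `1` at successors, and the
diagonal bound at limits, which have only countably many predecessors. The recursion does not ask
the earlier functions to be increasing or ordered; this is proved afterwards by induction. -/
theorem exists_isNyikosSequence : ∃ f, IsNyikosSequence f := by
  classical
  let G : ∀ α : CountableOrdinal, (∀ β, β < α → ℕ → ℕ) → ℕ → ℕ := fun α ih =>
    if IsMin α then id
    else if h : ∃ β, β ⋖ α then fun n => ih h.choose h.choose_spec.lt n + 1
    else (exists_strictMono_eventually_gt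
      (A := range fun β : Iio α => ih β β.2)
      (by have := (CountableOrdinal.countable_Iio α).to_subtype; exact countable_range _)).choose
  let f : CountableOrdinal → ℕ → ℕ := wellFounded_lt.fix G
  have hf : ∀ α, f α = G α fun β _ => f β := fun α => wellFounded_lt.fix_eq G α
  have hzero : ∀ α, IsMin α → f α = id := fun α h => by rw [hf]; simp only [G, if_pos h]
  have hsucc : ∀ α β, α ⋖ β → f β = fun n => f α n + 1 := by
    intro α β h
    have hm : ¬ IsMin β := fun hm => h.lt.not_ge (hm h.lt.le)
    have hex : ∃ γ, γ ⋖ β := ⟨α, h⟩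
    rw [hf]
    simp only [G, if_neg hm, dif_pos hex]
    rw [hex.choose_spec.unique_left h]
  have hlim : ∀ α, ¬ IsMin α → (¬ ∃ β, β ⋖ α) →
      StrictMono (f α) ∧ (∀ n, n < f α n) ∧ ∀ β < α, ∀ᶠ n in atTop, f β n < f α n := by
    intro α hm hex
    rw [hf]
    simp only [G, if_neg hm, dif_neg hex]
    generalize_proofs pf
    exact ⟨pf.choose_spec.1, pf.choose_spec.2.1,
      fun β hβ => pf.choose_spec.2.2 _ ⟨⟨β, hβ⟩, rfl⟩⟩
  have hmono : ∀ α, StrictMono (f α) := by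
    intro α
    induction α using WellFoundedLT.induction with
    | _ α ih =>
    by_cases hm : IsMin α
    · rw [hzero α hm]; exact strictMono_id
    by_cases hex : ∃ β, β ⋖ α
    · obtain ⟨β, hβ⟩ := hex
      rw [hsucc β α hβ]
      exact (ih β hβ.lt).add_const 1
    · exact (hlim α hm hex).1
  refine ⟨f, hmono, ?_, fun α h n => by rw [hzero α h]; rfl, ?_,
    fun α β h n => by rw [hsucc α β h]⟩
  · intro α β
    induction β using WellFoundedLT.induction with
    | _ β ih =>
    intro hαβ
    have hm : ¬ IsMin β := fun hm => hαβ.not_ge (hm hαβ.le)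
    by_cases hex : ∃ γ, γ ⋖ β
    · obtain ⟨γ, hγ⟩ := hex
      rw [hsucc γ β hγ]
      obtain rfl | hlt := (hγ.le_of_lt hαβ).eq_or_lt
      · exact Eventually.of_forall fun n => Nat.lt_succ_self _
      · exact (ih γ hγ.lt hlt).mono fun n hn => hn.trans (Nat.lt_succ_self _)
    · exact (hlim β hm hex).2.2 α hαβ
  · intro α hm n
    by_cases hex : ∃ γ, γ ⋖ α
    · obtain ⟨γ, hγ⟩ := hex
      rw [hsucc γ α hγ]
      exact Nat.lt_succ_of_le ((hmono γ).le_apply)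
    · exact (hlim α hm hex).2.1 n

/-! ### The curves of a Nyikosization -/

theorem nyikosCurve_zero (h : ℕ → ℝ) : nyikosCurve h 0 = 0 := by simp [nyikosCurve]

theorem nyikosCurve_of_one_le (h : ℕ → ℝ) {s : ℝ} (hs : 1 ≤ |s|) :
    nyikosCurve h s = -(1 / h 1) := by
  have : s ≠ 0 := by rintro rfl; norm_num at hs
  simp [nyikosCurve, this, hs]

theorem nyikosCurve_eq_of_mem_band {n : ℕ} (hn : 1 ≤ n) {s : ℝ} (h1 : 1 / ((n : ℝ) + 1) ≤ |s|)
    (h2 : |s| ≤ 1 / (n : ℝ)) (h : ℕ → ℝ) :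
    nyikosCurve h s = (|s| - 1 / (n + 1)) * (n * (n + 1)) * (-(1 / h n)) +
      (1 - (|s| - 1 / (n + 1)) * (n * (n + 1))) * (-(1 / h (n + 1))) := by
  have hn0 : (0 : ℝ) < n := by exact_mod_cast hn
  have hs : 0 < |s| := lt_of_lt_of_le (by positivity) h1
  have hs0 : s ≠ 0 := abs_pos.1 hs
  -- At the common endpoint of two bands the floor selects the outer or the inner formula by
  -- convention; both give the prescribed value there, so the formula of a band holds on the closed
  -- band.
  have hband : ∀ m : ℕ, 1 ≤ m → |s| = 1 / (m : ℝ) → nyikosCurve h s = -(1 / h m) := by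
    intro m hm hsm
    have hm0 : (0 : ℝ) < m := by exact_mod_cast hm
    by_cases h1' : 1 ≤ |s|
    · have hm1 : m = 1 := by
        rw [hsm, le_div_iff₀ hm0, one_mul] at h1'
        have : m ≤ 1 := by exact_mod_cast h1'
        omega
      rw [nyikosCurve_of_one_le h h1', hm1]
    · have hfl : ⌊1 / |s|⌋₊ = m := by rw [hsm, one_div_one_div, Nat.floor_natCast]
      have hc : (|s| - 1 / ((m : ℝ) + 1)) * (m * (m + 1)) = 1 := by
        rw [hsm]; field_simp; ring
      simp only [nyikosCurve, hs0, h1', if_false, hfl, hc]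
      ring
  rcases h2.eq_or_lt with h2 | h2
  · have hc : (|s| - 1 / ((n : ℝ) + 1)) * (n * (n + 1)) = 1 := by
      rw [h2]; field_simp; ring
    rw [hband n hn h2, hc]; ring
  rcases h1.eq_or_lt with h1 | h1
  · have := hband (n + 1) (by omega) (by push_cast; exact h1.symm)
    rw [this, ← h1]; ring
  have hlt : |s| < 1 := h2.trans_le (by rw [div_le_one hn0]; exact_mod_cast hn)
  have hfl : ⌊1 / |s|⌋₊ = n := by
    rw [Nat.floor_eq_iff (by positivity)]
    constructor
    · rw [le_div_iff₀ hs]; rw [lt_div_iff₀ hn0] at h2; linarith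
    · rw [div_lt_iff₀ hs]; rw [div_lt_iff₀ (by positivity)] at h1; linarith
  simp only [nyikosCurve, hs0, not_le.2 hlt, if_false, hfl]

theorem exists_band {s : ℝ} (hs0 : s ≠ 0) (hs : |s| ≤ 1) :
    ∃ n : ℕ, 1 ≤ n ∧ 1 / ((n : ℝ) + 1) ≤ |s| ∧ |s| ≤ 1 / (n : ℝ) := by
  have hs' : 0 < |s| := abs_pos.2 hs0
  have h1 : 1 ≤ 1 / |s| := by rw [le_div_iff₀ hs']; linarith
  have hn : 1 ≤ ⌊1 / |s|⌋₊ := (Nat.one_le_floor_iff _).2 h1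
  have hn0 : (0 : ℝ) < ⌊1 / |s|⌋₊ := by exact_mod_cast hn
  refine ⟨_, hn, ?_, ?_⟩
  · rw [div_le_iff₀ (by positivity)]
    have := (Nat.lt_floor_add_one (1 / |s|)).le
    rw [div_le_iff₀ hs'] at this
    linarith
  · rw [le_div_iff₀ hn0]
    have := Nat.floor_le (a := 1 / |s|) (by positivity)
    rw [le_div_iff₀ hs'] at this
    linarith

/-- All curves are, at a given abscissa, the same convex combination of two consecutive values. -/
theorem exists_nyikosCurve_eq {s : ℝ} (hs0 : s ≠ 0) :
    ∃ (n : ℕ) (c : ℝ), 1 ≤ n ∧ 0 ≤ c ∧ c ≤ 1 ∧ 1 / ((n : ℝ) + 1) ≤ |s| ∧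
      (c * (1 / (n : ℝ)) + (1 - c) * (1 / ((n : ℝ) + 1)) ≤ |s|) ∧
      (∀ N : ℕ, 1 ≤ N → |s| < 1 / (N : ℝ) → N ≤ n) ∧
      ∀ h : ℕ → ℝ, nyikosCurve h s = c * (-(1 / h n)) + (1 - c) * (-(1 / h (n + 1))) := by
  rcases le_total 1 |s| with hs | hs
  · refine ⟨1, 1, le_rfl, zero_le_one, le_rfl, ?_, ?_, fun N hN h => ?_, fun h => ?_⟩
    · norm_num; linarith
    · norm_num; linarith
    · exfalso
      have hN0 : (1 : ℝ) ≤ N := by exact_mod_cast hN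
      have : 1 / (N : ℝ) ≤ 1 := by rw [div_le_one (by linarith)]; exact hN0
      linarith
    · rw [nyikosCurve_of_one_le h hs]; ring
  · obtain ⟨n, hn, h1, h2⟩ := exists_band hs0 hs
    have hn0 : (0 : ℝ) < n := by exact_mod_cast hn
    refine ⟨n, _, hn, ?_, ?_, h1, ?_, ?_, nyikosCurve_eq_of_mem_band hn h1 h2⟩
    · exact mul_nonneg (sub_nonneg.2 h1) (by positivity)
    · have : |s| - 1 / ((n : ℝ) + 1) ≤ 1 / n - 1 / (n + 1) := by linarith
      calc (|s| - 1 / ((n : ℝ) + 1)) * (n * (n + 1)) ≤ (1 / n - 1 / (n + 1)) * (n * (n + 1)) := by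
            gcongr
        _ = 1 := by field_simp; ring
    · apply le_of_eq; field_simp; ring
    · intro N hN h
      have hN0 : (0 : ℝ) < N := by exact_mod_cast hN
      have h3 := h1.trans_lt h
      rw [div_lt_div_iff₀ (by positivity) hN0] at h3
      have : N < n + 1 := by exact_mod_cast (by linarith : (N : ℝ) < n + 1)
      omega

theorem nyikosCurve_neg_of_ne {h : ℕ → ℝ} (hh : ∀ n : ℕ, 1 ≤ n → (n : ℝ) ≤ h n) {s : ℝ} (hs : s ≠ 0) :
    nyikosCurve h s < 0 := by
  obtain ⟨n, c, hn, hc0, hc1, -, -, -, e⟩ := exists_nyikosCurve_eq hs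
  rw [e]
  have hp : ∀ m, 1 ≤ m → 0 < 1 / h m := fun m hm =>
    one_div_pos.2 (lt_of_lt_of_le (by exact_mod_cast hm) (hh m hm))
  have h1 := hp n hn
  have h2 := hp (n + 1) (by omega)
  rcases hc0.eq_or_lt with rfl | hc
  · linarith
  · nlinarith [mul_pos hc h1, mul_nonneg (sub_nonneg.2 hc1) h2.le]

/-- Since `h n ≥ n`, the curve lies above the interpolation of the values `-1/n`, which is at least
`-|s|`. This wedge gives continuity at `0` and keeps every curve inside small boxes. -/
theorem neg_abs_le_nyikosCurve {h : ℕ → ℝ} (hh : ∀ n : ℕ, 1 ≤ n → (n : ℝ) ≤ h n) (s : ℝ) :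
    -|s| ≤ nyikosCurve h s := by
  rcases eq_or_ne s 0 with rfl | hs
  · simp [nyikosCurve_zero]
  obtain ⟨n, c, hn, hc0, hc1, -, hle, -, e⟩ := exists_nyikosCurve_eq hs
  rw [e]
  have hn0 : (0 : ℝ) < n := by exact_mod_cast hn
  have h1 : 1 / h n ≤ 1 / n := one_div_le_one_div_of_le hn0 (hh n hn)
  have h2 : 1 / h (n + 1) ≤ 1 / (n + 1) :=
    one_div_le_one_div_of_le (by positivity) (by exact_mod_cast hh (n + 1) (by omega))
  have h3 := mul_le_mul_of_nonneg_left h1 hc0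
  have h4 := mul_le_mul_of_nonneg_left h2 (sub_nonneg.2 hc1)
  linarith

/-- For `|s| < 1/N` the two interpolated indices are at least `N`. Eventual domination of sequences
thus becomes a strict inequality of germs of curves at `0`, off the point `0` itself. -/
theorem nyikosCurve_lt {h k : ℕ → ℝ} {N : ℕ} (hN : 1 ≤ N) (h0 : ∀ n, 1 ≤ n → 0 < h n)
    (hk : ∀ n, N ≤ n → h n < k n) {s : ℝ} (hs : s ≠ 0) (hsN : |s| < 1 / (N : ℝ)) :
    nyikosCurve h s < nyikosCurve k s := by
  obtain ⟨n, c, hn, hc0, hc1, -, -, hNn, e⟩ := exists_nyikosCurve_eq hs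
  rw [e, e]
  have hNn := hNn N hN hsN
  have hp : ∀ m, N ≤ m → -(1 / h m) < -(1 / k m) := fun m hm =>
    neg_lt_neg (one_div_lt_one_div_of_lt (h0 m (by omega)) (hk m hm))
  have h1 := hp n hNn
  have h2 := hp (n + 1) (by omega)
  rcases hc0.eq_or_lt with rfl | hc
  · linarith
  · nlinarith [mul_lt_mul_of_pos_left h1 hc, mul_le_mul_of_nonneg_left h2.le (sub_nonneg.2 hc1)]

theorem nyikosCurve_lt_of_forall {h k : ℕ → ℝ} (h0 : ∀ n, 1 ≤ n → 0 < h n)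
    (hk : ∀ n, 1 ≤ n → h n < k n) {s : ℝ} (hs : s ≠ 0) :
    nyikosCurve h s < nyikosCurve k s := by
  obtain ⟨n, c, hn, hc0, hc1, -, -, -, e⟩ := exists_nyikosCurve_eq hs
  rw [e, e]
  have hp : ∀ m, 1 ≤ m → -(1 / h m) < -(1 / k m) := fun m hm =>
    neg_lt_neg (one_div_lt_one_div_of_lt (h0 m hm) (hk m hm))
  have h1 := hp n hn
  have h2 := hp (n + 1) (by omega)
  rcases hc0.eq_or_lt with rfl | hc
  · linarith
  · nlinarith [mul_lt_mul_of_pos_left h1 hc, mul_le_mul_of_nonneg_left h2.le (sub_nonneg.2 hc1)]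

/-- Away from `0` finitely many closed bands are glued together, by induction on their number; at
`0` the curve is squeezed between `-|s|` and `0`. -/
theorem continuous_nyikosCurve {h : ℕ → ℝ} (hh : ∀ n : ℕ, 1 ≤ n → (n : ℝ) ≤ h n) :
    Continuous (nyikosCurve h) := by
  have hon : ∀ N : ℕ, ContinuousOn (nyikosCurve h) {s | 1 / ((N : ℝ) + 1) ≤ |s|} := by
    intro N
    induction N with
    | zero =>
      refine (continuousOn_const (c := -(1 / h 1))).congr fun s hs => ?_
      exact nyikosCurve_of_one_le h (by simpa using hs)
    | succ n ih =>
      have hu : {s : ℝ | 1 / (((n + 1 : ℕ) : ℝ) + 1) ≤ |s|} ⊆ {s | 1 / ((n : ℝ) + 1) ≤ |s|} ∪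
          {s | 1 / (((n + 1 : ℕ) : ℝ) + 1) ≤ |s| ∧ |s| ≤ 1 / ((n + 1 : ℕ) : ℝ)} := by
        intro s hs
        rcases le_total (1 / ((n : ℝ) + 1)) |s| with h | h
        · exact Or.inl h
        · exact Or.inr ⟨hs, by push_cast; exact h⟩
      refine (ContinuousOn.union_of_isClosed ih ?_ ?_ ?_).mono hu
      · refine ContinuousOn.congr (f := fun s : ℝ =>
          (|s| - 1 / (((n + 1 : ℕ) : ℝ) + 1)) * (((n + 1 : ℕ) : ℝ) * (((n + 1 : ℕ) : ℝ) + 1)) *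
            (-(1 / h (n + 1))) +
          (1 - (|s| - 1 / (((n + 1 : ℕ) : ℝ) + 1)) *
            (((n + 1 : ℕ) : ℝ) * (((n + 1 : ℕ) : ℝ) + 1))) * (-(1 / h (n + 1 + 1)))) ?_
          fun s hs => nyikosCurve_eq_of_mem_band (by omega) hs.1 hs.2 h
        fun_prop
      · exact isClosed_le continuous_const continuous_abs
      · exact (isClosed_le continuous_const continuous_abs).inter
          (isClosed_le continuous_abs continuous_const)
  rw [continuous_iff_continuousAt]
  intro s
  rcases eq_or_ne s 0 with rfl | hs
  · rw [ContinuousAt, nyikosCurve_zero]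
    have hle : ∀ s, nyikosCurve h s ≤ 0 := fun s => by
      rcases eq_or_ne s 0 with rfl | hs
      · rw [nyikosCurve_zero]
      · exact (nyikosCurve_neg_of_ne hh hs).le
    refine tendsto_of_tendsto_of_tendsto_of_le_of_le (g := fun s : ℝ => -|s|) ?_
      tendsto_const_nhds (neg_abs_le_nyikosCurve hh) hle
    have : Continuous fun s : ℝ => -|s| := by fun_prop
    simpa using this.tendsto 0
  · obtain ⟨N, hN⟩ := exists_nat_one_div_lt (abs_pos.2 hs)
    exact (hon N).continuousAt (mem_of_superset
      ((isOpen_lt continuous_const continuous_abs).mem_nhds hN)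
      (ofPred_subset_ofPred.2 fun x hx => le_of_lt hx))

/-- The vertical position of the curve of `h + r` between those of `h` and `h + 1`. -/
theorem nyikosCurve_add_bounds {h : ℕ → ℝ} (hh : ∀ n : ℕ, 1 ≤ n → (n : ℝ) ≤ h n) {r : ℝ}
    (hr0 : 0 ≤ r) (hr1 : r ≤ 1) {s : ℝ} (hs : s ≠ 0) :
    r * (nyikosCurve (fun n => h n + 1) s - nyikosCurve h s) ≤
        nyikosCurve (fun n => h n + r) s - nyikosCurve h s ∧
      nyikosCurve (fun n => h n + r) s - nyikosCurve h s ≤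
        r * (1 + 2 * |s|) * (nyikosCurve (fun n => h n + 1) s - nyikosCurve h s) := by
  obtain ⟨n, c, hn, hc0, hc1, hns, -, -, e⟩ := exists_nyikosCurve_eq hs
  rw [e, e, e]
  -- The middle term is `r / (h (h + r))`, the outer ones are multiples of `r / (h (h + 1))`, and
  -- their ratio `(h + 1) / (h + r)` lies between `1` and `1 + 1 / h`.
  have key : ∀ m, n ≤ m → r * (-(1 / (h m + 1)) - -(1 / h m)) ≤ -(1 / (h m + r)) - -(1 / h m) ∧
      -(1 / (h m + r)) - -(1 / h m) ≤ r * (1 + 2 * |s|) * (-(1 / (h m + 1)) - -(1 / h m)) := by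
    intro m hm
    have hm1 : (1 : ℝ) ≤ m := by exact_mod_cast hn.trans hm
    have hmn : (n : ℝ) ≤ m := by exact_mod_cast hm
    have hhm := hh m (hn.trans hm)
    have hp : 0 < h m := by linarith
    have e1 : -(1 / (h m + 1)) - -(1 / h m) = 1 / (h m * (h m + 1)) := by field_simp; ring
    have e2 : -(1 / (h m + r)) - -(1 / h m) = r * (1 / (h m * (h m + r))) := by
      field_simp; ring
    have hn1 : (1 : ℝ) ≤ n := by exact_mod_cast hn
    -- From `|s| ≥ 1 / (n + 1) ≥ 1 / (2 n)` and `h m ≥ m ≥ n`; hence `1 / h m ≤ 2 |s|`.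
    have h2 : 1 ≤ 2 * |s| * h m := by
      rw [div_le_iff₀ (by positivity)] at hns
      nlinarith [abs_nonneg s, mul_le_mul_of_nonneg_left (hmn.trans hhm) (abs_nonneg s),
        mul_le_mul_of_nonneg_left hn1 (abs_nonneg s)]
    rw [e1, e2, mul_assoc]
    constructor
    · gcongr
    · gcongr
      rw [mul_one_div, div_le_div_iff₀ (by positivity) (by positivity), one_mul]
      have h3 : h m + 1 ≤ (1 + 2 * |s|) * (h m + r) := by nlinarith [mul_nonneg (abs_nonneg s) hr0]
      nlinarith [mul_le_mul_of_nonneg_left h3 hp.le]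
  obtain ⟨a1, b1⟩ := key n le_rfl
  obtain ⟨a2, b2⟩ := key (n + 1) (by omega)
  have hc1' := sub_nonneg.2 hc1
  constructor
  · linarith [mul_le_mul_of_nonneg_left a1 hc0, mul_le_mul_of_nonneg_left a2 hc1']
  · linarith [mul_le_mul_of_nonneg_left b1 hc0, mul_le_mul_of_nonneg_left b2 hc1']

/-! ### The closed long ray -/

instance : OrderTopology ClosedLongRay := ⟨rfl⟩

namespace ClosedLongRay

/-- The point `α + r` of the closed long ray. -/
def point (α : CountableOrdinal) (r : Ico (0 : ℝ) 1) : ClosedLongRay := toLex (α, r)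

/-- The integral point `α` of the closed long ray. -/
def base (α : CountableOrdinal) : ClosedLongRay := point α ⟨0, by norm_num⟩

/-- The ordinal part of a point. -/
def ord (x : ClosedLongRay) : CountableOrdinal := (ofLex x).1

/-- The fractional part of a point. -/
def frac (x : ClosedLongRay) : ℝ := ((ofLex x).2 : ℝ)

@[simp] theorem ord_point (α r) : (point α r).ord = α := rfl
@[simp] theorem frac_point (α r) : (point α r).frac = r := rfl
@[simp] theorem ord_base (α) : (base α).ord = α := rfl
@[simp] theorem frac_base (α) : (base α).frac = 0 := rfl

theorem frac_nonneg (x : ClosedLongRay) : 0 ≤ x.frac := (ofLex x).2.2.1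
theorem frac_lt_one (x : ClosedLongRay) : x.frac < 1 := (ofLex x).2.2.2

theorem lt_iff {x y : ClosedLongRay} : x < y ↔ x.ord < y.ord ∨ x.ord = y.ord ∧ x.frac < y.frac :=
  Prod.Lex.lt_iff

theorem eq_of_ord_frac {x y : ClosedLongRay} (h1 : x.ord = y.ord) (h2 : x.frac = y.frac) :
    x = y :=
  ofLex.injective (Prod.ext h1 (Subtype.ext h2))

theorem ord_mono {x y : ClosedLongRay} (h : x ≤ y) : x.ord ≤ y.ord := by
  rcases h.eq_or_lt with rfl | h
  · exact le_rfl
  · rcases lt_iff.1 h with h | h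
    exacts [h.le, h.1.le]

theorem lt_base_iff {x : ClosedLongRay} {α : CountableOrdinal} : x < base α ↔ x.ord < α := by
  rw [lt_iff]
  simp [(frac_nonneg x).not_gt]

theorem isMin_iff {x : ClosedLongRay} : IsMin x ↔ IsMin x.ord ∧ x.frac = 0 := by
  constructor
  · intro h
    constructor
    · intro β hβ
      by_contra hcon
      have h0 : base β < x := lt_iff.2 (Or.inl (not_le.1 hcon))
      exact h0.not_ge (h h0.le)
    · by_contra hcon
      have h0 : base x.ord < x :=
        lt_iff.2 (Or.inr ⟨rfl, lt_of_le_of_ne (frac_nonneg x) (Ne.symm hcon)⟩)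
      exact h0.not_ge (h h0.le)
  · rintro ⟨h1, h2⟩ y hy
    refine not_lt.1 fun hlt => ?_
    rcases lt_iff.1 hlt with h | h
    · exact h.not_ge (h1 h.le)
    · rw [h2] at h
      exact h.2.not_ge (frac_nonneg y)

theorem exists_isMin : ∃ x : ClosedLongRay, IsMin x :=
  CountableOrdinal.exists_isMin.imp' base fun _ h => isMin_iff.2 ⟨h, rfl⟩

theorem lt_of_isMin {x y : ClosedLongRay} (hx : IsMin x) (hy : ¬ IsMin y) : x < y := by
  rcases lt_trichotomy x y with h | rfl | h
  exacts [h, absurd hx hy, absurd (hx h.le) h.not_ge]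

theorem exists_not_isMin_lt {x : ClosedLongRay} (hx : ¬ IsMin x) : ∃ y, ¬ IsMin y ∧ y < x := by
  obtain ⟨m, hm⟩ := exists_isMin
  obtain ⟨y, hy1, hy2⟩ := exists_between (lt_of_isMin hm hx)
  exact ⟨y, not_isMin_of_lt hy1, hy2⟩

/-- The coordinate of the interval `[β, β + 1]`, constant outside of this interval. -/
def unitCoord (β : CountableOrdinal) (x : ClosedLongRay) : ℝ :=
  if x.ord < β then 0 else if x.ord = β then x.frac else 1

theorem unitCoord_nonneg (β x) : 0 ≤ unitCoord β x := by
  unfold unitCoord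
  split_ifs
  exacts [le_rfl, frac_nonneg x, zero_le_one]

theorem unitCoord_le_one (β x) : unitCoord β x ≤ 1 := by
  unfold unitCoord
  split_ifs
  exacts [zero_le_one, (frac_lt_one x).le, le_rfl]

/-- The case `r = 0` must be excluded: points of earlier blocks have coordinate `0` although they
lie below `β`. In the reverse comparison no such exception occurs, because points of later blocks
have coordinate `1 > r`. -/
theorem lt_point_iff {β : CountableOrdinal} {x : ClosedLongRay} {r : Ico (0 : ℝ) 1}
    (hr : 0 < (r : ℝ)) : x < point β r ↔ unitCoord β x < r := by
  rw [lt_iff, unitCoord]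
  rcases lt_trichotomy x.ord β with h | h | h
  · simp [h, hr]
  · simp [h]
  · simp [h.not_gt, h.ne', r.2.2.le]

theorem point_lt_iff {β : CountableOrdinal} {x : ClosedLongRay} {r : Ico (0 : ℝ) 1} :
    point β r < x ↔ (r : ℝ) < unitCoord β x := by
  rw [lt_iff, unitCoord]
  rcases lt_trichotomy x.ord β with h | h | h
  · simp [h, h.not_gt, h.ne', r.2.1]
  · simp [h]
  · simp [h, h.not_gt, h.ne', r.2.2]

theorem unitCoord_mono (β : CountableOrdinal) : Monotone (unitCoord β) := by
  intro x y hxy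
  by_contra! hcon
  obtain ⟨r, h1, h2⟩ := exists_between hcon
  have hr : r ∈ Ico (0 : ℝ) 1 :=
    ⟨(unitCoord_nonneg β y).trans h1.le, h2.trans_le (unitCoord_le_one β x)⟩
  have h3 : y < point β ⟨r, hr⟩ := (lt_point_iff ((unitCoord_nonneg β y).trans_lt h1)).2 h1
  have h4 : point β ⟨r, hr⟩ < x := point_lt_iff.2 h2
  exact (h3.trans h4).not_ge hxy

end ClosedLongRay

open ClosedLongRay

/-! ### The curves of the points of the long ray -/

/-- The curve of a point of the closed long ray. -/
def rayCurve (f : CountableOrdinal → ℕ → ℕ) (x : ClosedLongRay) (s : ℝ) : ℝ :=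
  nyikosCurve (longExtension f x) s

section rayCurve

variable {f : CountableOrdinal → ℕ → ℕ}

theorem longExtension_eq (f : CountableOrdinal → ℕ → ℕ) (x : ClosedLongRay) (n : ℕ) :
    longExtension f x n = f x.ord n + x.frac := rfl

theorem rayCurve_zero (f : CountableOrdinal → ℕ → ℕ) (x : ClosedLongRay) : rayCurve f x 0 = 0 :=
  nyikosCurve_zero _

namespace IsNyikosSequence

variable (hf : IsNyikosSequence f)
include hf

theorem le_longExtension (x : ClosedLongRay) (n : ℕ) (_ : 1 ≤ n) :
    (n : ℝ) ≤ longExtension f x n := by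
  have h : n ≤ f x.ord n := (hf.strictMono _).le_apply
  have h' : (n : ℝ) ≤ f x.ord n := by exact_mod_cast h
  rw [longExtension_eq]
  linarith [frac_nonneg x]

theorem longExtension_pos (x : ClosedLongRay) (n : ℕ) (hn : 1 ≤ n) : 0 < longExtension f x n :=
  lt_of_lt_of_le (by exact_mod_cast hn) (hf.le_longExtension x n hn)

theorem rayCurve_neg (x : ClosedLongRay) {s : ℝ} (hs : s ≠ 0) : rayCurve f x s < 0 :=
  nyikosCurve_neg_of_ne (hf.le_longExtension x) hs

theorem rayCurve_nonpos (x : ClosedLongRay) (s : ℝ) : rayCurve f x s ≤ 0 := by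
  rcases eq_or_ne s 0 with rfl | hs
  exacts [(rayCurve_zero f x).le, (hf.rayCurve_neg x hs).le]

theorem neg_abs_le_rayCurve (x : ClosedLongRay) (s : ℝ) : -|s| ≤ rayCurve f x s :=
  neg_abs_le_nyikosCurve (hf.le_longExtension x) s

theorem continuous_rayCurve (x : ClosedLongRay) : Continuous (rayCurve f x) :=
  continuous_nyikosCurve (hf.le_longExtension x)

theorem rayCurve_lt_of_ord_eq {x y : ClosedLongRay} (h1 : x.ord = y.ord) (h2 : x.frac < y.frac)
    {s : ℝ} (hs : s ≠ 0) : rayCurve f x s < rayCurve f y s := by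
  refine nyikosCurve_lt_of_forall (hf.longExtension_pos x) (fun n _ => ?_) hs
  rw [longExtension_eq, longExtension_eq, h1]
  linarith

theorem exists_rayCurve_lt {x y : ClosedLongRay} (h : x < y) :
    ∃ ε > 0, ∀ s, s ≠ 0 → |s| < ε → rayCurve f x s < rayCurve f y s := by
  rcases ClosedLongRay.lt_iff.1 h with h | h
  · obtain ⟨N, hN⟩ := eventually_atTop.1 (hf.eventually_lt _ _ h)
    refine ⟨1 / ((max N 1 : ℕ) : ℝ), one_div_pos.2 (by simp), fun s hs hsN =>
      nyikosCurve_lt (le_max_right N 1) (hf.longExtension_pos x) (fun n hn => ?_) hs hsN⟩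
    rw [longExtension_eq, longExtension_eq]
    -- Integrality provides a gap of `1`, which absorbs the fractional part of `x`.
    have h2 : f x.ord n + 1 ≤ f y.ord n := hN n ((le_max_left _ _).trans hn)
    have h3 : (f x.ord n : ℝ) + 1 ≤ f y.ord n := by exact_mod_cast h2
    linarith [frac_lt_one x, frac_nonneg y]
  · exact ⟨1, one_pos, fun s hs _ => hf.rayCurve_lt_of_ord_eq h.1 h.2 hs⟩

theorem exists_rayCurve_le {x y : ClosedLongRay} (h : x ≤ y) :
    ∃ ε > 0, ∀ s, |s| < ε → rayCurve f x s ≤ rayCurve f y s := by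
  rcases h.eq_or_lt with rfl | h
  · exact ⟨1, one_pos, fun _ _ => le_rfl⟩
  · obtain ⟨ε, hε, H⟩ := hf.exists_rayCurve_lt h
    refine ⟨ε, hε, fun s hs => ?_⟩
    rcases eq_or_ne s 0 with rfl | hs0
    · rw [rayCurve_zero, rayCurve_zero]
    · exact (H s hs0 hs).le

end IsNyikosSequence

/-- The upper boundary of the strip of the interval `[β, β + 1]`. -/
def upperCurve (f : CountableOrdinal → ℕ → ℕ) (β : CountableOrdinal) (s : ℝ) : ℝ :=
  nyikosCurve (fun n => longExtension f (base β) n + 1) s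

/-- The vertical coordinate in the strip between the curves of `β` and `β + 1`, extended by
constants. -/
def stripCoord (f : CountableOrdinal → ℕ → ℕ) (β : CountableOrdinal) (z : ℝ × ℝ) : ℝ :=
  max 0 (min 1 ((z.2 - rayCurve f (base β) z.1) /
    (upperCurve f β z.1 - rayCurve f (base β) z.1)))

theorem stripCoord_nonneg (β : CountableOrdinal) (z) : 0 ≤ stripCoord f β z := le_max_left _ _

theorem stripCoord_le_one (β : CountableOrdinal) (z) : stripCoord f β z ≤ 1 :=
  max_le zero_le_one (min_le_left _ _)

/-- On the axis both curves vanish and division by zero returns `0`. This is the correct limit for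
`t < 0`, but not for `t > 0`, where the nearby values are `1`; hence the restriction to `s ≠ 0 ∨ t <
0` below. -/
theorem stripCoord_zero (β : CountableOrdinal) (t : ℝ) : stripCoord f β (0, t) = 0 := by
  simp [stripCoord, upperCurve, rayCurve_zero, nyikosCurve_zero]

namespace IsNyikosSequence

variable (hf : IsNyikosSequence f)
include hf

theorem rayCurve_lt_upperCurve (β : CountableOrdinal) {s : ℝ} (hs : s ≠ 0) :
    rayCurve f (base β) s < upperCurve f β s :=
  nyikosCurve_lt_of_forall (hf.longExtension_pos _) (fun n _ => by linarith) hs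

theorem le_longExtension_add_one (β : CountableOrdinal) (n : ℕ) (hn : 1 ≤ n) :
    (n : ℝ) ≤ longExtension f (base β) n + 1 := by
  linarith [hf.le_longExtension (base β) n hn]

theorem continuous_upperCurve (β : CountableOrdinal) : Continuous (upperCurve f β) :=
  continuous_nyikosCurve (hf.le_longExtension_add_one β)

theorem stripCoord_mono (β : CountableOrdinal) (s : ℝ) :
    Monotone fun t => stripCoord f β (s, t) := by
  intro t t' h
  refine max_le_max_left _ (min_le_min_left _ (div_le_div_of_nonneg_right (by simpa using h) ?_))
  rcases eq_or_ne s 0 with rfl | hs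
  · simp [upperCurve, rayCurve_zero, nyikosCurve_zero]
  · exact (sub_pos.2 (hf.rayCurve_lt_upperCurve β hs)).le

theorem rayCurve_point_bounds (β : CountableOrdinal) (r : Ico (0 : ℝ) 1) {s : ℝ} (hs : s ≠ 0) :
    r * (upperCurve f β s - rayCurve f (base β) s) ≤ rayCurve f (point β r) s -
        rayCurve f (base β) s ∧
      rayCurve f (point β r) s - rayCurve f (base β) s ≤
        r * (1 + 2 * |s|) * (upperCurve f β s - rayCurve f (base β) s) := by
  have := nyikosCurve_add_bounds (hf.le_longExtension (base β)) r.2.1 r.2.2.le hs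
  convert this using 6 <;>
  · refine congrArg (fun h => nyikosCurve h s) (funext fun n => ?_)
    simp [longExtension_eq]

theorem le_stripCoord {β : CountableOrdinal} {r : Ico (0 : ℝ) 1} {s t : ℝ} (hs : s ≠ 0)
    (h : rayCurve f (point β r) s ≤ t) : r ≤ stripCoord f β (s, t) := by
  refine le_max_of_le_right (le_min r.2.2.le ?_)
  rw [le_div_iff₀ (sub_pos.2 (hf.rayCurve_lt_upperCurve β hs))]
  linarith [(hf.rayCurve_point_bounds β r hs).1]

/-- The curve of `β + r` is not exactly at relative height `r`, because `-1 / (h + r)` is not linear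
in `r`. The error factor `1 + 2 |s|` tends to `1` at the ray, which is all that continuity there
needs. -/
theorem stripCoord_le {β : CountableOrdinal} {r : Ico (0 : ℝ) 1} {s t : ℝ}
    (h : t ≤ rayCurve f (point β r) s) : stripCoord f β (s, t) ≤ r * (1 + 2 * |s|) := by
  have h0 : 0 ≤ (r : ℝ) * (1 + 2 * |s|) := mul_nonneg r.2.1 (by positivity)
  rcases eq_or_ne s 0 with rfl | hs
  · rwa [stripCoord_zero]
  refine max_le h0 (min_le_of_right_le ?_)
  rw [div_le_iff₀ (sub_pos.2 (hf.rayCurve_lt_upperCurve β hs))]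
  linarith [(hf.rayCurve_point_bounds β r hs).2]

theorem stripCoord_eq_zero {β : CountableOrdinal} {s t : ℝ}
    (h : t ≤ -|s|) : stripCoord f β (s, t) = 0 := by
  refine le_antisymm ?_ (stripCoord_nonneg _ _)
  simpa [base] using hf.stripCoord_le (β := β) (r := ⟨0, by norm_num⟩)
    (h.trans (hf.neg_abs_le_rayCurve _ s))

/-- Off the axis the denominator is positive. On the lower half axis the point is strictly inside
the wedge `t < -|s|`, where the coordinate vanishes identically. -/
theorem continuousAt_stripCoord (β : CountableOrdinal) {z : ℝ × ℝ} (hz : z.1 ≠ 0 ∨ z.2 < 0) :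
    ContinuousAt (stripCoord f β) z := by
  by_cases h : z.1 = 0
  · have h2 : z.2 < -|z.1| := by simpa [h] using hz
    have : ∀ᶠ w : ℝ × ℝ in 𝓝 z, w.2 < -|w.1| :=
      (isOpen_lt continuous_snd (by fun_prop)).mem_nhds h2
    refine (continuousAt_const (y := (0 : ℝ))).congr ?_
    filter_upwards [this] with w hw
    exact (hf.stripCoord_eq_zero (s := w.1) (t := w.2) hw.le).symm
  · have h1 := (hf.continuous_rayCurve (base β)).comp continuous_fst (X := ℝ × ℝ) (Z := ℝ)
    have h2 := (hf.continuous_upperCurve β).comp continuous_fst (X := ℝ × ℝ) (Z := ℝ)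
    refine continuousAt_const.max (continuousAt_const.min (ContinuousAt.div ?_ ?_ ?_))
    · exact (continuous_snd.sub h1).continuousAt
    · exact (h2.sub h1).continuousAt
    · exact (sub_pos.2 (hf.rayCurve_lt_upperCurve β h)).ne'

end IsNyikosSequence

end rayCurve

/-! ### The topology of a Nyikosization -/

namespace Nyikosization

open ClosedLongRay

variable {X : Type*} {p : X} {φ : ℝ × ℝ → X} {f : CountableOrdinal → ℕ → ℕ}

/-- The inclusion of the punctured surface. -/
def ofPoint (q : {x : X // x ≠ p}) : Nyikosization p φ f := Sum.inl q

/-- The inclusion of the closed long ray. -/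
def ofRay (x : ClosedLongRay) : Nyikosization p φ f := Sum.inr x

/-- The map that collapses the closed long ray to the point `p`. -/
def collapse (z : Nyikosization p φ f) : X := Sum.elim Subtype.val (fun _ => p) z

theorem eq_ofPoint_or_ofRay (z : Nyikosization p φ f) :
    (∃ q, z = ofPoint q) ∨ ∃ x, z = ofRay x := by
  rcases z with q | x
  exacts [Or.inl ⟨q, rfl⟩, Or.inr ⟨x, rfl⟩]

@[simp] theorem collapse_ofPoint (q : {x : X // x ≠ p}) :
    collapse (ofPoint q : Nyikosization p φ f) = q := rfl
@[simp] theorem collapse_ofRay (x : ClosedLongRay) :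
    collapse (ofRay x : Nyikosization p φ f) = p := rfl

@[simp] theorem ofRay_mem_union {x : ClosedLongRay} {A : Set X} {B : Set ClosedLongRay} :
    (ofRay x : Nyikosization p φ f) ∈ union A B ↔ x ∈ B := Iff.rfl

theorem ofPoint_injective : Function.Injective (ofPoint : _ → Nyikosization p φ f) :=
  Sum.inl_injective
theorem ofRay_injective : Function.Injective (ofRay : _ → Nyikosization p φ f) :=
  Sum.inr_injective

@[simp] theorem ofPoint_ne_ofRay {q : {x : X // x ≠ p}} {x : ClosedLongRay} :
    (ofPoint q : Nyikosization p φ f) ≠ ofRay x := Sum.inl_ne_inr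

theorem union_mono {A A' : Set X} {B B' : Set ClosedLongRay} (hA : A ⊆ A') (hB : B ⊆ B') :
    (union A B : Set (Nyikosization p φ f)) ⊆ union A' B' := by
  rintro (q | x) hz
  exacts [hA hz, hB hz]

/-- The part of a region in the plane and of a set of points of the long ray. -/
def boxUnion (A : Set (ℝ × ℝ)) (B : Set ClosedLongRay) : Set (Nyikosization p φ f) :=
  union (φ '' A) B

theorem boxUnion_mono {A A' : Set (ℝ × ℝ)} {B B' : Set ClosedLongRay} (hA : A ⊆ A') (hB : B ⊆ B') :
    (boxUnion A B : Set (Nyikosization p φ f)) ⊆ boxUnion A' B' :=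
  union_mono (image_mono hA) hB

variable [TopologicalSpace X]

theorem isOpen_union_empty {A : Set X} (hA : IsOpen A) :
    IsOpen (union A ∅ : Set (Nyikosization p φ f)) :=
  TopologicalSpace.isOpen_generateFrom_of_mem (Or.inl (Or.inl ⟨A, hA, rfl⟩))

theorem isOpen_basicU {ε : ℝ} (hε : 0 < ε) {x y : ClosedLongRay} (hx : ¬ IsMin x) (hxy : x < y) :
    IsOpen (basicU ε x y : Set (Nyikosization p φ f)) :=
  TopologicalSpace.isOpen_generateFrom_of_mem (Or.inl (Or.inr ⟨ε, x, y, hε, hx, hxy, rfl⟩))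

theorem isOpen_basicV {w : ClosedLongRay} (h1 : IsMin w.ord) (h2 : 0 < w.frac) :
    IsOpen (basicV w : Set (Nyikosization p φ f)) :=
  TopologicalSpace.isOpen_generateFrom_of_mem (Or.inr ⟨w, h1, h2, rfl⟩)

omit [TopologicalSpace X] in
theorem basicU_eq (ε : ℝ) (x y : ClosedLongRay) : (basicU ε x y : Set (Nyikosization p φ f)) =
    boxUnion {z | |z.1| < ε ∧ rayCurve f x z.1 < z.2 ∧ z.2 < rayCurve f y z.1} (Ioo x y) := rfl

omit [TopologicalSpace X] in
theorem basicV_eq (w : ClosedLongRay) : (basicV w : Set (Nyikosization p φ f)) =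
    boxUnion {z | |z.1| < w.frac ∧ -w.frac < z.2 ∧ z.2 < rayCurve f w z.1} (Iio w) := rfl

variable (hφ : IsOpenEmbedding φ) (h0 : φ (0, 0) = p) (hf : IsNyikosSequence f)

include hφ hf in
theorem continuous_ofPoint : Continuous (ofPoint : _ → Nyikosization p φ f) := by
  refine continuous_generateFrom_iff.2 ?_
  have key : ∀ (A : Set (ℝ × ℝ)) (B : Set ClosedLongRay), IsOpen A →
      IsOpen (ofPoint ⁻¹' (boxUnion A B : Set (Nyikosization p φ f))) := fun A B hA =>
    (hφ.isOpenMap A hA).preimage continuous_subtype_val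
  have h1 : Continuous fun z : ℝ × ℝ => |z.1| := by fun_prop
  have hc : ∀ x, Continuous fun z : ℝ × ℝ => rayCurve f x z.1 := fun x =>
    (hf.continuous_rayCurve x).comp continuous_fst
  rintro _ ((⟨A, hA, rfl⟩ | ⟨ε, x, y, -, -, -, rfl⟩) | ⟨w, -, -, rfl⟩)
  · exact hA.preimage continuous_subtype_val
  · rw [basicU_eq]
    exact key _ _ ((isOpen_lt h1 continuous_const).inter
      ((isOpen_lt (hc x) continuous_snd).inter (isOpen_lt continuous_snd (hc y))))
  · rw [basicV_eq]
    exact key _ _ ((isOpen_lt h1 continuous_const).inter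
      ((isOpen_lt continuous_const continuous_snd).inter (isOpen_lt continuous_snd (hc w))))

include hφ hf in
theorem isOpenEmbedding_ofPoint : IsOpenEmbedding (ofPoint : _ → Nyikosization p φ f) := by
  refine .of_continuous_injective_isOpenMap (continuous_ofPoint hφ hf) ofPoint_injective ?_
  rintro _ ⟨A, hA, rfl⟩
  convert isOpen_union_empty (p := p) (φ := φ) (f := f) hA using 1
  ext (q | x)
  · exact ofPoint_injective.mem_set_image
  · exact iff_of_false (fun ⟨q, _, h⟩ => ofPoint_ne_ofRay h) id

/-! #### Neighbourhoods of the points of the long ray -/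

omit [TopologicalSpace X] in
include hf in
theorem basicV_mono {w w' : ClosedLongRay} (h : w ≤ w') (hw : w.ord = w'.ord) :
    (basicV w : Set (Nyikosization p φ f)) ⊆ basicV w' := by
  rcases h.eq_or_lt with rfl | hlt
  · exact subset_rfl
  have hfr : w.frac < w'.frac := by
    rcases ClosedLongRay.lt_iff.1 hlt with h | h
    exacts [absurd hw h.ne, h.2]
  rw [basicV_eq, basicV_eq]
  refine boxUnion_mono (fun z hz => ⟨hz.1.trans hfr, (neg_lt_neg hfr).trans hz.2.1,
    hz.2.2.trans_le ?_⟩) (Iio_subset_Iio h)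
  rcases eq_or_ne z.1 0 with h0 | h0
  · rw [h0, rayCurve_zero, rayCurve_zero]
  · exact (hf.rayCurve_lt_of_ord_eq hw hfr h0).le

include hf in
-- The topology is given by a subbasis only, so the supersets of the sets `basicU` around `x` are
-- shown to form a filter `N` that contains every subbasic neighbourhood. Closure under intersection
-- takes the larger lower end and the smaller upper end, and shrinks `ε` until the curves are in the
-- same order as the points.
theorem exists_basicU_subset {x : ClosedLongRay} (hx : ¬ IsMin x) {O : Set (Nyikosization p φ f)}
    (hO : O ∈ 𝓝 (ofRay x : Nyikosization p φ f)) :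
    ∃ ε > 0, ∃ x₁ x₂, ¬ IsMin x₁ ∧ x₁ < x ∧ x < x₂ ∧ basicU ε x₁ x₂ ⊆ O := by
  let N : Filter (Nyikosization p φ f) :=
    { sets := {O | ∃ ε > 0, ∃ x₁ x₂, ¬ IsMin x₁ ∧ x₁ < x ∧ x < x₂ ∧ basicU ε x₁ x₂ ⊆ O}
      univ_sets := by
        obtain ⟨x₁, h1, h2⟩ := exists_not_isMin_lt hx
        obtain ⟨x₂, h3⟩ := exists_gt x
        exact ⟨1, one_pos, x₁, x₂, h1, h2, h3, subset_univ _⟩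
      sets_of_superset := by
        rintro O O' ⟨ε, hε, x₁, x₂, h1, h2, h3, h4⟩ h
        exact ⟨ε, hε, x₁, x₂, h1, h2, h3, h4.trans h⟩
      inter_sets := by
        rintro O O' ⟨ε, hε, x₁, x₂, h1, h2, h3, h4⟩ ⟨ε', hε', x₁', x₂', h1', h2', h3', h4'⟩
        obtain ⟨δ₁, hδ₁, H₁⟩ := hf.exists_rayCurve_le (le_max_left x₁ x₁')
        obtain ⟨δ₂, hδ₂, H₂⟩ := hf.exists_rayCurve_le (le_max_right x₁ x₁')
        obtain ⟨δ₃, hδ₃, H₃⟩ := hf.exists_rayCurve_le (min_le_left x₂ x₂')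
        obtain ⟨δ₄, hδ₄, H₄⟩ := hf.exists_rayCurve_le (min_le_right x₂ x₂')
        refine ⟨min (min ε ε') (min (min δ₁ δ₂) (min δ₃ δ₄)), by positivity, max x₁ x₁',
          min x₂ x₂', ?_, max_lt h2 h2', lt_min h3 h3', subset_inter
            (Subset.trans (boxUnion_mono ?_ (Ioo_subset_Ioo (le_max_left _ _) (min_le_left _ _))) h4)
            (Subset.trans (boxUnion_mono ?_
              (Ioo_subset_Ioo (le_max_right _ _) (min_le_right _ _))) h4')⟩
        · rcases max_choice x₁ x₁' with h | h <;> rwa [h]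
        · rintro z ⟨hz, hz1, hz2⟩
          simp only [lt_min_iff] at hz
          exact ⟨hz.1.1, (H₁ _ hz.2.1.1).trans_lt hz1, hz2.trans_le (H₃ _ hz.2.2.1)⟩
        · rintro z ⟨hz, hz1, hz2⟩
          simp only [lt_min_iff] at hz
          exact ⟨hz.1.2, (H₂ _ hz.2.1.2).trans_lt hz1, hz2.trans_le (H₄ _ hz.2.2.2)⟩ }
  suffices h : N ≤ 𝓝 (ofRay x : Nyikosization p φ f) from h hO
  rw [TopologicalSpace.nhds_generateFrom]
  refine le_iInf₂ fun S hS => le_principal_iff.2 ?_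
  obtain ⟨hxS, (⟨A, hA, rfl⟩ | ⟨ε, x₁, x₂, hε, h1, -, rfl⟩) | ⟨w, hw1, hw2, rfl⟩⟩ := hS
  · exact absurd hxS (by simp)
  · exact ⟨ε, hε, x₁, x₂, h1, hxS.1, hxS.2, subset_rfl⟩
  -- A set `basicV w` contains a set `basicU` of width `w.frac`: there the wedge `-|s|` is above the
  -- bottom side `-w.frac`.
  · obtain ⟨x₁, h1, h2⟩ := exists_not_isMin_lt hx
    refine ⟨w.frac, hw2, x₁, w, h1, h2, hxS, boxUnion_mono ?_ fun y hy => hy.2⟩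
    rintro z ⟨hz, hz1, hz2⟩
    exact ⟨hz, (neg_lt_neg hz).trans_le (hf.neg_abs_le_rayCurve x₁ z.1) |>.trans hz1, hz2⟩

include hf in
-- Within the first block the curves are ordered for all abscissas, so the sets `basicV` are nested
-- and need no shrinking; the sets `basicU` do not contain the least point.
theorem exists_basicV_subset {x : ClosedLongRay} (hx : IsMin x) {O : Set (Nyikosization p φ f)}
    (hO : O ∈ 𝓝 (ofRay x : Nyikosization p φ f)) :
    ∃ w, IsMin w.ord ∧ 0 < w.frac ∧ basicV w ⊆ O := by
  let N : Filter (Nyikosization p φ f) :=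
    { sets := {O | ∃ w, IsMin w.ord ∧ 0 < w.frac ∧ basicV w ⊆ O}
      univ_sets := ⟨point x.ord ⟨1 / 2, by norm_num, by norm_num⟩, (isMin_iff.1 hx).1, by simp,
        subset_univ _⟩
      sets_of_superset := by
        rintro O O' ⟨w, h1, h2, h3⟩ h
        exact ⟨w, h1, h2, h3.trans h⟩
      inter_sets := by
        rintro O O' ⟨w, h1, h2, h3⟩ ⟨w', h1', h2', h3'⟩
        have he := CountableOrdinal.eq_of_isMin h1 h1'
        rcases le_total w w' with h | h
        · exact ⟨w, h1, h2, subset_inter h3 ((basicV_mono hf h he).trans h3')⟩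
        · exact ⟨w', h1', h2', subset_inter ((basicV_mono hf h he.symm).trans h3) h3'⟩ }
  suffices h : N ≤ 𝓝 (ofRay x : Nyikosization p φ f) from h hO
  rw [TopologicalSpace.nhds_generateFrom]
  refine le_iInf₂ fun S hS => le_principal_iff.2 ?_
  obtain ⟨hxS, (⟨A, hA, rfl⟩ | ⟨ε, x₁, x₂, hε, h1, -, rfl⟩) | ⟨w, hw1, hw2, rfl⟩⟩ := hS
  · exact absurd hxS (by simp)
  · exact absurd hxS.1 (not_lt.2 ((le_total x x₁).elim id fun h => hx h))
  · exact ⟨w, hw1, hw2, subset_rfl⟩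

/-- Small neighbourhoods of the long ray in the box. -/
theorem boxUnion_small_mem_nhds (x : ClosedLongRay) {ε : ℝ} (hε : 0 < ε) (hf : IsNyikosSequence f) :
    (boxUnion {z | |z.1| < ε ∧ -ε < z.2 ∧ z.2 < 0} univ : Set (Nyikosization p φ f)) ∈
      𝓝 (ofRay x : Nyikosization p φ f) := by
  by_cases hx : IsMin x
  · have hw : min (ε) (1 / 2) ∈ Ico (0 : ℝ) 1 :=
      ⟨by positivity, (min_le_right _ _).trans_lt (by norm_num)⟩
    have hx' := isMin_iff.1 hx
    have hw0 : 0 < min ε (1 / 2) := by positivity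
    refine mem_of_superset ((isOpen_basicV (w := point x.ord ⟨_, hw⟩) hx'.1 hw0).mem_nhds ?_)
      (boxUnion_mono ?_ (subset_univ _))
    · exact ClosedLongRay.lt_iff.2 (Or.inr ⟨rfl, by rw [hx'.2]; exact hw0⟩)
    · rintro z ⟨h1, h2, h3⟩
      have := min_le_left ε (1 / 2)
      exact ⟨h1.trans_le this, (neg_le_neg this).trans_lt h2, h3.trans_le (hf.rayCurve_nonpos _ _)⟩
  · obtain ⟨x₁, h1, h2⟩ := exists_not_isMin_lt hx
    obtain ⟨x₂, h3⟩ := exists_gt x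
    refine mem_of_superset ((isOpen_basicU hε h1 (h2.trans h3)).mem_nhds ⟨h2, h3⟩)
      (boxUnion_mono ?_ (subset_univ _))
    rintro z ⟨h1, h2, h3⟩
    exact ⟨h1, (neg_lt_neg h1).trans_le (hf.neg_abs_le_rayCurve x₁ z.1) |>.trans h2,
      h3.trans_le (hf.rayCurve_nonpos _ _)⟩

include hφ

theorem boxUnion_inter (A A' : Set (ℝ × ℝ)) (B B' : Set ClosedLongRay) :
    (boxUnion A B ∩ boxUnion A' B' : Set (Nyikosization p φ f)) =
      boxUnion (A ∩ A') (B ∩ B') := by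
  unfold boxUnion
  rw [image_inter hφ.injective]
  ext (q | x)
  exacts [Iff.rfl, Iff.rfl]

include hf

/-- The points below the curve of `y`. -/
theorem boxUnion_below_mem_nhds {x y : ClosedLongRay} (h : x < y) :
    (boxUnion {z | z.2 < rayCurve f y z.1} (Iio y) : Set (Nyikosization p φ f)) ∈
      𝓝 (ofRay x : Nyikosization p φ f) := by
  by_cases hx : IsMin x
  · obtain ⟨w', hw1, hw2⟩ := exists_between h
    have hx' := isMin_iff.1 hx
    -- Sets `basicV w` are open only for `w` in the first block; if `w'` lies beyond it, the point
    -- `1/2` serves instead.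
    obtain ⟨w, hw3, hw4, hw5⟩ : ∃ w : ClosedLongRay, IsMin w.ord ∧ 0 < w.frac ∧ w ≤ w' := by
      by_cases hm : IsMin w'.ord
      · refine ⟨w', hm, ?_, le_rfl⟩
        refine lt_of_le_of_ne (frac_nonneg _) fun h => not_isMin_of_lt hw1 (isMin_iff.2 ⟨hm, h.symm⟩)
      · refine ⟨point x.ord ⟨1 / 2, by norm_num, by norm_num⟩, hx'.1, by simp, le_of_lt
          (ClosedLongRay.lt_iff.2 (Or.inl ?_))⟩
        rw [ord_point]
        exact not_le.1 fun h => hm (fun b hb => h.trans (hx'.1 (hb.trans h)))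
    have hxw : x < w := ClosedLongRay.lt_iff.2
      (Or.inr ⟨CountableOrdinal.eq_of_isMin hx'.1 hw3, by rwa [hx'.2]⟩)
    have hwy := hw5.trans hw2.le
    obtain ⟨ε, hε, H⟩ := hf.exists_rayCurve_le hwy
    refine mem_of_superset (inter_mem (boxUnion_small_mem_nhds x hε hf)
      ((isOpen_basicV hw3 hw4).mem_nhds hxw)) ?_
    rw [basicV_eq, boxUnion_inter hφ]
    exact boxUnion_mono (fun z hz => hz.2.2.2.trans_le (H _ hz.1.1))
      (fun v hv => lt_of_lt_of_le hv.2 hwy)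
  · obtain ⟨x₁, h1, h2⟩ := exists_not_isMin_lt hx
    refine mem_of_superset ((isOpen_basicU one_pos h1 (h2.trans h)).mem_nhds ⟨h2, h⟩)
      (boxUnion_mono (fun z hz => hz.2.2) fun v hv => hv.2)

omit hφ in
/-- The points above the curve of `y`. -/
theorem boxUnion_above_mem_nhds {x y : ClosedLongRay} (h : y < x) :
    (boxUnion {z | z.1 ≠ 0 ∧ rayCurve f y z.1 < z.2} (Ioi y) : Set (Nyikosization p φ f)) ∈
      𝓝 (ofRay x : Nyikosization p φ f) := by
  -- The point `y` may be the least one, which is not allowed as the lower end of a set `basicU`; an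
  -- intermediate point always is.
  obtain ⟨y', h1, h2⟩ := exists_between h
  obtain ⟨x₂, h3⟩ := exists_gt x
  obtain ⟨ε, hε, H⟩ := hf.exists_rayCurve_le h1.le
  refine mem_of_superset ((isOpen_basicU hε (not_isMin_of_lt h1) (h2.trans h3)).mem_nhds ⟨h2, h3⟩)
    (boxUnion_mono (fun z hz => ⟨fun h0 => ?_, (H _ hz.1).trans_lt hz.2.1⟩)
      fun v hv => h1.trans hv.1)
  have : rayCurve f y' z.1 < rayCurve f x₂ z.1 := hz.2.1.trans hz.2.2
  rw [h0, rayCurve_zero, rayCurve_zero] at this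
  exact this.false

include h0

theorem continuous_collapse : Continuous (collapse : Nyikosization p φ f → X) := by
  rw [continuous_iff_continuousAt]
  intro z
  rcases eq_ofPoint_or_ofRay z with ⟨q, rfl⟩ | ⟨x, rfl⟩
  · rw [← (isOpenEmbedding_ofPoint hφ hf).continuousAt_iff]
    exact continuousAt_subtype_val
  · intro B hB
    rw [collapse_ofRay, ← h0] at hB
    have := hφ.continuous.continuousAt hB
    obtain ⟨ε, hε, H⟩ := Metric.mem_nhds_iff.1 this
    refine mem_map.2 (mem_of_superset (boxUnion_small_mem_nhds x hε hf) ?_)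
    intro z hz
    rcases eq_ofPoint_or_ofRay z with ⟨q, rfl⟩ | ⟨y, rfl⟩
    · obtain ⟨w, hw, e⟩ := hz
      change (q : X) ∈ B
      rw [← e]
      refine H ?_
      rw [Metric.mem_ball, Prod.dist_eq, Real.dist_eq, Real.dist_eq, sub_zero, sub_zero]
      exact max_lt hw.1 (abs_lt.2 ⟨hw.2.1, hw.2.2.trans hε⟩)
    · change p ∈ B
      rw [← h0]
      exact mem_of_mem_nhds hB

/-- Points with different images under `collapse` are separated in `X`. Two points of the ray are
separated by the curve of a point between them, the regions below and above it being neighbourhoods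
of the one and the other. -/
theorem t2Space [T2Space X] : T2Space (Nyikosization p φ f) := by
  refine ⟨fun z z' hne => ?_⟩
  by_cases hc : collapse z = collapse z'
  · have key : ∀ x y : ClosedLongRay, x < y → ∃ U V : Set (Nyikosization p φ f), IsOpen U ∧ IsOpen V ∧
        ofRay x ∈ U ∧ ofRay y ∈ V ∧ Disjoint U V := by
      intro x y hxy
      obtain ⟨w, h1, h2⟩ := exists_between hxy
      obtain ⟨U, hU, oU, mU⟩ := mem_nhds_iff.1 (boxUnion_below_mem_nhds (p := p) hφ hf h1)
      obtain ⟨V, hV, oV, mV⟩ := mem_nhds_iff.1 (boxUnion_above_mem_nhds (p := p) hf h2)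
      refine ⟨U, V, oU, oV, mU, mV, disjoint_iff_inter_eq_empty.2 (subset_eq_empty
        (inter_subset_inter hU hV) ?_)⟩
      rw [boxUnion_inter hφ]
      refine eq_empty_of_forall_notMem ?_
      rintro (q | v) hz
      · obtain ⟨w, ⟨hw1, hw2⟩, -⟩ := hz
        exact lt_asymm hw1 hw2.2
      · exact lt_asymm (mem_Iio.1 hz.1) (mem_Ioi.1 hz.2)
    rcases eq_ofPoint_or_ofRay z with ⟨q, rfl⟩ | ⟨x, rfl⟩ <;>
    rcases eq_ofPoint_or_ofRay z' with ⟨q', rfl⟩ | ⟨x', rfl⟩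
    · exact absurd (congrArg _ (Subtype.ext hc)) hne
    · exact absurd hc q.2
    · exact absurd hc.symm q'.2
    · rcases lt_trichotomy x x' with h | rfl | h
      · exact key _ _ h
      · exact absurd rfl hne
      · obtain ⟨U, V, h1, h2, h3, h4, h5⟩ := key _ _ h
        exact ⟨V, U, h2, h1, h4, h3, h5.symm⟩
  · obtain ⟨U, V, h1, h2, h3, h4, h5⟩ := t2_separation hc
    exact ⟨_, _, h1.preimage (continuous_collapse hφ h0 hf),
      h2.preimage (continuous_collapse hφ h0 hf), h3, h4, h5.preimage _⟩

end Nyikosization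

/-! ### Weighted heights on the long ray -/

namespace ClosedLongRay

theorem unitCoord_base (β γ : CountableOrdinal) :
    unitCoord γ (base β) = (Iio β).indicator (fun _ => 1) γ := by
  unfold unitCoord
  rcases lt_trichotomy γ β with h | h | h
  · simp [h, h.not_gt, h.ne']
  · simp [h]
  · simp [h, h.not_gt]

theorem unitCoord_point (β γ : CountableOrdinal) (r : Ico (0 : ℝ) 1) :
    unitCoord γ (point β r) = unitCoord γ (base β) + if γ = β then (r : ℝ) else 0 := by
  unfold unitCoord
  rcases lt_trichotomy γ β with h | h | h
  · simp [h.not_gt, h.ne', h.ne]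
  · simp [h]
  · simp [h, h.ne']

/-- The weighted sum of the unit coordinates. -/
def rayHeight (w : CountableOrdinal → ℝ) (x : ClosedLongRay) : ℝ := ∑' β, w β * unitCoord β x

variable {w : CountableOrdinal → ℝ} (hw : Summable w) (hw0 : ∀ β, 0 ≤ w β)
include hw hw0

theorem summable_mul_unitCoord (x : ClosedLongRay) : Summable fun β => w β * unitCoord β x :=
  hw.of_nonneg_of_le (fun β => mul_nonneg (hw0 β) (unitCoord_nonneg β x))
    fun β => mul_le_of_le_one_right (hw0 β) (unitCoord_le_one β x)

omit hw in
theorem rayHeight_nonneg (x : ClosedLongRay) : 0 ≤ rayHeight w x :=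
  tsum_nonneg fun β => mul_nonneg (hw0 β) (unitCoord_nonneg β x)

theorem strictMonoOn_rayHeight {α : CountableOrdinal} (hpos : ∀ β < α, 0 < w β) :
    StrictMonoOn (rayHeight w) (Iic (base α)) := by
  intro x _ y hy hxy
  have hxα : x.ord < α := lt_base_iff.1 (hxy.trans_le hy)
  refine (summable_mul_unitCoord hw hw0 x).tsum_lt_tsum (i := x.ord) (fun β =>
    mul_le_mul_of_nonneg_left (unitCoord_mono β hxy.le) (hw0 β)) ?_
    (summable_mul_unitCoord hw hw0 y)
  refine mul_lt_mul_of_pos_left ?_ (hpos _ hxα)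
  have h1 : unitCoord x.ord x = x.frac := by simp [unitCoord]
  rw [h1]
  exact (point_lt_iff (β := x.ord) (r := ⟨x.frac, frac_nonneg x, frac_lt_one x⟩)).1 hxy

omit hw hw0 in
theorem rayHeight_base (β : CountableOrdinal) :
    rayHeight w (base β) = ∑' γ, (Iio β).indicator w γ := by
  refine tsum_congr fun γ => ?_
  rw [unitCoord_base]
  by_cases h : γ ∈ Iio β <;> simp [h]

theorem rayHeight_point (β : CountableOrdinal) (r : Ico (0 : ℝ) 1) :
    rayHeight w (point β r) = rayHeight w (base β) + w β * r := by
  have h : ∀ γ, w γ * unitCoord γ (point β r) =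
      w γ * unitCoord γ (base β) + if γ = β then w β * r else 0 := by
    intro γ
    rw [unitCoord_point, mul_add]
    split_ifs with h
    · rw [h]
    · rw [mul_zero]
  unfold rayHeight
  simp_rw [h]
  rw [(summable_mul_unitCoord hw hw0 _).tsum_add (hasSum_ite_eq β (w β * r)).summable, tsum_ite_eq]

/-- A finite partial sum already exceeds `y`; the largest index that occurs in it serves as `β`. -/
theorem exists_lt_tsum_indicator_Iic {I : Set CountableOrdinal} {y : ℝ} (hy : 0 ≤ y)
    (h : y < ∑' γ, I.indicator w γ) : ∃ β ∈ I, y < ∑' γ, (Iic β).indicator w γ := by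
  classical
  have hs : ∀ J : Set CountableOrdinal, Summable (J.indicator w) := fun J => hw.indicator J
  obtain ⟨F, hF⟩ := ((hs I).hasSum.eventually (lt_mem_nhds h)).exists
  have hF' : y < ∑ γ ∈ F.filter (· ∈ I), w γ := by
    rw [Finset.sum_filter]
    exact hF.trans_eq (Finset.sum_congr rfl fun γ _ => by by_cases h : γ ∈ I <;> simp [h])
  have hne : (F.filter (· ∈ I)).Nonempty := by
    rw [Finset.nonempty_iff_ne_empty]
    intro he
    rw [he, Finset.sum_empty] at hF'
    exact hF'.not_ge hy
  refine ⟨(F.filter (· ∈ I)).max' hne, (Finset.mem_filter.1 (Finset.max'_mem _ hne)).2,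
    hF'.trans_le ?_⟩
  refine le_trans (Finset.sum_le_sum fun γ hγ => ?_)
    ((hs _).sum_le_tsum (F.filter (· ∈ I)) fun γ _ => indicator_nonneg (fun γ _ => hw0 γ) γ)
  rw [indicator_of_mem (show γ ∈ Iic _ from Finset.le_max' _ _ hγ)]

/-- Intermediate values on the ray by well-ordering: `y` is attained in the block of the least `β`
whose weight lifts the sum above `y`, at the fraction of that weight that is still missing. -/
theorem exists_rayHeight_eq {α : CountableOrdinal} (hpos : ∀ β < α, 0 < w β) {y : ℝ} (hy : 0 ≤ y)
    (hyα : y < rayHeight w (base α)) : ∃ x < base α, rayHeight w x = y := by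
  rw [rayHeight_base] at hyα
  obtain ⟨β₀, hβ₀, h0⟩ := exists_lt_tsum_indicator_Iic hw hw0 hy hyα
  obtain ⟨β, ⟨hβα, hβ⟩, hmin⟩ := wellFounded_lt.has_min
    {β | β < α ∧ y < ∑' γ, (Iic β).indicator w γ} ⟨β₀, hβ₀, h0⟩
  -- If the sum over the ordinals strictly below `β` exceeded `y`, some smaller ordinal would do,
  -- against minimality.
  have hle : rayHeight w (base β) ≤ y := by
    by_contra! hcon
    rw [rayHeight_base] at hcon
    obtain ⟨β', h1, h2⟩ := exists_lt_tsum_indicator_Iic hw hw0 hy hcon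
    exact hmin β' ⟨lt_trans h1 hβα, h2⟩ h1
  have hIic : ∑' γ, (Iic β).indicator w γ = rayHeight w (base β) + w β := by
    have : ∀ γ, (Iic β).indicator w γ = (Iio β).indicator w γ + if γ = β then w β else 0 := by
      intro γ
      rcases lt_trichotomy γ β with h | h | h
      · simp [h, h.le, h.ne]
      · simp [h]
      · simp [h.not_ge, h.not_gt, h.ne']
    simp_rw [this]
    rw [(hw.indicator _).tsum_add (hasSum_ite_eq β (w β)).summable, tsum_ite_eq,
      rayHeight_base]
  rw [hIic] at hβ
  have hwβ := hpos β hβα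
  refine ⟨point β ⟨(y - rayHeight w (base β)) / w β, div_nonneg (by linarith) hwβ.le, ?_⟩,
    lt_base_iff.2 hβα, ?_⟩
  · rw [div_lt_one hwβ]; linarith
  · rw [rayHeight_point hw hw0]
    simp only
    field_simp
    ring

end ClosedLongRay

/-! ### Charts along the long ray -/

/-- The bounding functions need to be continuous at `s₀` only; this suits the heights along the
curves of points of the ray, whose continuity is established only at `0`. -/
theorem mem_nhds_prod_of_sections {A : Set (ℝ × ℝ)} {e s₀ : ℝ} {l₁ l₂ : ℝ → ℝ}
    (c₁ : ContinuousAt l₁ s₀) (c₂ : ContinuousAt l₂ s₀) (h₁ : l₁ s₀ < e) (h₂ : e < l₂ s₀)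
    (H : ∀ᶠ s in 𝓝 s₀, ∀ y, l₁ s < y → y < l₂ s → (y, s) ∈ A) : A ∈ 𝓝 (e, s₀) := by
  have hf : Tendsto (Prod.fst : ℝ × ℝ → ℝ) (𝓝 (e, s₀)) (𝓝 e) := continuous_fst.continuousAt
  have hs : Tendsto (Prod.snd : ℝ × ℝ → ℝ) (𝓝 (e, s₀)) (𝓝 s₀) := continuous_snd.continuousAt
  filter_upwards [(c₁.tendsto.comp hs).eventually_lt hf h₁, hf.eventually_lt (c₂.tendsto.comp hs) h₂,
    hs.eventually H] with z hz1 hz2 hz3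
  exact hz3 z.1 hz1 hz2

namespace Nyikosization

open ClosedLongRay

variable {X : Type*} {p : X} {φ : ℝ × ℝ → X} {f : CountableOrdinal → ℕ → ℕ}

/-- The coordinates of the box, with value `0` on the long ray. -/
def box (z : Nyikosization p φ f) : ℝ × ℝ := Function.invFun φ (collapse z)

/-- The part of the box that is adjacent to the long ray, with the long ray. -/
def rayRegion : Set (Nyikosization p φ f) := boxUnion {z | z.1 ≠ 0 ∨ z.2 < 0} univ

/-- The coordinate of the strip between `β` and `β + 1`. -/
def stripFun (β : CountableOrdinal) (z : Nyikosization p φ f) : ℝ :=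
  Sum.elim (fun q : {x : X // x ≠ p} => stripCoord f β (Function.invFun φ q)) (unitCoord β) z

/-- The leafwise coordinate near the long ray. -/
def height (w : CountableOrdinal → ℝ) (v : ℝ → ℝ) (z : Nyikosization p φ f) : ℝ :=
  v (box z).2 + ∑' β, w β * stripFun β z

/-- The leafwise coordinate in the box. -/
def boxHeight (f : CountableOrdinal → ℕ → ℕ) (w : CountableOrdinal → ℝ) (v : ℝ → ℝ)
    (z : ℝ × ℝ) : ℝ :=
  v z.2 + ∑' β, w β * stripCoord f β z

/-- The chart near the part of the long ray below `α`. -/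
def rayMap (w : CountableOrdinal → ℝ) (v : ℝ → ℝ) (z : Nyikosization p φ f) : ℝ × ℝ :=
  (height w v z, (box z).1)

/-- The domain of the chart near the part of the long ray below `α`. -/
def rayDomain (α : CountableOrdinal) : Set (Nyikosization p φ f) :=
  boxUnion {z | z.1 ≠ 0 ∨ z.2 < 0} (Iio (base α))

theorem rayDomain_subset (α : CountableOrdinal) :
    (rayDomain α : Set (Nyikosization p φ f)) ⊆ rayRegion :=
  boxUnion_mono subset_rfl (subset_univ _)

@[simp] theorem stripFun_ofRay (β : CountableOrdinal) (x : ClosedLongRay) :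
    stripFun β (ofRay x : Nyikosization p φ f) = unitCoord β x := rfl

theorem stripFun_nonneg (β : CountableOrdinal) (z : Nyikosization p φ f) : 0 ≤ stripFun β z := by
  rcases z with q | x
  exacts [stripCoord_nonneg _ _, unitCoord_nonneg _ _]

theorem stripFun_le_one (β : CountableOrdinal) (z : Nyikosization p φ f) : stripFun β z ≤ 1 := by
  rcases z with q | x
  exacts [stripCoord_le_one _ _, unitCoord_le_one _ _]

section

variable (hinj : Function.Injective φ) (h0 : φ (0, 0) = p)
include hinj

theorem box_ofPoint {q : {x : X // x ≠ p}} {z : ℝ × ℝ} (h : φ z = q) :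
    box (ofPoint q : Nyikosization p φ f) = z := by
  rw [box, collapse_ofPoint, ← h]
  exact Function.leftInverse_invFun hinj z

theorem stripFun_ofPoint (β : CountableOrdinal) {q : {x : X // x ≠ p}} {z : ℝ × ℝ} (h : φ z = q) :
    stripFun β (ofPoint q : Nyikosization p φ f) = stripCoord f β z := by
  change stripCoord f β (Function.invFun φ (q : X)) = _
  rw [← h, Function.leftInverse_invFun hinj z]

theorem height_ofPoint (w : CountableOrdinal → ℝ) (v : ℝ → ℝ) {q : {x : X // x ≠ p}} {z : ℝ × ℝ}
    (h : φ z = q) : height w v (ofPoint q : Nyikosization p φ f) = boxHeight f w v z := by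
  simp only [height, boxHeight, box_ofPoint hinj h, stripFun_ofPoint hinj _ h]

theorem rayMap_ofPoint (w : CountableOrdinal → ℝ) (v : ℝ → ℝ) {q : {x : X // x ≠ p}} {z : ℝ × ℝ}
    (h : φ z = q) : rayMap w v (ofPoint q : Nyikosization p φ f) = (boxHeight f w v z, z.1) := by
  rw [rayMap, height_ofPoint hinj w v h, box_ofPoint hinj h]

include h0

theorem apply_ne_of_ne {z : ℝ × ℝ} (hz : z ≠ (0, 0)) : φ z ≠ p := fun h =>
  hz (hinj (h.trans h0.symm))

theorem box_ofRay (x : ClosedLongRay) : box (ofRay x : Nyikosization p φ f) = (0, 0) := by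
  rw [box, collapse_ofRay, ← h0]
  exact Function.leftInverse_invFun hinj _

theorem height_ofRay (w : CountableOrdinal → ℝ) {v : ℝ → ℝ} (hv : v 0 = 0) (x : ClosedLongRay) :
    height w v (ofRay x : Nyikosization p φ f) = rayHeight w x := by
  simp [height, rayHeight, box_ofRay hinj h0, hv]

theorem rayMap_ofRay (w : CountableOrdinal → ℝ) {v : ℝ → ℝ} (hv : v 0 = 0) (x : ClosedLongRay) :
    rayMap w v (ofRay x : Nyikosization p φ f) = (rayHeight w x, 0) := by
  rw [rayMap, height_ofRay hinj h0 w hv, box_ofRay hinj h0]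

omit hinj h0 in
/-- Points of the domain of a ray chart. -/
theorem mem_rayDomain_cases {α : CountableOrdinal} {z : Nyikosization p φ f}
    (hz : z ∈ (rayDomain α : Set (Nyikosization p φ f))) :
    (∃ (y : ℝ × ℝ) (h : φ y ≠ p), (y.1 ≠ 0 ∨ y.2 < 0) ∧ z = ofPoint ⟨φ y, h⟩) ∨
      ∃ x, x < base α ∧ z = ofRay x := by
  rcases eq_ofPoint_or_ofRay z with ⟨⟨q, hq⟩, rfl⟩ | ⟨x, rfl⟩
  · obtain ⟨y, hy, rfl⟩ := hz
    exact Or.inl ⟨y, hq, hy, rfl⟩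
  · exact Or.inr ⟨x, hz, rfl⟩

end

section boxHeight

variable {w : CountableOrdinal → ℝ} (hw : Summable w) (hw0 : ∀ β, 0 ≤ w β) {v : ℝ → ℝ}
  (hf : IsNyikosSequence f)

theorem boxHeight_zero_left (t : ℝ) : boxHeight f w v (0, t) = v t := by
  simp [boxHeight, stripCoord_zero]

include hw hw0

omit hw in
theorem norm_mul_le_of_unit {a : ℝ} (h1 : 0 ≤ a) (h2 : a ≤ 1) (β : CountableOrdinal) :
    ‖w β * a‖ ≤ w β := by
  rw [Real.norm_of_nonneg (mul_nonneg (hw0 β) h1)]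
  exact mul_le_of_le_one_right (hw0 β) h2

theorem summable_mul_stripCoord (z : ℝ × ℝ) : Summable fun β => w β * stripCoord f β z :=
  hw.of_norm_bounded fun β => norm_mul_le_of_unit hw0 (stripCoord_nonneg β z)
    (stripCoord_le_one β z) β

include hf

/-- The strip coordinates are only weakly increasing, since they are clipped; strictness comes from
the summand `v`. -/
theorem strictMono_boxHeight (hv : StrictMono v) (s : ℝ) :
    StrictMono fun t => boxHeight f w v (s, t) := fun _ _ h =>
  add_lt_add_of_lt_of_le (hv h) ((summable_mul_stripCoord hw hw0 _).tsum_le_tsum (fun β =>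
    mul_le_mul_of_nonneg_left (hf.stripCoord_mono β s h.le) (hw0 β))
    (summable_mul_stripCoord hw hw0 _))

theorem continuousOn_boxHeight (hv : Continuous v) :
    ContinuousOn (boxHeight f w v) {z | z.1 ≠ 0 ∨ z.2 < 0} := by
  refine (hv.comp continuous_snd).continuousOn.add (continuousOn_tsum (fun β => ?_) hw
    fun β z _ => norm_mul_le_of_unit hw0 (stripCoord_nonneg β z) (stripCoord_le_one β z) β)
  exact continuousOn_const.mul fun z hz => (hf.continuousAt_stripCoord β hz).continuousWithinAt

end boxHeight

theorem isOpen_planeRegion : IsOpen {z : ℝ × ℝ | z.1 ≠ 0 ∨ z.2 < 0} :=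
  (isOpen_ne_fun continuous_fst continuous_const).union (isOpen_lt continuous_snd continuous_const)

section topology

variable [TopologicalSpace X] (hφ : IsOpenEmbedding φ) (h0 : φ (0, 0) = p)
  (hf : IsNyikosSequence f)

include hφ hf in
theorem eventually_ofPoint_mem {q : {x : X // x ≠ p}} {O : Set (Nyikosization p φ f)}
    (hO : O ∈ 𝓝 (ofPoint q : Nyikosization p φ f)) {z : ℝ × ℝ} (hz : φ z = q) :
    ∀ᶠ y in 𝓝 z, ∀ h : φ y ≠ p, (ofPoint ⟨φ y, h⟩ : Nyikosization p φ f) ∈ O := by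
  have h1 := (continuous_ofPoint (p := p) hφ hf).continuousAt (x := q) hO
  rw [mem_map, nhds_subtype_eq_comap, mem_comap] at h1
  obtain ⟨B, hB, hBO⟩ := h1
  rw [← hz] at hB
  filter_upwards [hφ.continuous.continuousAt hB] with y hy h
  exact hBO (show (⟨φ y, h⟩ : {x : X // x ≠ p}) ∈ Subtype.val ⁻¹' B from hy)

include hφ hf

theorem isOpen_rayDomain {α : CountableOrdinal} :
    IsOpen (rayDomain α : Set (Nyikosization p φ f)) := by
  rw [isOpen_iff_mem_nhds]
  intro z hz
  rcases eq_ofPoint_or_ofRay z with ⟨q, rfl⟩ | ⟨x, rfl⟩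
  · rw [← (isOpenEmbedding_ofPoint hφ hf).map_nhds_eq, mem_map]
    exact continuous_subtype_val.continuousAt
      ((hφ.isOpenMap _ isOpen_planeRegion).mem_nhds hz)
  · refine mem_of_superset (inter_mem (boxUnion_small_mem_nhds x one_pos hf)
      (boxUnion_below_mem_nhds hφ hf (y := base α) hz)) ?_
    rw [boxUnion_inter hφ]
    exact boxUnion_mono (fun y hy => Or.inr hy.1.2.2) inter_subset_right

theorem isOpen_rayRegion : IsOpen (rayRegion : Set (Nyikosization p φ f)) := by
  rw [isOpen_iff_mem_nhds]
  intro z hz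
  rcases eq_ofPoint_or_ofRay z with ⟨q, rfl⟩ | ⟨x, rfl⟩
  · rw [← (isOpenEmbedding_ofPoint hφ hf).map_nhds_eq, mem_map]
    exact continuous_subtype_val.continuousAt
      ((hφ.isOpenMap _ isOpen_planeRegion).mem_nhds hz)
  · exact mem_of_superset (boxUnion_small_mem_nhds x one_pos hf)
      (boxUnion_mono (fun y hy => Or.inr hy.2.2) subset_rfl)

include h0

theorem continuousAt_box {z : Nyikosization p φ f} (hz : z ∈ (rayRegion : Set (Nyikosization p φ f))) :
    ContinuousAt (box : Nyikosization p φ f → ℝ × ℝ) z := by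
  have hr : ∃ y, φ y = collapse z := by
    rcases eq_ofPoint_or_ofRay z with ⟨q, rfl⟩ | ⟨x, rfl⟩
    · obtain ⟨y, -, hy⟩ := hz
      exact ⟨y, hy⟩
    · exact ⟨_, h0⟩
  obtain ⟨y, hy⟩ := hr
  refine ContinuousAt.comp (g := Function.invFun φ) ?_
    (continuous_collapse hφ h0 hf).continuousAt
  rw [← hy, ← hφ.continuousAt_iff]
  exact continuousAt_id.congr (Eventually.of_forall fun z =>
    (Function.leftInverse_invFun hφ.injective z).symm)

/-- At a point `x` of the ray, the curves of the points `β + r` squeeze the function: for `r` below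
the value at `x` a neighbourhood lies above that curve, where the coordinate is at least `r`; for
`r` above it a neighbourhood lies below the curve, where the coordinate is at most `r (1 + 2 |s|)`.
-/
theorem continuousAt_stripFun (β : CountableOrdinal) {z : Nyikosization p φ f}
    (hz : z ∈ (rayRegion : Set (Nyikosization p φ f))) :
    ContinuousAt (stripFun β : Nyikosization p φ f → ℝ) z := by
  rcases eq_ofPoint_or_ofRay z with ⟨q, rfl⟩ | ⟨x, rfl⟩
  · obtain ⟨y, hy, hyq⟩ := id hz
    rw [← (isOpenEmbedding_ofPoint hφ hf).continuousAt_iff]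
    have h1 := (continuousAt_box hφ h0 hf hz).comp
      (continuous_ofPoint (p := p) hφ hf).continuousAt
    refine ContinuousAt.comp (g := stripCoord f β) ?_ h1
    rw [show Function.invFun φ (q : X) = y from hyq ▸ Function.leftInverse_invFun hφ.injective y]
    exact hf.continuousAt_stripCoord β hy
  · refine tendsto_order.2 ⟨fun l hl => ?_, fun u hu => ?_⟩
    · rw [stripFun_ofRay] at hl
      rcases lt_or_ge l 0 with h | h
      · exact Eventually.of_forall fun z => h.trans_le (stripFun_nonneg β z)
      obtain ⟨r, h1, h2⟩ := exists_between hl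
      have hr : r ∈ Ico (0 : ℝ) 1 := ⟨h.trans h1.le, h2.trans_le (unitCoord_le_one β x)⟩
      filter_upwards [boxUnion_above_mem_nhds hf (point_lt_iff (r := ⟨r, hr⟩).2 h2)] with z hz
      refine h1.trans_le ?_
      rcases eq_ofPoint_or_ofRay z with ⟨q, rfl⟩ | ⟨y, rfl⟩
      · obtain ⟨y, hy, hyq⟩ := hz
        rw [stripFun_ofPoint hφ.injective β hyq]
        exact hf.le_stripCoord (r := ⟨r, hr⟩) hy.1 hy.2.le
      · exact (point_lt_iff (r := ⟨r, hr⟩).1 hz).le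
    · rw [stripFun_ofRay] at hu
      rcases lt_or_ge 1 u with h | h
      · exact Eventually.of_forall fun z => (stripFun_le_one β z).trans_lt h
      obtain ⟨r, h1, h2⟩ := exists_between hu
      have hr0 : 0 < r := (unitCoord_nonneg β x).trans_lt h1
      have hr : r ∈ Ico (0 : ℝ) 1 := ⟨hr0.le, h2.trans_le h⟩
      -- As `r < 1`, a bound `|s| < (u - r) / 2` forces `r (1 + 2 |s|) < u`.
      have hε : 0 < (u - r) / 2 := by linarith
      filter_upwards [boxUnion_below_mem_nhds hφ hf ((lt_point_iff (r := ⟨r, hr⟩) hr0).2 h1),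
        boxUnion_small_mem_nhds x hε hf] with z hz hz'
      rcases eq_ofPoint_or_ofRay z with ⟨q, rfl⟩ | ⟨y, rfl⟩
      · obtain ⟨y, hy, hyq⟩ := hz
        obtain ⟨y', hy', hyq'⟩ := hz'
        obtain rfl := hφ.injective (hyq.trans hyq'.symm)
        rw [stripFun_ofPoint hφ.injective β hyq]
        refine (hf.stripCoord_le (r := ⟨r, hr⟩) (s := y.1) (t := y.2) (le_of_lt hy)).trans_lt ?_
        simp only
        nlinarith [hy'.1, hr.2, abs_nonneg y.1]
      · exact ((lt_point_iff (r := ⟨r, hr⟩) hr0).1 hz).trans h2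

variable {w : CountableOrdinal → ℝ} (hw : Summable w) (hw0 : ∀ β, 0 ≤ w β) {v : ℝ → ℝ}
  (hvc : Continuous v) (hvm : StrictMono v) (hv0 : v 0 = 0)

include hw hw0 hvc

theorem continuousOn_rayMap : ContinuousOn (rayMap w v : Nyikosization p φ f → ℝ × ℝ) rayRegion := by
  have hb : ContinuousOn (box : Nyikosization p φ f → ℝ × ℝ) rayRegion := fun z hz =>
    (continuousAt_box hφ h0 hf hz).continuousWithinAt
  refine ContinuousOn.prodMk ?_ (continuous_fst.comp_continuousOn hb)
  refine ((hvc.comp continuous_snd).comp_continuousOn hb).add (continuousOn_tsum (fun β => ?_) hw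
    fun β z _ => norm_mul_le_of_unit hw0 (stripFun_nonneg β z) (stripFun_le_one β z) β)
  exact continuousOn_const.mul fun z hz =>
    (continuousAt_stripFun hφ h0 hf β hz).continuousWithinAt

omit hvc in
include hvm hv0 in
-- The second coordinate fixes the vertical. Off the axis the height is strictly increasing; on the
-- axis the lower half has negative heights `v t`, and the ray has non-negative heights that
-- increase strictly below `α`.
theorem injOn_rayMap {α : CountableOrdinal} (hpos : ∀ β < α, 0 < w β) :
    InjOn (rayMap w v : Nyikosization p φ f → ℝ × ℝ) (rayDomain α) := by
  have key : ∀ (y : ℝ × ℝ) (h : φ y ≠ p) (x : ClosedLongRay), (y.1 ≠ 0 ∨ y.2 < 0) →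
      rayMap w v (ofPoint ⟨φ y, h⟩ : Nyikosization p φ f) ≠
        rayMap w v (ofRay x : Nyikosization p φ f) := by
    rintro ⟨s, t⟩ h x hy he
    rw [rayMap_ofRay hφ.injective h0 w hv0, rayMap_ofPoint hφ.injective w v rfl] at he
    obtain ⟨h1, h2⟩ := Prod.ext_iff.1 he
    simp only at h1 h2
    subst h2
    rw [boxHeight_zero_left] at h1
    have ht : t < 0 := by simpa using hy
    have := hvm ht
    have := rayHeight_nonneg hw0 x
    linarith
  intro z hz z' hz' he
  rcases mem_rayDomain_cases hz with ⟨y, h, hy, rfl⟩ | ⟨x, hx, rfl⟩ <;>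
  rcases mem_rayDomain_cases hz' with ⟨y', h', hy', rfl⟩ | ⟨x', hx', rfl⟩
  · rw [rayMap_ofPoint hφ.injective w v rfl, rayMap_ofPoint hφ.injective w v rfl] at he
    obtain ⟨h1, h2⟩ := Prod.ext_iff.1 he
    obtain ⟨s, t⟩ := y
    obtain ⟨s', t'⟩ := y'
    simp only at h1 h2
    subst h2
    have := (strictMono_boxHeight hw hw0 hf hvm s).injective h1
    subst this
    rfl
  · exact absurd he (key y h x' hy)
  · exact absurd he.symm (key y' h' x hy')
  · rw [rayMap_ofRay hφ.injective h0 w hv0, rayMap_ofRay hφ.injective h0 w hv0] at he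
    rw [(strictMonoOn_rayHeight hw hw0 hpos).injOn (le_of_lt hx) (le_of_lt hx')
      (Prod.ext_iff.1 he).1]

end topology

end Nyikosization

/-! ### Openness of the ray maps and existence of ray charts -/

namespace Nyikosization

open ClosedLongRay

variable {X : Type*} {p : X} {φ : ℝ × ℝ → X} {f : CountableOrdinal → ℕ → ℕ}

theorem eventually_abs_lt {ε : ℝ} (hε : 0 < ε) : ∀ᶠ s : ℝ in 𝓝 0, |s| < ε :=
  (isOpen_lt continuous_abs continuous_const).mem_nhds (by simpa using hε)

open Classical in
/-- The section of the first coordinate of the box through the point `x` of the long ray. -/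
def raySection (x : ClosedLongRay) (s : ℝ) : Nyikosization p φ f :=
  if h : s ≠ 0 ∧ φ (s, rayCurve f x s) ≠ p then ofPoint ⟨_, h.2⟩ else ofRay x

theorem raySection_zero (x : ClosedLongRay) :
    (raySection x 0 : Nyikosization p φ f) = ofRay x := by simp [raySection]

theorem raySection_of_ne (hinj : Function.Injective φ) (h0 : φ (0, 0) = p) (x : ClosedLongRay)
    {s : ℝ} (hs : s ≠ 0) : (raySection x s : Nyikosization p φ f) =
      ofPoint ⟨φ (s, rayCurve f x s), apply_ne_of_ne hinj h0 fun h => hs (Prod.ext_iff.1 h).1⟩ :=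
  dif_pos ⟨hs, apply_ne_of_ne hinj h0 fun h => hs (Prod.ext_iff.1 h).1⟩

variable [TopologicalSpace X] (hφ : IsOpenEmbedding φ) (h0 : φ (0, 0) = p)
  (hf : IsNyikosSequence f)

include hφ h0 hf

/-- For small non-zero `s` the curve of `x` runs strictly between the curves that bound a given
basic neighbourhood of `x`. -/
theorem continuousAt_raySection (x : ClosedLongRay) :
    ContinuousAt (raySection x : ℝ → Nyikosization p φ f) 0 := by
  intro O hO
  rw [raySection_zero] at hO
  rw [mem_map]
  have habs : ∀ ε > 0, ∀ᶠ s : ℝ in 𝓝 0, |s| < ε := fun ε hε =>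
    eventually_abs_lt hε
  by_cases hx : IsMin x
  · obtain ⟨w, h1, h2, h3⟩ := exists_basicV_subset hf hx hO
    have hx' := isMin_iff.1 hx
    filter_upwards [habs _ h2] with s hs
    refine h3 ?_
    rcases eq_or_ne s 0 with rfl | hs0
    · rw [raySection_zero]
      exact ClosedLongRay.lt_iff.2
        (Or.inr ⟨CountableOrdinal.eq_of_isMin hx'.1 h1, by rwa [hx'.2]⟩)
    · rw [raySection_of_ne hφ.injective h0 x hs0]
      exact ⟨_, ⟨hs, (neg_lt_neg hs).trans_le (hf.neg_abs_le_rayCurve x s),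
        hf.rayCurve_lt_of_ord_eq (CountableOrdinal.eq_of_isMin hx'.1 h1) (by rwa [hx'.2]) hs0⟩, rfl⟩
  · obtain ⟨ε, hε, x₁, x₂, -, h1, h2, h3⟩ := exists_basicU_subset hf hx hO
    obtain ⟨ε₁, hε₁, H₁⟩ := hf.exists_rayCurve_lt h1
    obtain ⟨ε₂, hε₂, H₂⟩ := hf.exists_rayCurve_lt h2
    filter_upwards [habs _ hε, habs _ hε₁, habs _ hε₂] with s hs hs1 hs2
    refine h3 ?_
    rcases eq_or_ne s 0 with rfl | hs0
    · rw [raySection_zero]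
      exact ⟨h1, h2⟩
    · rw [raySection_of_ne hφ.injective h0 x hs0]
      exact ⟨(s, rayCurve f x s), ⟨hs, H₁ s hs0 hs1, H₂ s hs0 hs2⟩, rfl⟩

variable {w : CountableOrdinal → ℝ} (hw : Summable w) (hw0 : ∀ β, 0 ≤ w β) {v : ℝ → ℝ}
  (hvc : Continuous v) (hvm : StrictMono v) (hv0 : v 0 = 0) {α : CountableOrdinal}
  (hpos : ∀ β < α, 0 < w β)

include hw hw0 hvc

theorem continuousAt_height_raySection (x : ClosedLongRay) :
    ContinuousAt (fun s => height w v (raySection x s : Nyikosization p φ f)) 0 := by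
  have h1 : ContinuousAt (rayMap w v : Nyikosization p φ f → ℝ × ℝ) (raySection x 0) :=
    (continuousOn_rayMap hφ h0 hf hw hw0 hvc).continuousAt ((isOpen_rayRegion hφ hf).mem_nhds (by
      rw [raySection_zero]; exact mem_univ x))
  exact continuous_fst.continuousAt.comp (h1.comp (continuousAt_raySection hφ h0 hf x))

omit [TopologicalSpace X] hφ h0 in
/-- Intermediate values along a vertical segment of the box. -/
theorem exists_boxHeight_eq {s t₁ t₂ y : ℝ} (h12 : t₁ ≤ t₂) (hs : s ≠ 0 ∨ t₂ < 0)
    (h1 : boxHeight f w v (s, t₁) < y) (h2 : y < boxHeight f w v (s, t₂)) :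
    ∃ t ∈ Ioo t₁ t₂, boxHeight f w v (s, t) = y := by
  have hc : ContinuousOn (fun t => boxHeight f w v (s, t)) (Icc t₁ t₂) := by
    refine (continuousOn_boxHeight hw hw0 hf hvc).comp (f := fun t => (s, t)) (by fun_prop) ?_
    exact fun t ht => hs.imp id fun h => ht.2.trans_lt h
  exact intermediate_value_Ioo h12 hc ⟨h1, h2⟩

include hvm hv0 hpos

/-- A neighbourhood contains a region bounded below and above by two sections of the abscissa. Its
image fills the region between the heights of these sections: by intermediate values on each
vertical of the box, and by `exists_rayHeight_eq` on the ray. -/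
theorem image_rayMap_mem_nhds {z : Nyikosization p φ f} {O : Set (Nyikosization p φ f)}
    (hO : O ∈ 𝓝 z) (hOα : O ⊆ rayDomain α) : rayMap w v '' O ∈ 𝓝 (rayMap w v z) := by
  have habs : ∀ ε > 0, ∀ᶠ s : ℝ in 𝓝 0, |s| < ε := fun ε hε =>
    eventually_abs_lt hε
  have hzα := hOα (mem_of_mem_nhds hO)
  have hmonoR := strictMonoOn_rayHeight hw hw0 hpos
  rcases mem_rayDomain_cases hzα with ⟨⟨s₀, t₀⟩, h, hy, rfl⟩ | ⟨x, hx, rfl⟩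
  · rw [rayMap_ofPoint hφ.injective w v rfl]
    have hev := (eventually_ofPoint_mem hφ hf hO (z := (s₀, t₀)) rfl).and
      (isOpen_planeRegion.mem_nhds hy)
    obtain ⟨ε, hε, H⟩ := Metric.eventually_nhds_iff.1 hev
    have Hb : ∀ s t, |s - s₀| < ε → |t - t₀| < ε → (s ≠ 0 ∨ t < 0) ∧
        ∃ h : φ (s, t) ≠ p, (ofPoint ⟨_, h⟩ : Nyikosization p φ f) ∈ O := by
      intro s t hs ht
      have := H (y := (s, t)) (by rw [Prod.dist_eq]; exact max_lt hs ht)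
      refine ⟨this.2, ?_⟩
      have hne : φ (s, t) ≠ p := apply_ne_of_ne hφ.injective h0 (by
        rintro he
        obtain ⟨rfl, rfl⟩ := Prod.ext_iff.1 he
        simpa using this.2)
      exact ⟨hne, this.1 hne⟩
    have hct : ∀ t, |t - t₀| < ε → ContinuousAt (fun s => boxHeight f w v (s, t)) s₀ := by
      intro t ht
      refine ContinuousAt.comp (f := fun s => (s, t)) (g := boxHeight f w v) ?_ (by fun_prop)
      exact (continuousOn_boxHeight hw hw0 hf hvc).continuousAt
        (isOpen_planeRegion.mem_nhds (Hb s₀ t (by simpa) ht).1)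
    have hm1 : |t₀ - ε / 2 - t₀| < ε := by rw [abs_lt]; constructor <;> linarith
    have hm2 : |t₀ + ε / 2 - t₀| < ε := by rw [abs_lt]; constructor <;> linarith
    have hmono := strictMono_boxHeight hw hw0 hf hvm
    refine mem_nhds_prod_of_sections (hct _ hm1) (hct _ hm2)
      (hmono s₀ (by linarith : t₀ - ε / 2 < t₀)) (hmono s₀ (by linarith : t₀ < t₀ + ε / 2)) ?_
    filter_upwards [Metric.ball_mem_nhds s₀ hε] with s hs y h1 h2
    obtain ⟨t, ⟨ht1, ht2⟩, rfl⟩ := exists_boxHeight_eq hf hw hw0 hvc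
      (by linarith : t₀ - ε / 2 ≤ t₀ + ε / 2) (Hb s _ hs hm2).1 h1 h2
    obtain ⟨-, hne, hmem⟩ := Hb s t hs (by rw [abs_lt]; constructor <;> linarith)
    exact ⟨_, hmem, rayMap_ofPoint hφ.injective w v rfl⟩
  rw [rayMap_ofRay hφ.injective h0 w hv0]
  -- Substitute for the intermediate value theorem on the axis.
  have hray : ∀ x'', x'' < base α → ∀ y, 0 ≤ y → y < rayHeight w x'' →
      ∃ x' < x'', rayHeight w x' = y := by
    intro x'' hx'' y hy0 hy
    obtain ⟨x', h1, h2⟩ := exists_rayHeight_eq hw hw0 hpos hy0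
      (hy.trans (hmonoR (le_of_lt hx'') (le_refl (base α)) hx''))
    refine ⟨x', ?_, h2⟩
    rw [← h2] at hy
    exact (hmonoR.lt_iff_lt h1.le hx''.le).1 hy
  by_cases hxm : IsMin x
  · obtain ⟨b, hb1, hb2, hb3⟩ := exists_basicV_subset hf hxm hO
    have hx' := isMin_iff.1 hxm
    have hxb : x < b := ClosedLongRay.lt_iff.2
      (Or.inr ⟨CountableOrdinal.eq_of_isMin hx'.1 hb1, by rwa [hx'.2]⟩)
    obtain ⟨x'', hx1, hx2⟩ := exists_between (lt_min hxb hx)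
    have hx''α := (lt_min_iff.1 hx2).2
    have hx''b := (lt_min_iff.1 hx2).1
    obtain ⟨ε₂, hε₂, H₂⟩ := hf.exists_rayCurve_lt hx''b
    have hneg : -(b.frac / 2) < 0 := by linarith
    have hc1 : ContinuousAt (fun s => boxHeight f w v (s, -(b.frac / 2))) 0 := by
      refine ContinuousAt.comp (f := fun s => (s, -(b.frac / 2))) (g := boxHeight f w v) ?_
        (by fun_prop)
      exact (continuousOn_boxHeight hw hw0 hf hvc).continuousAt
        (isOpen_planeRegion.mem_nhds (Or.inr hneg))
    have hvneg : v (-(b.frac / 2)) < 0 := hv0 ▸ hvm hneg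
    -- At the least point the region lies between the line `t = -(b.frac / 2)` and the curve of
    -- `x''`. Requiring `|s| < b.frac / 2` keeps the wedge, hence the curve, above the line. On the
    -- axis negative heights come from the vertical and the others from the ray.
    refine mem_nhds_prod_of_sections hc1
      (continuousAt_height_raySection hφ h0 hf hw hw0 hvc x'') ?_ ?_ ?_
    · rw [boxHeight_zero_left]
      exact hvneg.trans_le (rayHeight_nonneg hw0 x)
    · rw [raySection_zero, height_ofRay hφ.injective h0 w hv0]
      exact hmonoR hx.le hx''α.le hx1
    filter_upwards [habs _ hε₂, habs (b.frac / 2) (by linarith)] with s hs2 hs y h1 h2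
    rcases eq_or_ne s 0 with rfl | hs0
    · rw [boxHeight_zero_left] at h1
      rw [raySection_zero, height_ofRay hφ.injective h0 w hv0] at h2
      rcases lt_or_ge y 0 with hy | hy
      · obtain ⟨t, ⟨ht1, ht2⟩, rfl⟩ := intermediate_value_Ioo hneg.le hvc.continuousOn
          (show y ∈ Ioo (v (-(b.frac / 2))) (v 0) from ⟨h1, by rwa [hv0]⟩)
        have hne : φ (0, t) ≠ p := apply_ne_of_ne hφ.injective h0 fun he =>
          ht2.ne (Prod.ext_iff.1 he).2
        refine ⟨ofPoint ⟨_, hne⟩, hb3 ⟨(0, t), ⟨?_, ?_, ?_⟩, rfl⟩, ?_⟩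
        · change |(0 : ℝ)| < b.frac
          rwa [abs_zero]
        · change -b.frac < t
          linarith
        · change t < rayCurve f b 0
          rwa [rayCurve_zero]
        · rw [rayMap_ofPoint hφ.injective w v rfl, boxHeight_zero_left]
      · obtain ⟨x', h3, rfl⟩ := hray x'' hx''α y hy h2
        exact ⟨ofRay x', hb3 (h3.trans hx''b), rayMap_ofRay hφ.injective h0 w hv0 x'⟩
    · rw [raySection_of_ne hφ.injective h0 _ hs0, height_ofPoint hφ.injective w v rfl] at h2
      have hle := hf.neg_abs_le_rayCurve x'' s
      obtain ⟨t, ⟨ht1, ht2⟩, rfl⟩ := exists_boxHeight_eq hf hw hw0 hvc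
        (by linarith : -(b.frac / 2) ≤ rayCurve f x'' s) (Or.inl hs0) h1 h2
      have hne : φ (s, t) ≠ p := apply_ne_of_ne hφ.injective h0 fun he =>
        hs0 (Prod.ext_iff.1 he).1
      refine ⟨ofPoint ⟨_, hne⟩, hb3 ⟨(s, t), ⟨?_, ?_, ?_⟩, rfl⟩,
        rayMap_ofPoint hφ.injective w v rfl⟩
      · change |s| < b.frac
        linarith
      · change -b.frac < t
        linarith
      · exact ht2.trans (H₂ s hs0 hs2)
  · obtain ⟨ε, hε, x₁, x₂, -, h1, h2, h3⟩ := exists_basicU_subset hf hxm hO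
    -- With `x₁ < x' < x < x'' < x₂`, the region between the curves of `x'` and `x''` lies, near `s
    -- = 0`, inside the neighbourhood bounded by the curves of `x₁` and `x₂`.
    obtain ⟨x', hx1, hx2⟩ := exists_between h1
    obtain ⟨x'', hx3, hx4⟩ := exists_between (lt_min h2 hx)
    have hx''α := (lt_min_iff.1 hx4).2
    have hx''b := (lt_min_iff.1 hx4).1
    have hxx := hx2.trans hx3
    have hx'α := hx2.trans hx
    obtain ⟨ε₁, hε₁, H₁⟩ := hf.exists_rayCurve_lt hx1
    obtain ⟨ε₂, hε₂, H₂⟩ := hf.exists_rayCurve_lt hx''b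
    obtain ⟨ε₃, hε₃, H₃⟩ := hf.exists_rayCurve_lt hxx
    refine mem_nhds_prod_of_sections (continuousAt_height_raySection hφ h0 hf hw hw0 hvc x')
      (continuousAt_height_raySection hφ h0 hf hw hw0 hvc x'') ?_ ?_ ?_
    · rw [raySection_zero, height_ofRay hφ.injective h0 w hv0]
      exact hmonoR hx'α.le hx.le hx2
    · rw [raySection_zero, height_ofRay hφ.injective h0 w hv0]
      exact hmonoR hx.le hx''α.le hx3
    filter_upwards [habs _ hε, habs _ hε₁, habs _ hε₂, habs _ hε₃] with s hs hs1 hs2 hs3 y h5 h6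
    rcases eq_or_ne s 0 with rfl | hs0
    · rw [raySection_zero, height_ofRay hφ.injective h0 w hv0] at h5 h6
      obtain ⟨x₃, h7, rfl⟩ := hray x'' hx''α y ((rayHeight_nonneg hw0 x').trans h5.le) h6
      have h8 := (hmonoR.lt_iff_lt hx'α.le (h7.trans hx''α).le).1 h5
      exact ⟨ofRay x₃, h3 ⟨hx1.trans h8, h7.trans hx''b⟩, rayMap_ofRay hφ.injective h0 w hv0 x₃⟩
    · rw [raySection_of_ne hφ.injective h0 _ hs0, height_ofPoint hφ.injective w v rfl] at h5 h6
      obtain ⟨t, ⟨ht1, ht2⟩, rfl⟩ := exists_boxHeight_eq hf hw hw0 hvc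
        (H₃ s hs0 hs3).le (Or.inl hs0) h5 h6
      have hne : φ (s, t) ≠ p := apply_ne_of_ne hφ.injective h0 fun he =>
        hs0 (Prod.ext_iff.1 he).1
      exact ⟨ofPoint ⟨_, hne⟩, h3 ⟨(s, t), ⟨hs, (H₁ s hs0 hs1).trans ht1,
        ht2.trans (H₂ s hs0 hs2)⟩, rfl⟩, rayMap_ofPoint hφ.injective w v rfl⟩

/-- There is a chart on `rayDomain α` that is given by `rayMap`. -/
theorem exists_rayChart : ∃ e : OpenPartialHomeomorph (Nyikosization p φ f) (ℝ × ℝ),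
    e.source = rayDomain α ∧ ∀ z, e z = rayMap w v z := by
  have : Nonempty (Nyikosization p φ f) := ⟨ofRay (base α)⟩
  have hopen := isOpen_rayDomain (p := p) (α := α) hφ hf
  refine ⟨OpenPartialHomeomorph.ofContinuousOpenRestrict
    ((injOn_rayMap hφ h0 hf hw hw0 hvm hv0 hpos).toPartialEquiv (rayMap w v) (rayDomain α))
    ((continuousOn_rayMap hφ h0 hf hw hw0 hvc).mono (rayDomain_subset α)) ?_ hopen, rfl,
    fun z => rfl⟩
  intro V hV
  rw [isOpen_iff_mem_nhds]
  rintro _ ⟨z, hz, rfl⟩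
  obtain ⟨V', hV', rfl⟩ := hV
  refine mem_of_superset (image_rayMap_mem_nhds hφ h0 hf hw hw0 hvc hvm hv0 hpos
    ((hV'.inter hopen).mem_nhds ⟨hz, z.2⟩) inter_subset_right) ?_
  rintro _ ⟨y, ⟨hy1, hy2⟩, rfl⟩
  exact ⟨⟨y, hy2⟩, hy1, rfl⟩

end Nyikosization

/-! ### Foliations generated by an atlas -/

section compatible

variable {M : Type*} [TopologicalSpace M]

theorem FoliatedCompatible.of_restrict {e e' d d' : OpenPartialHomeomorph M (ℝ × ℝ)}
    (h : FoliatedCompatible e e') (hs : (d.symm.trans d').source ⊆ (e.symm.trans e').source)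
    (hv : ∀ w ∈ (d.symm.trans d').source, (d.symm.trans d') w = (e.symm.trans e') w) :
    FoliatedCompatible d d' := by
  intro z hz
  obtain ⟨V, hV, hzV, hVs, k, hk, hki, hkv⟩ := h z (hs hz)
  have hsub : Prod.snd '' (V ∩ (d.symm.trans d').source) ⊆ Prod.snd '' V :=
    image_mono inter_subset_left
  exact ⟨_, hV.inter (d.symm.trans d').open_source, ⟨hzV, hz⟩, inter_subset_right, k,
    hk.mono hsub, hki.mono hsub, fun w hw => by rw [hv w hw.2, hkv w hw.1]⟩

theorem FoliatedCompatible.of_locally_add {e e' : OpenPartialHomeomorph M (ℝ × ℝ)}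
    (h : ∀ z ∈ e.source, z ∈ e'.source → ∃ c, ∀ᶠ y in 𝓝 z, (e' y).2 = (e y).2 + c) :
    FoliatedCompatible e e' := by
  intro w hw
  have hw' := hw
  rw [OpenPartialHomeomorph.trans_source] at hw'
  obtain ⟨c, hc⟩ := h (e.symm w) (e.map_target hw'.1) hw'.2
  obtain ⟨N, hN, oN, mN⟩ := mem_nhds_iff.1 hc
  refine ⟨(e.symm.trans e').source ∩ (e.target ∩ e.symm ⁻¹' N), (e.symm.trans e').open_source.inter
    (e.symm.isOpen_inter_preimage oN), ⟨hw, hw'.1, mN⟩, inter_subset_left, fun y => y + c,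
    by fun_prop, fun a _ b _ hab => add_right_cancel hab, ?_⟩
  rintro y ⟨-, hy, hyN⟩
  have := hN hyN
  rw [mem_ofPred_eq, e.right_inv hy] at this
  exact this

/-- Near each point the coordinate change factors through a chart of the cover around that point,
and the transverse embeddings compose. This makes the charts compatible with a generating family
compatible with one another. -/
theorem FoliatedCompatible.of_cover {B : Set (OpenPartialHomeomorph M (ℝ × ℝ))}
    (hcov : ∀ x : M, ∃ b ∈ B, x ∈ b.source) {e e' : OpenPartialHomeomorph M (ℝ × ℝ)}
    (h : ∀ b ∈ B, FoliatedCompatible e b) (h' : ∀ b ∈ B, FoliatedCompatible b e') :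
    FoliatedCompatible e e' := by
  intro z hz
  have hz' := hz
  rw [OpenPartialHomeomorph.trans_source] at hz'
  obtain ⟨b, hb, hzb⟩ := hcov (e.symm z)
  have h1 : z ∈ (e.symm.trans b).source := by
    rw [OpenPartialHomeomorph.trans_source]; exact ⟨hz'.1, hzb⟩
  have h2 : (e.symm.trans b) z ∈ (b.symm.trans e').source := by
    rw [OpenPartialHomeomorph.trans_source]
    refine ⟨b.map_source hzb, ?_⟩
    change b.symm (b (e.symm z)) ∈ e'.source
    rw [b.left_inv hzb]
    exact hz'.2
  obtain ⟨V, oV, mV, sV, k, ck, ik, vk⟩ := h b hb z h1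
  obtain ⟨V', oV', mV', sV', k', ck', ik', vk'⟩ := h' b hb _ h2
  have hmaps : MapsTo k (Prod.snd '' (V ∩ ((e.symm.trans b).source ∩ (e.symm.trans b) ⁻¹' V')))
      (Prod.snd '' V') := by
    rintro _ ⟨w, ⟨hw, -, hw'⟩, rfl⟩
    exact ⟨_, hw', vk w hw⟩
  have hsub : Prod.snd '' (V ∩ ((e.symm.trans b).source ∩ (e.symm.trans b) ⁻¹' V')) ⊆
      Prod.snd '' V := image_mono inter_subset_left
  have hval : ∀ w ∈ V ∩ ((e.symm.trans b).source ∩ (e.symm.trans b) ⁻¹' V'),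
      (b.symm.trans e') ((e.symm.trans b) w) = (e.symm.trans e') w := by
    rintro w ⟨-, hw, -⟩
    change e' (b.symm (b (e.symm w))) = e' (e.symm w)
    rw [b.left_inv (show e.symm w ∈ b.source from hw.2)]
  refine ⟨V ∩ ((e.symm.trans b).source ∩ (e.symm.trans b) ⁻¹' V'),
    oV.inter ((e.symm.trans b).isOpen_inter_preimage oV'), ⟨mV, h1, mV'⟩, ?_, k' ∘ k,
    ck'.comp (ck.mono hsub) hmaps, ik'.comp (ik.mono hsub) hmaps, ?_⟩
  · rintro w ⟨-, hw, hw'⟩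
    rw [OpenPartialHomeomorph.trans_source]
    refine ⟨hw.1, ?_⟩
    have h3 : b.symm (b (e.symm w)) ∈ e'.source := (sV' hw').2
    rw [b.left_inv (show e.symm w ∈ b.source from hw.2)] at h3
    exact h3
  · intro w hw
    rw [← hval w hw, vk' _ hw.2.2, vk w hw.1, Function.comp_apply]

end compatible

namespace Foliation

variable {M : Type*} [TopologicalSpace M]

/-- The foliation generated by a covering family of pairwise compatible charts. -/
def generate (B : Set (OpenPartialHomeomorph M (ℝ × ℝ))) (hcov : ∀ x : M, ∃ b ∈ B, x ∈ b.source)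
    (hB : ∀ b ∈ B, ∀ b' ∈ B, FoliatedCompatible b b') : Foliation M where
  atlas := {e | ∀ b ∈ B, FoliatedCompatible e b ∧ FoliatedCompatible b e}
  cover x := (hcov x).imp fun b hb => ⟨fun b' hb' => ⟨hB b hb.1 b' hb', hB b' hb' b hb.1⟩, hb.2⟩
  compatible _ he _ he' := .of_cover hcov (fun b hb => (he b hb).1) fun b hb => (he' b hb).2
  maximal _ he b hb := he b fun b' hb' => ⟨hB b hb b' hb', hB b' hb' b hb⟩

theorem subset_atlas_generate (B : Set (OpenPartialHomeomorph M (ℝ × ℝ)))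
    (hcov : ∀ x : M, ∃ b ∈ B, x ∈ b.source) (hB : ∀ b ∈ B, ∀ b' ∈ B, FoliatedCompatible b b') :
    B ⊆ (generate B hcov hB).atlas := fun b hb b' hb' => ⟨hB b hb b' hb', hB b' hb' b hb⟩

/-! ### The leaf topology and parametrizations of leaves -/

variable (F : Foliation M)

theorem restrOpen_mem_atlas {e : OpenPartialHomeomorph M (ℝ × ℝ)} (he : e ∈ F.atlas) {s : Set M}
    (hs : IsOpen s) : e.restrOpen s hs ∈ F.atlas := by
  refine F.maximal _ fun e' he' => ⟨(F.compatible e he e' he').of_restrict ?_ fun w _ => rfl,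
    (F.compatible e' he' e he).of_restrict ?_ fun w _ => rfl⟩
  · rintro w ⟨hw, hw'⟩
    exact ⟨hw.1, hw'⟩
  · rintro w ⟨hw, hw'⟩
    exact ⟨hw, hw'.1⟩

/-- A parametrization of a subset that is locally a horizontal line of a foliated chart. -/
structure IsLeafParam {L : Type*} [TopologicalSpace L] (γ : L → M) : Prop where
  injective : Function.Injective γ
  exists_chart : ∀ x, ∃ b ∈ F.atlas, ∃ (k : OpenPartialHomeomorph L ℝ) (c : ℝ), x ∈ k.source ∧
    ∀ y ∈ k.source, γ y ∈ b.source ∧ b (γ y) = (k y, c)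

variable {F} {L : Type*} [TopologicalSpace L] {γ : L → M}

/-- A short horizontal segment of the chart `b` is connected and, by compatibility, stays on one
level of the chart `e`; hence it lies in the plaque of `e` that it meets. -/
theorem IsLeafParam.isOpen_preimage_plaque (h : F.IsLeafParam γ) {P : Set M} (hP : F.IsPlaque P) :
    IsOpen (γ ⁻¹' P) := by
  obtain ⟨e, he, x₀, hx₀, rfl⟩ := hP
  rw [isOpen_iff_mem_nhds]
  intro y hy
  obtain ⟨b, hb, k, c, hyk, hk⟩ := h.exists_chart y
  have hye := connectedComponentIn_subset _ _ hy
  have hsrc : (k y, c) ∈ (b.symm.trans e).source := by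
    rw [OpenPartialHomeomorph.trans_source]
    refine ⟨?_, ?_⟩
    · rw [← (hk y hyk).2]; exact b.map_source (hk y hyk).1
    · rw [mem_preimage, ← (hk y hyk).2, b.left_inv (hk y hyk).1]; exact hye.1
  obtain ⟨V, oV, mV, sV, g, -, -, vg⟩ := F.compatible b hb e he _ hsrc
  have hopen : IsOpen {r : ℝ | (r, c) ∈ V} := oV.preimage (by fun_prop)
  obtain ⟨ε, hε, H⟩ := Metric.isOpen_iff.1 hopen (k y) mV
  have hγ : ∀ y' ∈ k.source, γ y' = b.symm (k y', c) := fun y' hy' => by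
    rw [← (hk y' hy').2, b.left_inv (hk y' hy').1]
  have hconn : IsPreconnected ((fun r => b.symm (r, c)) '' Metric.ball (k y) ε) := by
    refine (convex_ball _ _).isPreconnected.image _ ?_
    exact b.symm.continuousOn.comp (by fun_prop) fun r hr => (sV (H hr)).1
  have hval : ∀ r ∈ Metric.ball (k y) ε, (e (b.symm (r, c))).2 = g c := fun r hr => vg _ (H hr)
  have hmem : γ y ∈ (fun r => b.symm (r, c)) '' Metric.ball (k y) ε :=
    ⟨k y, Metric.mem_ball_self hε, (hγ y hyk).symm⟩
  have hsub : (fun r => b.symm (r, c)) '' Metric.ball (k y) ε ⊆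
      {z | z ∈ e.source ∧ (e z).2 = (e x₀).2} := by
    rintro _ ⟨r, hr, rfl⟩
    refine ⟨(sV (H hr)).2, ?_⟩
    rw [hval r hr, ← hye.2, hγ y hyk, hval _ (Metric.mem_ball_self hε)]
  rw [connectedComponentIn_eq hy]
  filter_upwards [k.open_source.mem_nhds hyk,
    (k.continuousAt hyk).preimage_mem_nhds (Metric.ball_mem_nhds _ hε)] with y' h1 h2
  refine hconn.subset_connectedComponentIn hmem hsub ⟨k y', h2, (hγ y' h1).symm⟩

/-- By maximality the atlas contains the restriction of `b` to the points whose leafwise coordinate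
lies in the open set `k '' (k.source ∩ U)`. A whole level set of this restriction, and so a plaque,
is contained in the image of `U`. -/
theorem IsLeafParam.isOpen_image (h : F.IsLeafParam γ) {U : Set L} (hU : IsOpen U) :
    IsOpen[F.leafTopology] (γ '' U) := by
  refine (@isOpen_iff_forall_mem_open M F.leafTopology _).2 ?_
  rintro _ ⟨y, hy, rfl⟩
  obtain ⟨b, hb, k, c, hyk, hk⟩ := h.exists_chart y
  have hJ : IsOpen (k '' (k.source ∩ U)) :=
    k.isOpen_image_of_subset_source (k.open_source.inter hU) inter_subset_left
  have hs : IsOpen (b.source ∩ b ⁻¹' (Prod.fst ⁻¹' (k '' (k.source ∩ U)))) :=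
    b.isOpen_inter_preimage (hJ.preimage continuous_fst)
  have hmem : γ y ∈ (b.restrOpen _ hs).source := by
    rw [OpenPartialHomeomorph.restrOpen_source]
    refine ⟨(hk y hyk).1, (hk y hyk).1, ?_⟩
    rw [mem_preimage, (hk y hyk).2]
    exact ⟨y, ⟨hyk, hy⟩, rfl⟩
  refine ⟨_, ?_, TopologicalSpace.isOpen_generateFrom_of_mem
    ⟨_, F.restrOpen_mem_atlas hb hs, γ y, hmem, rfl⟩, mem_connectedComponentIn ⟨hmem, rfl⟩⟩
  refine (connectedComponentIn_subset _ _).trans ?_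
  rintro z ⟨⟨hz, -, y', ⟨hy', hyU⟩, h1⟩, h2⟩
  change (b z).2 = (b (γ y)).2 at h2
  refine ⟨y', hyU, b.injOn (hk y' hy').1 hz ?_⟩
  rw [(hk y' hy').2]
  refine Prod.ext h1 ?_
  rw [h2, (hk y hyk).2]

theorem IsLeafParam.isOpenEmbedding (h : F.IsLeafParam γ) :
    @IsOpenEmbedding L M _ F.leafTopology γ :=
  @IsOpenEmbedding.of_continuous_injective_isOpenMap L M γ _ F.leafTopology
    (continuous_generateFrom_iff.2 fun _ hP => h.isOpen_preimage_plaque hP) h.injective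
    fun _ hU => h.isOpen_image hU

theorem IsLeafParam.leafHomeomorphic_range (h : F.IsLeafParam γ) {Y : Type*} [TopologicalSpace Y]
    (g : L ≃ₜ Y) : F.LeafHomeomorphic (range γ) Y :=
  ⟨@Homeomorph.trans _ _ _ (F.intrinsicTopology _) _ _
    (@Homeomorph.symm _ _ _ (F.intrinsicTopology _)
      (@IsEmbedding.toHomeomorph L M _ F.leafTopology γ
        (@IsOpenEmbedding.isEmbedding L M γ _ F.leafTopology h.isOpenEmbedding))) g⟩

theorem IsLeafParam.isPathConnected_range [PathConnectedSpace L] (h : F.IsLeafParam γ) :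
    @IsPathConnected M F.leafTopology (range γ) :=
  @_root_.isPathConnected_range L M _ F.leafTopology _ γ
    (@IsOpenEmbedding.continuous L M γ _ F.leafTopology h.isOpenEmbedding)

theorem IsLeafParam.isOpen_range (h : F.IsLeafParam γ) : IsOpen[F.leafTopology] (range γ) :=
  @IsOpenEmbedding.isOpen_range L M _ F.leafTopology γ h.isOpenEmbedding

end Foliation

/-- The complement of a piece is a union of open pieces, so each piece is clopen and no path leaves
it. -/
theorem pathComponent_eq_of_partition {N : Type*} [TopologicalSpace N] {𝒮 : Set (Set N)}
    (hopen : ∀ l ∈ 𝒮, IsOpen l) (hpath : ∀ l ∈ 𝒮, IsPathConnected l) (hcov : ∀ x, ∃ l ∈ 𝒮, x ∈ l)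
    (hdisj : ∀ l ∈ 𝒮, ∀ l' ∈ 𝒮, (l ∩ l').Nonempty → l = l') {l : Set N} (hl : l ∈ 𝒮) {x : N}
    (hx : x ∈ l) : pathComponent x = l := by
  refine Subset.antisymm ?_ ((hpath l hl).subset_pathComponent hx)
  have hclosed : IsClosed l := by
    rw [← isOpen_compl_iff, isOpen_iff_forall_mem_open]
    intro y hy
    obtain ⟨l', hl', hy'⟩ := hcov y
    refine ⟨l', fun z hz hzl => hy ?_, hopen l' hl', hy'⟩
    rw [hdisj l hl l' hl' ⟨z, hzl, hz⟩]
    exact hy'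
  exact isPathConnected_pathComponent.isConnected.isPreconnected.subset_isClopen
    ⟨hclosed, hopen l hl⟩ ⟨x, mem_pathComponent_self x, hx⟩

theorem Foliation.isLeaf_iff_of_partition {M : Type*} [TopologicalSpace M] (F : Foliation M)
    {𝒮 : Set (Set M)} (hopen : ∀ l ∈ 𝒮, IsOpen[F.leafTopology] l)
    (hpath : ∀ l ∈ 𝒮, @IsPathConnected M F.leafTopology l) (hcov : ∀ x, ∃ l ∈ 𝒮, x ∈ l)
    (hdisj : ∀ l ∈ 𝒮, ∀ l' ∈ 𝒮, (l ∩ l').Nonempty → l = l') (l : Set M) :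
    F.IsLeaf l ↔ l ∈ 𝒮 := by
  have key : ∀ l ∈ 𝒮, ∀ x ∈ l, @pathComponent M F.leafTopology x = l := fun l hl x hx =>
    @pathComponent_eq_of_partition M F.leafTopology 𝒮 hopen hpath hcov hdisj l hl x hx
  constructor
  · rintro ⟨x, rfl⟩
    obtain ⟨l, hl, hx⟩ := hcov x
    rwa [key l hl x hx]
  · intro hl
    obtain ⟨x, hx, -⟩ := hpath l hl
    exact ⟨x, (key l hl x hx).symm⟩

/-! ### Kronecker flows -/

/-- The covering of the torus by the plane, in coordinates `(v, u)` along the flow and along the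
horizontal circle through `p`. -/
def kroneckerPlane (a : ℝ) (p : Torus) (z : ℝ × ℝ) : Torus :=
  kroneckerFlow a z.1 (p + (((z.2 : ℝ) : UnitAddCircle), 0))

section kronecker

variable {a : ℝ} {p : Torus}

theorem kroneckerPlane_eq (z : ℝ × ℝ) : kroneckerPlane a p z =
    p + (((z.2 + z.1 : ℝ) : UnitAddCircle), ((a * z.1 : ℝ) : UnitAddCircle)) := by
  rw [kroneckerPlane, kroneckerFlow, add_assoc]
  simp

theorem kroneckerFlow_kroneckerFlow (s t : ℝ) (q : Torus) :
    kroneckerFlow a s (kroneckerFlow a t q) = kroneckerFlow a (t + s) q := by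
  simp only [kroneckerFlow, add_assoc, Prod.mk_add_mk, ← AddCircle.coe_add, ← mul_add]

theorem kroneckerFlow_zero (q : Torus) : kroneckerFlow a 0 q = q := by
  simp [kroneckerFlow]

theorem kroneckerPlane_zero_right (t : ℝ) : kroneckerPlane a p (t, 0) = kroneckerFlow a t p := by
  simp [kroneckerPlane, Prod.mk_zero_zero]

theorem kroneckerFlow_kroneckerPlane (t v u : ℝ) :
    kroneckerFlow a t (kroneckerPlane a p (v, u)) = kroneckerPlane a p (v + t, u) :=
  kroneckerFlow_kroneckerFlow _ _ _

theorem unitAddCircle_coe_eq_iff {x y : ℝ} :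
    (x : UnitAddCircle) = y ↔ ∃ n : ℤ, (n : ℝ) = x - y := by
  rw [← sub_eq_zero, ← AddCircle.coe_sub, AddCircle.coe_eq_zero_iff]
  simp

theorem kroneckerPlane_eq_iff {z z' : ℝ × ℝ} : kroneckerPlane a p z = kroneckerPlane a p z' ↔
    (∃ m : ℤ, (m : ℝ) = (z.2 + z.1) - (z'.2 + z'.1)) ∧ ∃ n : ℤ, (n : ℝ) = a * z.1 - a * z'.1 := by
  rw [kroneckerPlane_eq, kroneckerPlane_eq, add_right_inj, Prod.ext_iff]
  exact and_congr unitAddCircle_coe_eq_iff unitAddCircle_coe_eq_iff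

theorem kroneckerPlane_add {z z' : ℝ × ℝ} (h : kroneckerPlane a p z = kroneckerPlane a p z')
    (c : ℝ × ℝ) : kroneckerPlane a p (z + c) = kroneckerPlane a p (z' + c) := by
  rw [kroneckerPlane_eq_iff] at *
  obtain ⟨⟨m, hm⟩, n, hn⟩ := h
  exact ⟨⟨m, by rw [hm]; simp; ring⟩, n, by rw [hn]; simp; ring⟩

theorem eq_zero_of_abs_intCast_lt_one {n : ℤ} {x : ℝ} (h : (n : ℝ) = x) (hx : |x| < 1) :
    x = 0 := by
  rw [← h] at hx ⊢
  have : |n| < 1 := by exact_mod_cast hx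
  rw [Int.abs_lt_one_iff.1 this, Int.cast_zero]

theorem kroneckerPlane_injective_of_close (ha : a ≠ 0) {z z' : ℝ × ℝ}
    (h : kroneckerPlane a p z = kroneckerPlane a p z')
    (h1 : |(z.2 + z.1) - (z'.2 + z'.1)| < 1) (h2 : |a * z.1 - a * z'.1| < 1) : z = z' := by
  obtain ⟨⟨m, hm⟩, n, hn⟩ := kroneckerPlane_eq_iff.1 h
  have e1 := eq_zero_of_abs_intCast_lt_one hm h1
  have e2 := eq_zero_of_abs_intCast_lt_one hn h2
  rw [← mul_sub, mul_eq_zero, or_iff_right ha] at e2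
  exact Prod.ext (by linarith) (by linarith)

/-- A return of the orbit after time `m` needs both `m` and `a * m` to be integers, which
irrationality allows only for `m = 0`. -/
theorem kroneckerPlane_left_injective (ha : Irrational a) {v v' u : ℝ}
    (h : kroneckerPlane a p (v, u) = kroneckerPlane a p (v', u)) : v = v' := by
  obtain ⟨⟨m, hm⟩, n, hn⟩ := kroneckerPlane_eq_iff.1 h
  simp only at hm hn
  have h1 : (m : ℝ) = v - v' := by linarith
  have h2 : a * m = n := by rw [h1, hn]; ring
  by_cases hm0 : m = 0
  · rw [hm0, Int.cast_zero] at h1; linarith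
  · exact absurd (h2.symm ▸ ha.mul_intCast hm0 : Irrational (n : ℝ)) (Int.not_irrational n)

theorem kroneckerFlow_injective (ha : Irrational a) (q : Torus) :
    Function.Injective fun t => kroneckerFlow a t q := fun t t' h => by
  refine kroneckerPlane_left_injective (p := q) (u := 0) ha ?_
  simpa only [kroneckerPlane_zero_right] using h

theorem kroneckerPlane_surjective (ha : a ≠ 0) : Function.Surjective (kroneckerPlane a p) := by
  rintro ⟨x, y⟩
  obtain ⟨x', hx⟩ := QuotientAddGroup.mk_surjective (x - p.1)
  obtain ⟨y', hy⟩ := QuotientAddGroup.mk_surjective (y - p.2)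
  refine ⟨(y' / a, x' - y' / a), ?_⟩
  rw [kroneckerPlane_eq]
  refine Prod.ext ?_ ?_
  · simp only [sub_add_cancel]
    change p.1 + (QuotientAddGroup.mk x' : UnitAddCircle) = x
    rw [hx, add_sub_cancel]
  · simp only [mul_div_cancel₀ _ ha]
    change p.2 + (QuotientAddGroup.mk y' : UnitAddCircle) = y
    rw [hy, add_sub_cancel]

theorem continuous_kroneckerPlane : Continuous (kroneckerPlane a p) := by
  have : kroneckerPlane a p = fun z : ℝ × ℝ =>
    p + (((z.2 + z.1 : ℝ) : UnitAddCircle), ((a * z.1 : ℝ) : UnitAddCircle)) :=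
      funext kroneckerPlane_eq
  rw [this]
  exact continuous_const.add (((AddCircle.continuous_mk' 1).comp (by fun_prop)).prodMk
    ((AddCircle.continuous_mk' 1).comp (by fun_prop)))

theorem isOpenMap_kroneckerPlane (ha : a ≠ 0) : IsOpenMap (kroneckerPlane a p) := by
  let A : ℝ × ℝ ≃ₜ ℝ × ℝ :=
    { toFun := fun z => (z.2 + z.1, a * z.1)
      invFun := fun z => (z.2 / a, z.1 - z.2 / a)
      left_inv := fun z => by simp [mul_div_cancel_left₀ _ ha]
      right_inv := fun z => by simp [mul_div_cancel₀ _ ha]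
      continuous_toFun := by fun_prop
      continuous_invFun := by fun_prop }
  have h1 : IsOpenMap fun x : ℝ => (x : UnitAddCircle) := QuotientAddGroup.isOpenMap_coe
  have : kroneckerPlane a p = (Homeomorph.addLeft p) ∘
      (Prod.map (fun x : ℝ => (x : UnitAddCircle)) fun x : ℝ => (x : UnitAddCircle)) ∘ A :=
    funext kroneckerPlane_eq
  rw [this]
  exact (Homeomorph.addLeft p).isOpenMap.comp ((h1.prodMap h1).comp A.isOpenMap)

/-- Two continuous lifts differ locally by a constant. -/
theorem eventually_eq_add_of_lifts (ha : a ≠ 0) {M : Type*} [TopologicalSpace M]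
    {l l' : M → ℝ × ℝ} {z : M} (hl : ContinuousAt l z) (hl' : ContinuousAt l' z)
    (h : ∀ᶠ y in 𝓝 z, kroneckerPlane a p (l y) = kroneckerPlane a p (l' y)) :
    ∀ᶠ y in 𝓝 z, l' y = l y + (l' z - l z) := by
  -- After translation the two lifts agree at `z`, so near `z` they are too close to differ by a
  -- non-zero lattice vector.
  have c1 : ContinuousAt (fun y => ((l' y).2 + (l' y).1) -
      ((l y + (l' z - l z)).2 + (l y + (l' z - l z)).1)) z := by
    have := hl.fst; have := hl.snd; have := hl'.fst; have := hl'.snd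
    simp only [Prod.fst_add, Prod.snd_add]
    fun_prop
  have c2 : ContinuousAt (fun y => a * (l' y).1 - a * (l y + (l' z - l z)).1) z := by
    have := hl.fst; have := hl'.fst
    simp only [Prod.fst_add]
    fun_prop
  have e1 := c1.abs.eventually_lt (continuousAt_const (y := (1 : ℝ))) (by simp)
  have e2 := c2.abs.eventually_lt (continuousAt_const (y := (1 : ℝ))) (by simp)
  filter_upwards [h, e1, e2] with y h1 h2 h3
  refine kroneckerPlane_injective_of_close (p := p) ha ?_ h2 h3
  have hz := h.self_of_nhds
  rw [kroneckerPlane_add h1 (l' z - l z)]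
  have h4 : kroneckerPlane a p (l' y) = kroneckerPlane a p (l' y + (l' z - l z)) := by
    have := kroneckerPlane_add hz (l' y - l z)
    rw [add_sub_cancel] at this
    rw [this]
    congr 1
    abel
  exact h4

/-- Half orbits of an irrational flow are dense. -/
theorem dense_kroneckerFlow_gt (ha : Irrational a) (q : Torus) (T : ℝ) :
    Dense {x | ∃ t > T, x = kroneckerFlow a t q} := by
  rintro ⟨x, y⟩
  obtain ⟨x₀, hx₀⟩ := QuotientAddGroup.mk_surjective (x - q.1)
  obtain ⟨N, hN⟩ := exists_nat_gt (T - x₀)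
  -- At the times `x₀ + N + n` the orbit is on the circle over `x`, where it moves by the rotation
  -- of angle `a`. The forward orbit of this rotation is dense, and the choice of `N` puts all these
  -- times beyond `T`.
  have hd : DenseRange fun n : ℕ => n • (a : UnitAddCircle) := by
    rw [← denseRange_zsmul_iff_nsmul, AddCircle.denseRange_zsmul_coe_iff]
    simpa using ha
  let b : UnitAddCircle := q.2 + ((a * (x₀ + N) : ℝ) : UnitAddCircle)
  have hc : Continuous fun r : UnitAddCircle => ((x, b + r) : Torus) := by fun_prop
  have := map_mem_closure (t := {x | ∃ t > T, x = kroneckerFlow a t q}) hc (hd (y - b)) ?_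
  · simpa using this
  · rintro _ ⟨n, rfl⟩
    refine ⟨x₀ + N + n, ?_, ?_⟩
    · have : (0 : ℝ) ≤ n := n.cast_nonneg
      linarith
    · refine Prod.ext ?_ ?_
      · have h1 : ((x₀ + N + n : ℝ) : UnitAddCircle) = (x₀ : UnitAddCircle) := by
          rw [unitAddCircle_coe_eq_iff]
          exact ⟨N + n, by push_cast; ring⟩
        simp only [kroneckerFlow, Prod.fst_add, h1]
        change x = q.1 + (QuotientAddGroup.mk x₀ : UnitAddCircle)
        rw [hx₀, add_sub_cancel]
      · simp only [kroneckerFlow, Prod.snd_add, b]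
        rw [add_assoc, add_right_inj, ← AddCircle.coe_nsmul, ← AddCircle.coe_add]
        congr 1
        rw [nsmul_eq_mul]
        ring

theorem dense_kroneckerFlow_lt (ha : Irrational a) (q : Torus) (T : ℝ) :
    Dense {x | ∃ t < T, x = kroneckerFlow a t q} := by
  rintro ⟨x, y⟩
  obtain ⟨x₀, hx₀⟩ := QuotientAddGroup.mk_surjective (x - q.1)
  obtain ⟨N, hN⟩ := exists_nat_gt (x₀ - T)
  have hd : DenseRange fun n : ℕ => n • ((-a : ℝ) : UnitAddCircle) := by
    rw [← denseRange_zsmul_iff_nsmul, AddCircle.denseRange_zsmul_coe_iff]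
    simpa using ha
  let b : UnitAddCircle := q.2 + ((a * (x₀ - N) : ℝ) : UnitAddCircle)
  have hc : Continuous fun r : UnitAddCircle => ((x, b + r) : Torus) := by fun_prop
  have := map_mem_closure (t := {x | ∃ t < T, x = kroneckerFlow a t q}) hc (hd (y - b)) ?_
  · simpa using this
  · rintro _ ⟨n, rfl⟩
    refine ⟨x₀ - N - n, ?_, ?_⟩
    · have : (0 : ℝ) ≤ n := n.cast_nonneg
      linarith
    · refine Prod.ext ?_ ?_
      · have h1 : ((x₀ - N - n : ℝ) : UnitAddCircle) = (x₀ : UnitAddCircle) := by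
          rw [unitAddCircle_coe_eq_iff]
          exact ⟨-N - n, by push_cast; ring⟩
        simp only [kroneckerFlow, Prod.fst_add, h1]
        change x = q.1 + (QuotientAddGroup.mk x₀ : UnitAddCircle)
        rw [hx₀, add_sub_cancel]
      · simp only [kroneckerFlow, Prod.snd_add, b]
        rw [add_assoc, add_right_inj, ← AddCircle.coe_nsmul, ← AddCircle.coe_add]
        congr 1
        rw [nsmul_eq_mul]
        ring

end kronecker

/-! ### Existence of Kronecker boxes -/

/-- A bounded increasing reparametrization of the line. -/
def scaledArctan (c s : ℝ) : ℝ := c * Real.arctan s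

section scaledArctan

variable {c : ℝ}

theorem scaledArctan_zero : scaledArctan c 0 = 0 := by simp [scaledArctan]

theorem isOpenEmbedding_scaledArctan (hc : c ≠ 0) : IsOpenEmbedding (scaledArctan c) := by
  have h1 : IsOpenEmbedding (Subtype.val ∘ Real.tanOrderIso.symm) :=
    isOpen_Ioo.isOpenEmbedding_subtypeVal.comp Real.tanOrderIso.symm.toHomeomorph.isOpenEmbedding
  exact (Homeomorph.mulLeft₀ c hc).isOpenEmbedding.comp h1

theorem strictMono_scaledArctan (hc : 0 < c) : StrictMono (scaledArctan c) :=
  Real.arctan_strictMono.const_mul hc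

theorem abs_scaledArctan_sub_lt (hc : 0 < c) (s t : ℝ) :
    |scaledArctan c s - scaledArctan c t| < 4 * c := by
  rw [scaledArctan, scaledArctan, ← mul_sub, abs_mul, abs_of_pos hc, mul_comm]
  refine mul_lt_mul_of_pos_right ?_ hc
  have h1 := Real.arctan_mem_Ioo s
  have h2 := Real.arctan_mem_Ioo t
  have h3 := Real.pi_lt_four
  rw [abs_lt]
  constructor <;> linarith [h1.1, h1.2, h2.1, h2.2]

end scaledArctan

/-- The box of width `c` at `p`. -/
def kroneckerBox (a : ℝ) (p : Torus) (c : ℝ) (z : ℝ × ℝ) : Torus :=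
  kroneckerPlane a p (scaledArctan c z.2, scaledArctan c z.1)

/-- Both flow coordinates vary by less than `4 c` on the box, so the lifted torus coordinates `u +
v` and `a v` vary by less than `8 c` and by at most `4 c |a|`. The assumption on `c` keeps both
variations below `1`, so the covering is injective on the box. -/
theorem isKroneckerBox_kroneckerBox {a : ℝ} (ha : a ≠ 0) (p : Torus) {c : ℝ} (hc : 0 < c)
    (hca : 8 * c * (1 + |a|) ≤ 1) : IsKroneckerBox a p (kroneckerBox a p c) := by
  have hu := isOpenEmbedding_scaledArctan hc.ne'
  refine ⟨.of_continuous_injective_isOpenMap ?_ ?_ ?_, ?_, scaledArctan c, scaledArctan c,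
    hu.continuous, strictMono_scaledArctan hc, scaledArctan_zero, hu.continuous,
    strictMono_scaledArctan hc, scaledArctan_zero, fun s t => rfl⟩
  · exact continuous_kroneckerPlane.comp
      ((hu.continuous.comp continuous_snd).prodMk (hu.continuous.comp continuous_fst))
  · intro z z' h
    have h1 := abs_lt.1 (abs_scaledArctan_sub_lt hc z.1 z'.1)
    have h2 := abs_lt.1 (abs_scaledArctan_sub_lt hc z.2 z'.2)
    have hpa := abs_nonneg a
    have he := kroneckerPlane_injective_of_close ha h (by
        simp only
        rw [abs_lt]
        constructor <;> nlinarith) (by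
        simp only
        rw [← mul_sub, abs_mul]
        nlinarith [abs_scaledArctan_sub_lt hc z.2 z'.2,
          abs_nonneg (scaledArctan c z.2 - scaledArctan c z'.2)])
    obtain ⟨e1, e2⟩ := Prod.ext_iff.1 he
    exact Prod.ext (hu.injective e2) (hu.injective e1)
  · have : kroneckerBox a p c = kroneckerPlane a p ∘ Prod.map (scaledArctan c) (scaledArctan c) ∘
        Homeomorph.prodComm ℝ ℝ := rfl
    rw [this]
    exact (isOpenMap_kroneckerPlane ha).comp ((hu.isOpenMap.prodMap hu.isOpenMap).comp
      (Homeomorph.prodComm ℝ ℝ).isOpenMap)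
  · rw [kroneckerBox, scaledArctan_zero, kroneckerPlane_zero_right, kroneckerFlow_zero]

/-! ### The charts of the Nyikosization of the torus -/

theorem exists_homeomorph_plane : Nonempty (ℝ × ℝ ≃ₜ EuclideanSpace ℝ (Fin 2)) :=
  ⟨(Homeomorph.finTwoArrow (X := ℝ)).symm.trans
    (EuclideanSpace.equiv (Fin 2) ℝ).symm.toHomeomorph⟩

theorem nonempty_chartedSpace_of_charts {M : Type*} [TopologicalSpace M]
    (h : ∀ x : M, ∃ e : OpenPartialHomeomorph M (ℝ × ℝ), x ∈ e.source) :
    Nonempty (ChartedSpace (EuclideanSpace ℝ (Fin 2)) M) := by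
  obtain ⟨g⟩ := exists_homeomorph_plane
  choose e he using h
  exact ⟨{ atlas := range fun x => (e x).trans g.toOpenPartialHomeomorph
           chartAt := fun x => (e x).trans g.toOpenPartialHomeomorph
           mem_chart_source := fun x => by simpa using he x
           chart_mem_atlas := fun x => ⟨x, rfl⟩ }⟩

/-! ### The integral points of the long ray as an obstruction to metrics -/

namespace ClosedLongRay

theorem base_injective : Function.Injective base := fun _ _ h => congrArg ord h

theorem tendsto_base {s : ℕ → CountableOrdinal} {b : CountableOrdinal} (hs : StrictMono s)
    (hb : IsLUB (range s) b) : Tendsto (fun n => base (s n)) atTop (𝓝 (base b)) := by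
  refine tendsto_order.2 ⟨fun x hx => ?_, fun x hx => Eventually.of_forall fun n => ?_⟩
  · obtain ⟨_, ⟨n, rfl⟩, hn⟩ := (lt_isLUB_iff hb).1 (lt_base_iff.1 hx)
    filter_upwards [eventually_ge_atTop n] with m hm
    exact lt_base_iff.2 (hn.trans_le (hs.monotone hm))
  · refine lt_of_le_of_lt ?_ hx
    rcases (hb.1 ⟨n, rfl⟩ : s n ≤ b).eq_or_lt with h | h
    · rw [h]
    · exact (lt_base_iff.2 h : base (s n) < base b).le

theorem not_homeomorph_metricSpace {Y : Type*} [MetricSpace Y] : IsEmpty (OpenLongRay ≃ₜ Y) := by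
  refine ⟨fun g => ?_⟩
  classical
  -- The integral points form a copy of the countable ordinals. The least one is missing from the
  -- open ray and is replaced by `1/2`; this does not affect limits, since a strictly increasing
  -- sequence leaves the least ordinal after its first term.
  let m : CountableOrdinal → OpenLongRay := fun α =>
    if h : IsMin α then ⟨point α ⟨1 / 2, by norm_num, by norm_num⟩, fun h' => by
      simpa using (isMin_iff.1 h').2⟩
    else ⟨base α, fun h' => h (isMin_iff.1 h').1⟩
  have hord : ∀ α, (m α).1.ord = α := fun α => by
    by_cases h : IsMin α <;> simp [m, h]
  refine CountableOrdinal.not_injective_of_tendsto (fun α => g (m α)) (fun s b hs hb => ?_)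
    fun α β h => by rw [← hord α, g.injective h, hord]
  refine (g.continuous.tendsto _).comp ?_
  rw [tendsto_subtype_rng]
  have hval : ∀ α, ¬ IsMin α → (m α).1 = base α := fun α h => by simp [m, h]
  have hlt : s 0 < b := (hs one_pos).trans_le (hb.1 ⟨1, rfl⟩)
  rw [hval b (not_isMin_of_lt hlt)]
  refine (tendsto_base hs hb).congr' ?_
  filter_upwards [eventually_gt_atTop 0] with n hn
  exact (hval _ (not_isMin_of_lt (hs hn))).symm

end ClosedLongRay

namespace Nyikosization

open ClosedLongRay

theorem continuous_ofRay {X : Type*} [TopologicalSpace X] {p : X} {φ : ℝ × ℝ → X}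
    {f : CountableOrdinal → ℕ → ℕ} : Continuous (ofRay : _ → Nyikosization p φ f) := by
  refine continuous_generateFrom_iff.2 ?_
  rintro _ ((⟨A, hA, rfl⟩ | ⟨ε, x, y, -, -, -, rfl⟩) | ⟨w, -, -, rfl⟩)
  exacts [isOpen_empty, isOpen_Ioo, isOpen_Iio]

theorem not_metrizableSpace {X : Type*} [TopologicalSpace X] {p : X} {φ : ℝ × ℝ → X}
    {f : CountableOrdinal → ℕ → ℕ} :
    ¬ TopologicalSpace.MetrizableSpace (Nyikosization p φ f) := by
  intro _
  let := TopologicalSpace.metrizableSpaceMetric (Nyikosization p φ f)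
  refine CountableOrdinal.not_injective_of_tendsto
    (fun α => (ofRay (base α) : Nyikosization p φ f)) (fun s b hs hb =>
      (continuous_ofRay.tendsto _).comp (tendsto_base hs hb)) fun α β h =>
        base_injective (ofRay_injective h)

/-! ### Lift charts, ray charts and the foliation they generate -/

variable {a : ℝ} {p : Torus} {c : ℝ} {f : CountableOrdinal → ℕ → ℕ}

/-- The Nyikosization of the torus in a Kronecker box. -/
abbrev KroneckerNyikos (a : ℝ) (p : Torus) (c : ℝ) (f : CountableOrdinal → ℕ → ℕ) : Type :=
  Nyikosization p (kroneckerBox a p c) f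

/-- A chart that is inverse to the covering of the torus by the plane. -/
def IsLiftChart (e : OpenPartialHomeomorph (KroneckerNyikos a p c f) (ℝ × ℝ)) : Prop :=
  ∀ z ∈ e.source, (∃ q, z = ofPoint q) ∧ kroneckerPlane a p (e z) = collapse z

/-- A chart near the long ray whose transverse coordinate is the one of the box. -/
def IsRayChart (e : OpenPartialHomeomorph (KroneckerNyikos a p c f) (ℝ × ℝ)) : Prop :=
  e.source ⊆ rayRegion ∧ ∀ z ∈ e.source, (e z).2 = scaledArctan c (box z).1

/-- The generating atlas. -/
def baseAtlas (a : ℝ) (p : Torus) (c : ℝ) (f : CountableOrdinal → ℕ → ℕ) :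
    Set (OpenPartialHomeomorph (KroneckerNyikos a p c f) (ℝ × ℝ)) :=
  {e | IsLiftChart e ∨ IsRayChart e}

variable (hbox : IsKroneckerBox a p (kroneckerBox a p c)) (hf : IsNyikosSequence f) (ha : a ≠ 0)

include hbox hf

/-- Off the ray both kinds of charts have the transverse coordinate of a local lift to the plane: a
lift chart is itself the lift, and for a ray chart the rescaled box coordinates are one. -/
theorem exists_lift (hc : c ≠ 0) {e : OpenPartialHomeomorph (KroneckerNyikos a p c f) (ℝ × ℝ)}
    (he : e ∈ baseAtlas a p c f) {q : {x : Torus // x ≠ p}} (hz : ofPoint q ∈ e.source) :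
    ∃ l : KroneckerNyikos a p c f → ℝ × ℝ, ContinuousAt l (ofPoint q) ∧
      ∀ᶠ y in 𝓝 (ofPoint q), kroneckerPlane a p (l y) = collapse y ∧ (e y).2 = (l y).2 := by
  have hN := e.open_source.mem_nhds hz
  rcases he with he | he
  · refine ⟨e, e.continuousAt hz, ?_⟩
    filter_upwards [hN] with y hy
    exact ⟨(he y hy).2, rfl⟩
  · have hb : ContinuousAt (box : KroneckerNyikos a p c f → ℝ × ℝ) (ofPoint q) :=
      continuousAt_box hbox.isOpenEmbedding hbox.map_zero hf (he.1 hz)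
    have hu := (isOpenEmbedding_scaledArctan hc).continuous
    refine ⟨fun y => (scaledArctan c (box y).2, scaledArctan c (box y).1),
      (hu.continuousAt.comp hb.snd).prodMk (hu.continuousAt.comp hb.fst), ?_⟩
    have hq := (isOpenEmbedding_ofPoint (p := p) hbox.isOpenEmbedding hf).isOpen_range.mem_nhds
      ⟨q, rfl⟩
    filter_upwards [hN, hq] with y hy hyq
    refine ⟨?_, he.2 y hy⟩
    obtain ⟨q', rfl⟩ := hyq
    obtain ⟨w, -, hw⟩ := he.1 hy
    rw [box_ofPoint hbox.isOpenEmbedding.injective hw]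
    exact hw

include ha in
-- Off the ray two lifts differ locally by a constant, so the transverse change is a translation.
-- Points of the ray lie in ray charts only, and those share the same transverse coordinate.
theorem baseAtlas_compatible (hc : c ≠ 0) {e e' : OpenPartialHomeomorph (KroneckerNyikos a p c f) (ℝ × ℝ)}
    (he : e ∈ baseAtlas a p c f) (he' : e' ∈ baseAtlas a p c f) : FoliatedCompatible e e' := by
  refine .of_locally_add fun z hz hz' => ?_
  rcases eq_ofPoint_or_ofRay z with ⟨q, rfl⟩ | ⟨x, rfl⟩
  · obtain ⟨l, hl, hl1⟩ := exists_lift hbox hf hc he hz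
    obtain ⟨l', hl', hl1'⟩ := exists_lift hbox hf hc he' hz'
    have := eventually_eq_add_of_lifts (p := p) ha hl hl' (by
      filter_upwards [hl1, hl1'] with y h1 h2
      rw [h1.1, h2.1])
    refine ⟨(l' (ofPoint q) - l (ofPoint q)).2, ?_⟩
    filter_upwards [hl1, hl1', this] with y h1 h2 h3
    rw [h1.2, h2.2, h3, Prod.snd_add]
  · have key : ∀ d : OpenPartialHomeomorph (KroneckerNyikos a p c f) (ℝ × ℝ),
        d ∈ baseAtlas a p c f → ofRay x ∈ d.source → IsRayChart d := by
      rintro d (hd | hd) hx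
      · obtain ⟨⟨q, hq⟩, -⟩ := hd _ hx
        exact absurd hq.symm ofPoint_ne_ofRay
      · exact hd
    refine ⟨0, ?_⟩
    filter_upwards [e.open_source.mem_nhds hz, e'.open_source.mem_nhds hz'] with y h1 h2
    rw [(key e he hz).2 y h1, (key e' he' hz').2 y h2, add_zero]

include ha in
theorem exists_liftChart {z₀ : ℝ × ℝ} (hz₀ : kroneckerPlane a p z₀ ≠ p) :
    ∃ (e : OpenPartialHomeomorph (KroneckerNyikos a p c f) (ℝ × ℝ)) (Ω : Set (ℝ × ℝ)),
      IsLiftChart e ∧ IsOpen Ω ∧ z₀ ∈ Ω ∧ ∀ z ∈ Ω, ∀ h : kroneckerPlane a p z ≠ p,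
        ofPoint ⟨_, h⟩ ∈ e.source ∧ e (ofPoint ⟨_, h⟩) = z := by
  -- The radius `1/2` in both torus coordinates keeps differences within `Ω` below `1`, so the
  -- covering is injective on `Ω`.
  let Ω : Set (ℝ × ℝ) := {z | |(z.2 + z.1) - (z₀.2 + z₀.1)| < 1 / 2 ∧
    |a * z.1 - a * z₀.1| < 1 / 2}
  have c1 : Continuous fun z : ℝ × ℝ => |(z.2 + z.1) - (z₀.2 + z₀.1)| := by fun_prop
  have c2 : Continuous fun z : ℝ × ℝ => |a * z.1 - a * z₀.1| := by fun_prop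
  have hΩ : IsOpen Ω := (isOpen_lt c1 continuous_const).inter (isOpen_lt c2 continuous_const)
  have hinj : InjOn (kroneckerPlane a p) Ω := by
    intro z hz z' hz' h
    have h1 := abs_lt.1 hz.1
    have h2 := abs_lt.1 hz.2
    have h3 := abs_lt.1 hz'.1
    have h4 := abs_lt.1 hz'.2
    refine kroneckerPlane_injective_of_close ha h ?_ ?_ <;> rw [abs_lt] <;> constructor <;> linarith
  let t : OpenPartialHomeomorph (ℝ × ℝ) Torus := OpenPartialHomeomorph.ofContinuousOpen
    (hinj.toPartialEquiv _ _) continuous_kroneckerPlane.continuousOn (isOpenMap_kroneckerPlane ha) hΩ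
  have : Nonempty {x : Torus // x ≠ p} := ⟨⟨_, hz₀⟩⟩
  have hemb := isOpenEmbedding_ofPoint (p := p) hbox.isOpenEmbedding hf
  let g : OpenPartialHomeomorph (KroneckerNyikos a p c f) {x : Torus // x ≠ p} :=
    (hemb.toOpenPartialHomeomorph _).symm
  have hval : IsOpenEmbedding (Subtype.val : {x : Torus // x ≠ p} → Torus) :=
    isOpen_ne.isOpenEmbedding_subtypeVal
  let e := (g.trans (hval.toOpenPartialHomeomorph _)).trans t.symm
  have hg : ∀ q, g (ofPoint q) = q := fun q => hemb.toOpenPartialHomeomorph_left_inv _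
  have hsrc : ∀ z, z ∈ e.source ↔ ∃ q : {x : Torus // x ≠ p}, z = ofPoint q ∧ (q : Torus) ∈ t.target := by
    intro z
    have h1 : z ∈ e.source ↔ z ∈ range (ofPoint : _ → KroneckerNyikos a p c f) ∧
        ((g z : Torus) ∈ t.target) := by
      simp [e, g]
    rw [h1]
    constructor
    · rintro ⟨⟨q, rfl⟩, hq⟩
      rw [hg] at hq
      exact ⟨q, rfl, hq⟩
    · rintro ⟨q, rfl, hq⟩
      exact ⟨⟨q, rfl⟩, by rwa [hg]⟩
  have hval : ∀ q, e (ofPoint q) = t.symm q := fun q => by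
    change t.symm (g (ofPoint q) : Torus) = _
    rw [hg]
  refine ⟨e, Ω, ?_, hΩ, by simp [Ω], ?_⟩
  · intro z hz
    obtain ⟨q, rfl, hq⟩ := (hsrc z).1 hz
    refine ⟨⟨q, rfl⟩, ?_⟩
    rw [hval]
    exact t.right_inv hq
  · intro z hz h
    refine ⟨(hsrc _).2 ⟨_, rfl, t.map_source hz⟩, ?_⟩
    rw [hval]
    exact t.left_inv hz

omit hbox hf in
theorem exists_rayChart_kronecker (hbox : IsKroneckerBox a p (kroneckerBox a p c))
    (hf : IsNyikosSequence f) (hc : 0 < c) {w : CountableOrdinal → ℝ}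
    (hw : Summable w) (hw0 : ∀ β, 0 ≤ w β) {α : CountableOrdinal} (hpos : ∀ β < α, 0 < w β) :
    ∃ e : OpenPartialHomeomorph (KroneckerNyikos a p c f) (ℝ × ℝ), IsRayChart e ∧
      e.source = rayDomain α ∧
      ∀ z, e z = (height w (scaledArctan c) z, scaledArctan c (box z).1) := by
  have hu := isOpenEmbedding_scaledArctan hc.ne'
  obtain ⟨e, h1, h2⟩ := exists_rayChart (p := p) hbox.isOpenEmbedding hbox.map_zero hf hw hw0
    hu.continuous (strictMono_scaledArctan hc) scaledArctan_zero hpos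
  -- Rescaling the abscissa turns it into the transverse coordinate of the covering plane, so that
  -- it matches the lift charts.
  let d := e.trans ((OpenPartialHomeomorph.refl ℝ).prod (hu.toOpenPartialHomeomorph _))
  have hd : d.source = rayDomain α := by simp [d, h1]
  have hdz : ∀ z, d z = (height w (scaledArctan c) z, scaledArctan c (box z).1) := by
    intro z
    simp [d, h2, rayMap]
  exact ⟨d, ⟨hd.trans_subset (rayDomain_subset α), fun z _ => by rw [hdz]⟩, hd, hdz⟩

include ha in
theorem baseAtlas_cover (hc : 0 < c) (z : KroneckerNyikos a p c f) :
    ∃ e ∈ baseAtlas a p c f, z ∈ e.source := by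
  rcases eq_ofPoint_or_ofRay z with ⟨⟨q, hq⟩, rfl⟩ | ⟨x, rfl⟩
  · obtain ⟨z₀, rfl⟩ := kroneckerPlane_surjective (p := p) ha q
    obtain ⟨e, Ω, he, -, h1, h2⟩ := exists_liftChart hbox hf ha hq
    exact ⟨e, Or.inl he, (h2 z₀ h1 hq).1⟩
  · obtain ⟨α, hα⟩ := exists_gt x.ord
    obtain ⟨w, hw, hw0, hpos⟩ := CountableOrdinal.exists_weights α
    obtain ⟨e, he, h1, -⟩ := exists_rayChart_kronecker hbox hf hc hw hw0 hpos
    exact ⟨e, Or.inr he, h1 ▸ lt_base_iff.2 hα⟩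

/-- The foliation of the Nyikosization of the torus. -/
def kroneckerFoliation (hbox : IsKroneckerBox a p (kroneckerBox a p c)) (hf : IsNyikosSequence f)
    (ha : a ≠ 0) (hc : 0 < c) : Foliation (KroneckerNyikos a p c f) :=
  Foliation.generate (baseAtlas a p c f) (baseAtlas_cover hbox hf ha hc)
    fun _ he _ he' => baseAtlas_compatible hbox hf ha hc.ne' he he'

theorem baseAtlas_subset (hc : 0 < c) :
    baseAtlas a p c f ⊆ (kroneckerFoliation hbox hf ha hc).atlas :=
  Foliation.subset_atlas_generate _ _ _

/-! ### Density -/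

/-- Every open set meets the punctured torus, because each point of the ray is a limit along its own
curve; there the density of `A` applies. -/
theorem dense_union {A : Set Torus} (hA : Dense A) :
    Dense (union A ∅ : Set (KroneckerNyikos a p c f)) := by
  have hemb := isOpenEmbedding_ofPoint (p := p) hbox.isOpenEmbedding hf
  have hval : IsOpenEmbedding (Subtype.val : {x : Torus // x ≠ p} → Torus) :=
    isOpen_ne.isOpenEmbedding_subtypeVal
  rw [dense_iff_inter_open]
  rintro O hO ⟨z, hz⟩
  have hne : ∃ q, (ofPoint q : KroneckerNyikos a p c f) ∈ O := by
    rcases eq_ofPoint_or_ofRay z with ⟨q, rfl⟩ | ⟨x, rfl⟩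
    · exact ⟨q, hz⟩
    · have h1 : ContinuousAt (raySection x : ℝ → KroneckerNyikos a p c f) 0 :=
        continuousAt_raySection hbox.isOpenEmbedding hbox.map_zero hf x
      have h2 : O ∈ 𝓝 (raySection x 0 : KroneckerNyikos a p c f) := by
        rw [raySection_zero]
        exact hO.mem_nhds hz
      obtain ⟨s, hs, hs0⟩ := (((h1.eventually h2).filter_mono nhdsWithin_le_nhds).and
        (self_mem_nhdsWithin (s := {0}ᶜ))).exists
      rw [raySection_of_ne hbox.isOpenEmbedding.injective hbox.map_zero x hs0] at hs
      exact ⟨_, hs⟩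
  obtain ⟨q, hq⟩ := hne
  obtain ⟨_, ⟨⟨q', hq', rfl⟩, hqA⟩⟩ := hA.inter_open_nonempty _
    (hval.isOpenMap _ (hO.preimage hemb.continuous)) ⟨q, q, hq, rfl⟩
  exact ⟨ofPoint q', hq', hqA⟩

/-! ### Parametrizations of leaves in the torus -/

variable {L : Type*} [TopologicalSpace L]

include ha in
-- A lift chart inverts the covering, so it turns a piece of orbit into a horizontal segment with
-- coordinate `κ`. Allowing a partial `κ` on any space makes this usable for the short leaves and
-- for the tail of the long leaf.
theorem exists_chart_of_flow (hc : 0 < c) {γ : L → KroneckerNyikos a p c f} {κ : OpenPartialHomeomorph L ℝ}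
    {u : ℝ} (hne : ∀ y ∈ κ.source, kroneckerPlane a p (κ y, u) ≠ p)
    (hγ : ∀ y (hy : y ∈ κ.source), γ y = ofPoint ⟨_, hne y hy⟩) {x : L} (hx : x ∈ κ.source) :
    ∃ b ∈ (kroneckerFoliation hbox hf ha hc).atlas, ∃ (k : OpenPartialHomeomorph L ℝ) (d : ℝ),
      x ∈ k.source ∧ ∀ y ∈ k.source, γ y ∈ b.source ∧ b (γ y) = (k y, d) := by
  obtain ⟨e, Ω, he, hΩ, h1, h2⟩ := exists_liftChart hbox hf ha (hne x hx)
  have hopen : IsOpen (κ.source ∩ κ ⁻¹' {r | (r, u) ∈ Ω}) :=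
    κ.isOpen_inter_preimage (hΩ.preimage (by fun_prop))
  refine ⟨e, baseAtlas_subset hbox hf ha hc (Or.inl he), κ.restrOpen _ hopen, u, ⟨hx, hx, h1⟩, ?_⟩
  rintro y ⟨hy, -, hy'⟩
  rw [hγ y hy]
  exact h2 _ hy' _

include ha in
theorem isLeafParam_flow (hirr : Irrational a) (hc : 0 < c) {κ : ℝ → ℝ} (hκ : IsOpenEmbedding κ) {u : ℝ}
    (hne : ∀ y, kroneckerPlane a p (κ y, u) ≠ p) :
    (kroneckerFoliation hbox hf ha hc).IsLeafParam fun y => ofPoint ⟨_, hne y⟩ where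
  injective _ _ h := hκ.injective (kroneckerPlane_left_injective hirr
    (congrArg Subtype.val (ofPoint_injective h)))
  exists_chart x := exists_chart_of_flow hbox hf ha hc (κ := hκ.toOpenPartialHomeomorph _)
    (fun y _ => hne y) (fun _ _ => rfl) (mem_univ x)

end Nyikosization

/-! ### Charts of the open long ray -/

/-- An order isomorphism is a homeomorphism of order topologies, and on order-connected sets these
are the subspace topologies. -/
theorem StrictMonoOn.exists_openPartialHomeomorph {L : Type*} [LinearOrder L] [TopologicalSpace L]
    [OrderTopology L] [Nonempty L] {g : L → ℝ} {s : Set L} (hg : StrictMonoOn g s)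
    (hs : IsOpen s) (hsc : s.OrdConnected) (hi : IsOpen (g '' s)) (hic : (g '' s).OrdConnected) :
    ∃ k : OpenPartialHomeomorph L ℝ, k.source = s ∧ k.target = g '' s ∧ ∀ y, k y = g y := by
  let G := (StrictMonoOn.orderIso g s hg).toHomeomorph
  have hG : s.domRestrict g = Subtype.val ∘ G := rfl
  have hcont : ContinuousOn g s := by
    rw [continuousOn_iff_continuous_domRestrict, hG]
    exact continuous_subtype_val.comp G.continuous
  refine ⟨OpenPartialHomeomorph.ofContinuousOpenRestrict (hg.injOn.toPartialEquiv g s) hcont ?_ hs,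
    rfl, rfl, fun _ => rfl⟩
  change IsOpenMap (s.domRestrict g)
  rw [hG]
  exact hi.isOpenEmbedding_subtypeVal.isOpenMap.comp G.isOpenMap

instance : OrderTopology OpenLongRay :=
  @orderTopology_of_ordConnected _ _ _ _ {x : ClosedLongRay | ¬ IsMin x}
    ⟨fun _ hx _ _ _ hz h => hx (h.mono hz.1)⟩

/-! ### The open long ray as a half line followed by a closed long ray -/

namespace ClosedLongRay

/-- The first half of the first unit interval. -/
def IsTail (x : ClosedLongRay) : Prop := IsMin x.ord ∧ x.frac < 1 / 2

/-- The map that stretches the second half of the first unit interval to the whole interval. -/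
def stretch (x : ClosedLongRay) : ClosedLongRay :=
  open Classical in
  if IsMin x.ord then point x.ord ⟨max 0 (2 * x.frac - 1), le_max_left _ _,
    max_lt one_pos (by linarith [frac_lt_one x])⟩ else x

/-- The coordinate of the long ray that sends the first half of the first unit interval to the
negative half line. -/
def longHeight (w : CountableOrdinal → ℝ) (x : ClosedLongRay) : ℝ :=
  open Classical in
  if IsTail x then 2 - 1 / x.frac else rayHeight w (stretch x)

theorem ord_stretch (x : ClosedLongRay) : (stretch x).ord = x.ord := by
  unfold stretch
  split_ifs <;> rfl

theorem frac_stretch_of_isMin {x : ClosedLongRay} (h : IsMin x.ord) :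
    (stretch x).frac = max 0 (2 * x.frac - 1) := by
  simp [stretch, h]

theorem stretch_of_not_isMin {x : ClosedLongRay} (h : ¬ IsMin x.ord) : stretch x = x := by
  simp [stretch, h]

theorem stretch_lt_base_iff {x : ClosedLongRay} {α : CountableOrdinal} :
    stretch x < base α ↔ x < base α := by
  rw [lt_base_iff, lt_base_iff, ord_stretch]

theorem IsTail.of_le {x y : ClosedLongRay} (h : IsTail y) (hxy : x ≤ y) : IsTail x := by
  have ho : x.ord = y.ord := le_antisymm (ord_mono hxy) (h.1 (ord_mono hxy))
  refine ⟨ho ▸ h.1, lt_of_le_of_lt ?_ h.2⟩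
  rcases hxy.eq_or_lt with rfl | hlt
  · exact le_rfl
  · rcases ClosedLongRay.lt_iff.1 hlt with h' | h'
    exacts [absurd ho h'.ne, h'.2.le]

theorem IsTail.frac_pos {x : ClosedLongRay} (h : IsTail x) (hx : ¬ IsMin x) : 0 < x.frac :=
  lt_of_le_of_ne (frac_nonneg x) fun h' => hx (isMin_iff.2 ⟨h.1, h'.symm⟩)

theorem half_le_frac {x : ClosedLongRay} (h : ¬ IsTail x) (hx : IsMin x.ord) : 1 / 2 ≤ x.frac :=
  not_lt.1 fun h' => h ⟨hx, h'⟩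

theorem stretch_lt_stretch {x y : ClosedLongRay} (hx : ¬ IsTail x) (hxy : x < y) :
    stretch x < stretch y := by
  have hy : ¬ IsTail y := fun h => hx (h.of_le hxy.le)
  by_cases hmx : IsMin x.ord
  · have h1 := half_le_frac hx hmx
    rcases ClosedLongRay.lt_iff.1 hxy with h | h
    · exact ClosedLongRay.lt_iff.2 (Or.inl (by rwa [ord_stretch, ord_stretch]))
    · have hmy : IsMin y.ord := h.1 ▸ hmx
      refine ClosedLongRay.lt_iff.2 (Or.inr ⟨by rw [ord_stretch, ord_stretch, h.1], ?_⟩)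
      rw [frac_stretch_of_isMin hmx, frac_stretch_of_isMin hmy,
        max_eq_right (by linarith), max_eq_right (by linarith [h.2])]
      linarith [h.2]
  · have hmy : ¬ IsMin y.ord := fun h => hmx (h.mono (ord_mono hxy.le))
    rwa [stretch_of_not_isMin hmx, stretch_of_not_isMin hmy]

theorem exists_stretch_eq (x : ClosedLongRay) : ∃ y, ¬ IsMin y ∧ ¬ IsTail y ∧ stretch y = x := by
  by_cases h : IsMin x.ord
  · have h0 := frac_nonneg x
    have h1 := frac_lt_one x
    have hm : ((1 + x.frac) / 2) ∈ Ico (0 : ℝ) 1 := ⟨by linarith, by linarith⟩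
    refine ⟨point x.ord ⟨_, hm⟩, fun h' => ?_, fun h' => ?_, ?_⟩
    · have := (isMin_iff.1 h').2
      rw [frac_point] at this
      simp only at this
      linarith
    · have := h'.2
      rw [frac_point] at this
      simp only at this
      linarith
    · refine eq_of_ord_frac (ord_stretch _) ?_
      rw [frac_stretch_of_isMin (by exact h), frac_point, max_eq_right] <;> simp only <;> linarith
  · exact ⟨x, fun h' => h (isMin_iff.1 h').1, fun h' => h h'.1, stretch_of_not_isMin h⟩

variable {w : CountableOrdinal → ℝ}

theorem longHeight_of_isTail {x : ClosedLongRay} (h : IsTail x) :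
    longHeight w x = 2 - 1 / x.frac := by simp [longHeight, h]

theorem longHeight_of_not_isTail {x : ClosedLongRay} (h : ¬ IsTail x) :
    longHeight w x = rayHeight w (stretch x) := by simp [longHeight, h]

theorem longHeight_neg {x : ClosedLongRay} (h : IsTail x) (hx : ¬ IsMin x) :
    longHeight w x < 0 := by
  rw [longHeight_of_isTail h, sub_neg, lt_div_iff₀ (h.frac_pos hx)]
  linarith [h.2]

theorem exists_isTail_longHeight_eq {α : CountableOrdinal} (hα : ¬ IsMin α) {y : ℝ} (hy : y < 0) :
    ∃ x, ¬ IsMin x ∧ IsTail x ∧ x < base α ∧ ∀ w, longHeight w x = y := by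
  obtain ⟨m, hm⟩ := CountableOrdinal.exists_isMin
  have h2 : 0 < 2 - y := by linarith
  have h3 : 1 / (2 - y) < 1 / 2 := one_div_lt_one_div_of_lt two_pos (by linarith)
  -- Solution of `2 - 1 / r = y`; negativity of `y` puts it below `1/2`.
  have ht : IsTail (point m ⟨1 / (2 - y), by positivity, by linarith⟩) := ⟨hm, h3⟩
  refine ⟨_, fun h => ?_, ht, lt_base_iff.2 ?_, fun w => ?_⟩
  · exact (one_div_pos.2 h2).ne' (isMin_iff.1 h).2
  · rcases lt_or_ge m α with h | h
    exacts [h, absurd (hm.mono h) hα]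
  · rw [longHeight_of_isTail ht, frac_point, one_div_one_div]
    ring

variable (hw : Summable w) (hw0 : ∀ β, 0 ≤ w β)

include hw0 in
theorem isTail_of_longHeight_neg {x : ClosedLongRay} (h : longHeight w x < 0) : IsTail x := by
  by_contra hx
  rw [longHeight_of_not_isTail hx] at h
  exact h.not_ge (rayHeight_nonneg hw0 _)

include hw hw0

theorem strictMonoOn_longHeight {α : CountableOrdinal} (hpos : ∀ β < α, 0 < w β) :
    StrictMonoOn (longHeight w) {x | ¬ IsMin x ∧ x < base α} := by
  rintro x ⟨hx, hxα⟩ y ⟨hy, hyα⟩ hxy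
  by_cases ty : IsTail y
  · have tx := ty.of_le hxy.le
    rw [longHeight_of_isTail tx, longHeight_of_isTail ty]
    have hfr : x.frac < y.frac := by
      rcases ClosedLongRay.lt_iff.1 hxy with h | h
      exacts [absurd (ty.1 h.le) h.not_ge, h.2]
    linarith [one_div_lt_one_div_of_lt (tx.frac_pos hx) hfr]
  by_cases tx : IsTail x
  · refine (longHeight_neg tx hx).trans_le ?_
    rw [longHeight_of_not_isTail ty]
    exact rayHeight_nonneg hw0 _
  · rw [longHeight_of_not_isTail tx, longHeight_of_not_isTail ty]
    exact strictMonoOn_rayHeight hw hw0 hpos (stretch_lt_base_iff.2 hxα).le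
      (stretch_lt_base_iff.2 hyα).le (stretch_lt_stretch tx hxy)

/-- The initial segments of the open long ray are real lines. -/
theorem exists_longChart {α : CountableOrdinal} (hα : ¬ IsMin α) (hpos : ∀ β < α, 0 < w β) :
    ∃ k : OpenPartialHomeomorph OpenLongRay ℝ, k.source = {x | x.1 < base α} ∧
      k.target = Iio (rayHeight w (base α)) ∧ ∀ y, k y = longHeight w y.1 := by
  have hmono : StrictMonoOn (fun y : OpenLongRay => longHeight w y.1) {x | x.1 < base α} :=
    fun x hx y hy hxy => strictMonoOn_longHeight hw hw0 hpos ⟨x.2, hx⟩ ⟨y.2, hy⟩ hxy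
  have himage : (fun y : OpenLongRay => longHeight w y.1) '' {x | x.1 < base α} =
      Iio (rayHeight w (base α)) := by
    ext r
    constructor
    · rintro ⟨y, hy, rfl⟩
      by_cases ty : IsTail y.1
      · exact (longHeight_neg ty y.2).trans_le (rayHeight_nonneg hw0 _)
      · simp only [longHeight_of_not_isTail ty]
        exact strictMonoOn_rayHeight hw hw0 hpos (stretch_lt_base_iff.2 hy).le (le_refl (base α))
          (stretch_lt_base_iff.2 hy)
    · intro hr
      rcases lt_or_ge r 0 with h | h
      · obtain ⟨x, h1, -, h2, h3⟩ := exists_isTail_longHeight_eq hα h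
        exact ⟨⟨x, h1⟩, h2, h3 w⟩
      · obtain ⟨x, h1, rfl⟩ := exists_rayHeight_eq hw hw0 hpos h hr
        obtain ⟨y, h2, h3, rfl⟩ := exists_stretch_eq x
        exact ⟨⟨y, h2⟩, stretch_lt_base_iff.1 h1, longHeight_of_not_isTail h3⟩
  have : Nonempty OpenLongRay := ⟨⟨base α, fun h => hα (isMin_iff.1 h).1⟩⟩
  obtain ⟨k, h1, h2, h3⟩ := hmono.exists_openPartialHomeomorph
    (isOpen_Iio.preimage continuous_subtype_val) ⟨fun _ _ y (hy : y.1 < base α) z hz =>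
      (show z.1 < base α from lt_of_le_of_lt hz.2 hy)⟩
    (himage ▸ isOpen_Iio) (himage ▸ ordConnected_Iio)
  exact ⟨k, h1, h2.trans himage, h3⟩

omit hw hw0

theorem exists_not_isMin_gt (β : CountableOrdinal) : ∃ α, β < α ∧ ¬ IsMin α :=
  (exists_gt β).imp fun _ h => ⟨h, not_isMin_of_lt h⟩

instance : PathConnectedSpace OpenLongRay where
  nonempty := by
    obtain ⟨α, -, hα⟩ := exists_not_isMin_gt (Classical.arbitrary _)
    exact ⟨⟨base α, fun h => hα (isMin_iff.1 h).1⟩⟩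
  joined x y := by
    obtain ⟨α, h1, hα⟩ := exists_not_isMin_gt (max x.1.ord y.1.ord)
    obtain ⟨w, hw, hw0, hpos⟩ := CountableOrdinal.exists_weights α
    obtain ⟨k, k1, k2, -⟩ := exists_longChart hw hw0 hα hpos
    have hp : IsPathConnected k.source := by
      rw [← k.symm_image_target_eq_source]
      refine IsPathConnected.image' ?_ k.continuousOn_symm
      rw [k2]
      exact (convex_Iio _).isPathConnected nonempty_Iio
    refine (hp.joinedIn x ?_ y ?_).joined <;> rw [k1] <;> refine lt_base_iff.2 ?_
    exacts [(le_max_left _ _).trans_lt h1, (le_max_right _ _).trans_lt h1]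

end ClosedLongRay

/-! ### The parametrization of the long leaf -/

namespace Nyikosization

open ClosedLongRay

variable {a : ℝ} {p : Torus} {c : ℝ} {f : CountableOrdinal → ℕ → ℕ}

open Classical in
/-- The parametrization of the long leaf by the open long ray. -/
def longLeaf (a : ℝ) (p : Torus) (c : ℝ) (f : CountableOrdinal → ℕ → ℕ) (x : OpenLongRay) :
    KroneckerNyikos a p c f :=
  if h : IsTail x.1 ∧ kroneckerFlow a (2 - 1 / x.1.frac) p ≠ p then ofPoint ⟨_, h.2⟩
  else ofRay (stretch x.1)

theorem kroneckerFlow_ne (hirr : Irrational a) {t : ℝ} (ht : t ≠ 0) : kroneckerFlow a t p ≠ p :=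
  fun h => ht (kroneckerFlow_injective hirr p (h.trans (kroneckerFlow_zero p).symm))

/-- On the tail `longHeight` does not depend on the weights, so any `w` may be inserted: those of a
chart, or `0`. -/
theorem longLeaf_of_isTail (hirr : Irrational a) {x : OpenLongRay} (hx : IsTail x.1)
    (w : CountableOrdinal → ℝ) : longLeaf a p c f x = ofPoint ⟨kroneckerFlow a (longHeight w x.1) p,
      kroneckerFlow_ne hirr (longHeight_neg hx x.2).ne⟩ := by
  have h1 := longHeight_of_isTail (w := w) hx
  have h2 : kroneckerFlow a (2 - 1 / x.1.frac) p ≠ p :=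
    kroneckerFlow_ne hirr (h1 ▸ (longHeight_neg hx x.2).ne)
  simp only [longLeaf, hx, h2, ne_eq, not_false_eq_true, and_self, dite_true, h1]

theorem longLeaf_of_not_isTail {x : OpenLongRay} (hx : ¬ IsTail x.1) :
    longLeaf a p c f x = ofRay (stretch x.1) := by simp [longLeaf, hx]

theorem longLeaf_injective (hirr : Irrational a) :
    Function.Injective (longLeaf a p c f) := by
  have key : ∀ x y : OpenLongRay, IsTail x.1 → ¬ IsTail y.1 →
      longLeaf a p c f x ≠ longLeaf a p c f y := fun x y hx hy => by
    rw [longLeaf_of_isTail hirr hx 0, longLeaf_of_not_isTail hy]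
    exact ofPoint_ne_ofRay
  intro x y h
  by_cases hx : IsTail x.1 <;> by_cases hy : IsTail y.1
  · rw [longLeaf_of_isTail hirr hx 0, longLeaf_of_isTail hirr hy 0] at h
    have h1 := kroneckerFlow_injective hirr p (congrArg Subtype.val (ofPoint_injective h))
    rw [longHeight_of_isTail hx, longHeight_of_isTail hy, sub_right_inj, one_div, one_div,
      inv_inj] at h1
    exact Subtype.ext (eq_of_ord_frac (CountableOrdinal.eq_of_isMin hx.1 hy.1) h1)
  · exact absurd h (key x y hx hy)
  · exact absurd h.symm (key y x hy hx)
  · rw [longLeaf_of_not_isTail hx, longLeaf_of_not_isTail hy] at h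
    have h1 := ofRay_injective h
    rcases lt_trichotomy x.1 y.1 with h2 | h2 | h2
    · exact absurd h1 (stretch_lt_stretch hx h2).ne
    · exact Subtype.ext h2
    · exact absurd h1 (stretch_lt_stretch hy h2).ne'

theorem range_longLeaf (hirr : Irrational a) : range (longLeaf a p c f) =
    union {x | ∃ t < 0, x = kroneckerFlow a t p} univ := by
  obtain ⟨α, -, hα⟩ := exists_not_isMin_gt (Classical.arbitrary _)
  ext z
  constructor
  · rintro ⟨x, rfl⟩
    by_cases hx : IsTail x.1
    · rw [longLeaf_of_isTail hirr hx 0]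
      exact ⟨_, longHeight_neg hx x.2, rfl⟩
    · rw [longLeaf_of_not_isTail hx]
      exact mem_univ (stretch x.1)
  · intro hz
    rcases eq_ofPoint_or_ofRay z with ⟨⟨q, hq⟩, rfl⟩ | ⟨x, rfl⟩
    · obtain ⟨t, ht, rfl⟩ := hz
      obtain ⟨x, h1, h2, -, h3⟩ := exists_isTail_longHeight_eq hα ht
      refine ⟨⟨x, h1⟩, ?_⟩
      rw [longLeaf_of_isTail hirr h2 0]
      simp only [h3]
    · obtain ⟨y, h1, h2, rfl⟩ := exists_stretch_eq x
      exact ⟨⟨y, h1⟩, longLeaf_of_not_isTail h2⟩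

/-- At tail points the leaf is a piece of orbit with parameter `longHeight`, read in a lift chart.
At the other points a ray chart is used, with the same weights as the chart of the open long ray, so
that the two leafwise coordinates coincide. -/
theorem isLeafParam_longLeaf (hbox : IsKroneckerBox a p (kroneckerBox a p c))
    (hf : IsNyikosSequence f) (ha : a ≠ 0) (hirr : Irrational a) (hc : 0 < c) :
    (kroneckerFoliation hbox hf ha hc).IsLeafParam (longLeaf a p c f) where
  injective := longLeaf_injective hirr
  exists_chart x := by
    obtain ⟨α, hxα, hα⟩ := exists_not_isMin_gt x.1.ord
    obtain ⟨w, hw, hw0, hpos⟩ := CountableOrdinal.exists_weights α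
    obtain ⟨k, k1, k2, k3⟩ := exists_longChart hw hw0 hα hpos
    have hxk : x ∈ k.source := by rw [k1]; exact lt_base_iff.2 hxα
    by_cases tx : IsTail x.1
    · have hopen : IsOpen (k.source ∩ k ⁻¹' Iio 0) := k.isOpen_inter_preimage isOpen_Iio
      have tail : ∀ y ∈ (k.restrOpen _ hopen).source, IsTail y.1 := by
        rintro y ⟨-, -, hy⟩
        rw [mem_preimage, k3] at hy
        exact isTail_of_longHeight_neg hw0 hy
      have hval : ∀ y, kroneckerPlane a p (k.restrOpen _ hopen y, 0) =
          kroneckerFlow a (longHeight w y.1) p := fun y => by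
        rw [kroneckerPlane_zero_right]
        exact congrArg (fun r => kroneckerFlow a r p) (k3 y)
      refine exists_chart_of_flow hbox hf ha hc (κ := k.restrOpen _ hopen) (u := 0) ?_ ?_
        ⟨hxk, hxk, ?_⟩
      · intro y hy
        rw [hval]
        exact kroneckerFlow_ne hirr (longHeight_neg (tail y hy) y.2).ne
      · intro y hy
        rw [longLeaf_of_isTail hirr (tail y hy) w]
        exact congrArg ofPoint (Subtype.ext (hval y).symm)
      · rw [mem_preimage, k3]
        exact longHeight_neg tx x.2
    · obtain ⟨e, he, he1, he2⟩ := exists_rayChart_kronecker hbox hf hc hw hw0 hpos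
      have hvm := strictMono_scaledArctan hc
      have hv0 := scaledArctan_zero (c := c)
      have hvc := (isOpenEmbedding_scaledArctan hc.ne').continuous
      -- The part of the tail with parameter above this value lies in the box, on the axis with `-1
      -- < t < 0`, hence in the domain of the ray chart; any negative number could replace `-1`.
      have hneg : scaledArctan c (-1) < 0 := hv0 ▸ hvm (by norm_num)
      have hopen : IsOpen (k.source ∩ k ⁻¹' Ioi (scaledArctan c (-1))) :=
        k.isOpen_inter_preimage isOpen_Ioi
      refine ⟨e, baseAtlas_subset hbox hf ha hc (Or.inr he), k.restrOpen _ hopen, 0,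
        ⟨hxk, hxk, ?_⟩, ?_⟩
      · rw [mem_preimage, k3, longHeight_of_not_isTail tx]
        exact hneg.trans_le (rayHeight_nonneg hw0 _)
      rintro y ⟨-, hyk, hy⟩
      have hyα : y.1 < base α := by rw [k1] at hyk; exact hyk
      change _ ∧ e _ = (k y, 0)
      rw [k3, he1, he2]
      rw [mem_preimage, k3] at hy
      by_cases ty : IsTail y.1
      · have hyn := longHeight_neg (w := w) ty y.2
        obtain ⟨t, ⟨-, ht⟩, hvt⟩ := intermediate_value_Ioo (by norm_num : (-1 : ℝ) ≤ 0)
          hvc.continuousOn (show longHeight w y.1 ∈ Ioo (scaledArctan c (-1)) (scaledArctan c 0) from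
            ⟨hy, by rwa [hv0]⟩)
        have hq : kroneckerBox a p c (0, t) = kroneckerFlow a (longHeight w y.1) p := by
          rw [← hvt, ← kroneckerPlane_zero_right]
          simp [kroneckerBox, hv0]
        have hinj := hbox.isOpenEmbedding.injective
        rw [longLeaf_of_isTail hirr ty w]
        refine ⟨⟨(0, t), Or.inr ht, hq⟩, ?_⟩
        rw [height_ofPoint hinj w _ hq, box_ofPoint hinj hq, boxHeight_zero_left, hvt]
        simp only [hv0]
      · rw [longLeaf_of_not_isTail ty]
        have hinj := hbox.isOpenEmbedding.injective
        refine ⟨stretch_lt_base_iff.2 hyα, ?_⟩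
        rw [height_ofRay hinj hbox.map_zero w hv0, box_ofRay hinj hbox.map_zero,
          longHeight_of_not_isTail ty]
        simp only [hv0]

end Nyikosization

namespace Nyikosization

open ClosedLongRay

variable {a : ℝ} {p : Torus} {c : ℝ} {f : CountableOrdinal → ℕ → ℕ}

/-! ### The leaves -/

/-- The candidates for the leaves. -/
def leafSets (a : ℝ) (p : Torus) (c : ℝ) (f : CountableOrdinal → ℕ → ℕ) :
    Set (Set (KroneckerNyikos a p c f)) :=
  {l | l = union {x | ∃ t < 0, x = kroneckerFlow a t p} univ ∨
    l = union {x | ∃ t > 0, x = kroneckerFlow a t p} ∅ ∨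
    ∃ q : Torus, (∀ t : ℝ, kroneckerFlow a t q ≠ p) ∧
      l = union {x | ∃ t : ℝ, x = kroneckerFlow a t q} ∅}

theorem leafSets_cover (z : KroneckerNyikos a p c f) : ∃ l ∈ leafSets a p c f, z ∈ l := by
  rcases eq_ofPoint_or_ofRay z with ⟨⟨q, hq⟩, rfl⟩ | ⟨x, rfl⟩
  · by_cases h : ∃ t, kroneckerFlow a t q = p
    · obtain ⟨t, ht⟩ := h
      have hqt : q = kroneckerFlow a (-t) p := by
        rw [← ht, kroneckerFlow_kroneckerFlow, add_neg_cancel, kroneckerFlow_zero]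
      rcases lt_trichotomy t 0 with h0 | rfl | h0
      · exact ⟨_, Or.inr (Or.inl rfl), -t, neg_pos.2 h0, hqt⟩
      · rw [kroneckerFlow_zero] at ht
        exact absurd ht hq
      · exact ⟨_, Or.inl rfl, -t, neg_lt_zero.2 h0, hqt⟩
    · push Not at h
      exact ⟨_, Or.inr (Or.inr ⟨q, h, rfl⟩), 0, (kroneckerFlow_zero q).symm⟩
  · exact ⟨_, Or.inl rfl, mem_univ x⟩

theorem leafSets_eq_of_inter (hirr : Irrational a) (l : Set (KroneckerNyikos a p c f))
    (hl : l ∈ leafSets a p c f) (l' : Set (KroneckerNyikos a p c f)) (hl' : l' ∈ leafSets a p c f)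
    (h : (l ∩ l').Nonempty) : l = l' := by
  -- Orbits that meet differ by a time shift. In the mixed cases below, this leads an orbit that
  -- avoids `p` through `p`.
  have trans : ∀ {q q' : Torus} {t t' : ℝ}, kroneckerFlow a t q = kroneckerFlow a t' q' →
      ∀ s, kroneckerFlow a s q = kroneckerFlow a (t' - t + s) q' := by
    intro q q' t t' h s
    have := congrArg (kroneckerFlow a (s - t)) h
    rw [kroneckerFlow_kroneckerFlow, kroneckerFlow_kroneckerFlow, add_sub_cancel] at this
    rw [this]
    congr 1
    ring
  obtain ⟨z, hz, hz'⟩ := h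
  rcases eq_ofPoint_or_ofRay z with ⟨q, rfl⟩ | ⟨x, rfl⟩
  · rcases hl with rfl | rfl | ⟨q₁, h₁, rfl⟩ <;> rcases hl' with rfl | rfl | ⟨q₂, h₂, rfl⟩ <;>
      obtain ⟨t, ht⟩ := hz <;> obtain ⟨t', ht'⟩ := hz'
    · rfl
    · have := kroneckerFlow_injective hirr p (ht.2.symm.trans ht'.2)
      linarith [ht.1, ht'.1]
    · exact absurd ((trans (ht'.symm.trans ht.2) (t' - t)).trans (by simp [kroneckerFlow_zero]))
        (h₂ _)
    · have := kroneckerFlow_injective hirr p (ht.2.symm.trans ht'.2)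
      linarith [ht.1, ht'.1]
    · rfl
    · exact absurd ((trans (ht'.symm.trans ht.2) (t' - t)).trans (by simp [kroneckerFlow_zero]))
        (h₂ _)
    · exact absurd ((trans (ht.symm.trans ht'.2) (t - t')).trans (by simp [kroneckerFlow_zero]))
        (h₁ _)
    · exact absurd ((trans (ht.symm.trans ht'.2) (t - t')).trans (by simp [kroneckerFlow_zero]))
        (h₁ _)
    · congr 1
      ext y
      constructor
      · rintro ⟨s, rfl⟩
        exact ⟨_, trans (ht.symm.trans ht') s⟩
      · rintro ⟨s, rfl⟩
        exact ⟨_, trans (ht'.symm.trans ht) s⟩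
  · have key : ∀ l ∈ leafSets a p c f, ofRay x ∈ l →
        l = union {x | ∃ t < 0, x = kroneckerFlow a t p} univ := by
      rintro l (rfl | rfl | ⟨q, hq, rfl⟩) hx
      exacts [rfl, absurd hx (by simp), absurd hx (by simp)]
    rw [key l hl hz, key l' hl' hz']

variable (hbox : IsKroneckerBox a p (kroneckerBox a p c)) (hf : IsNyikosSequence f) (ha : a ≠ 0)
  (hirr : Irrational a) (hc : 0 < c)

include hirr in
-- Continuity into the surface is recorded because this leaf, a dense continuous image of the line,
-- also proves the surface connected.
theorem exists_param_right : ∃ γ : ℝ → KroneckerNyikos a p c f,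
    (kroneckerFoliation hbox hf ha hc).IsLeafParam γ ∧ Continuous γ ∧
    range γ = union {x | ∃ t > 0, x = kroneckerFlow a t p} ∅ := by
  have hne : ∀ t, kroneckerPlane a p (Real.exp t, 0) ≠ p := fun t => by
    rw [kroneckerPlane_zero_right]
    exact kroneckerFlow_ne hirr (Real.exp_pos t).ne'
  refine ⟨_, isLeafParam_flow hbox hf ha hirr hc Real.isOpenEmbedding_exp hne,
    (continuous_ofPoint hbox.isOpenEmbedding hf).comp (Continuous.subtype_mk
      (continuous_kroneckerPlane.comp (by fun_prop)) _), ?_⟩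
  ext z
  constructor
  · rintro ⟨t, rfl⟩
    exact ⟨Real.exp t, Real.exp_pos t, kroneckerPlane_zero_right _⟩
  · intro hz
    rcases eq_ofPoint_or_ofRay z with ⟨⟨q, hq⟩, rfl⟩ | ⟨x, rfl⟩
    · obtain ⟨t, ht, rfl⟩ := hz
      refine ⟨Real.log t, congrArg ofPoint (Subtype.ext ?_)⟩
      simp only [Real.exp_log ht, kroneckerPlane_zero_right]
    · exact absurd hz (by simp)

include hirr in
theorem exists_param_kronecker {q : Torus} (hq : ∀ t, kroneckerFlow a t q ≠ p) :
    ∃ γ : ℝ → KroneckerNyikos a p c f, (kroneckerFoliation hbox hf ha hc).IsLeafParam γ ∧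
    range γ = union {x | ∃ t : ℝ, x = kroneckerFlow a t q} ∅ := by
  obtain ⟨⟨v, u⟩, rfl⟩ := kroneckerPlane_surjective (p := p) ha q
  have hne : ∀ t, kroneckerPlane a p (Homeomorph.addLeft v t, u) ≠ p := fun t => by
    have := hq t
    rwa [kroneckerFlow_kroneckerPlane] at this
  refine ⟨_, isLeafParam_flow hbox hf ha hirr hc (Homeomorph.addLeft v).isOpenEmbedding hne, ?_⟩
  ext z
  constructor
  · rintro ⟨t, rfl⟩
    exact ⟨t, (kroneckerFlow_kroneckerPlane _ _ _).symm⟩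
  · intro hz
    rcases eq_ofPoint_or_ofRay z with ⟨⟨q, hq⟩, rfl⟩ | ⟨x, rfl⟩
    · obtain ⟨t, rfl⟩ := hz
      exact ⟨t, congrArg ofPoint (Subtype.ext (kroneckerFlow_kroneckerPlane _ _ _).symm)⟩
    · exact absurd hz (by simp)

include hirr in
theorem leafHomeomorphic_real {l : Set (KroneckerNyikos a p c f)} (hl : l ∈ leafSets a p c f)
    (hne : l ≠ union {x | ∃ t < 0, x = kroneckerFlow a t p} univ) :
    (kroneckerFoliation hbox hf ha hc).LeafHomeomorphic l ℝ := by
  rcases hl with h | rfl | ⟨q, hq, rfl⟩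
  · exact absurd h hne
  · obtain ⟨γ, h1, -, h2⟩ := exists_param_right hbox hf ha hirr hc
    exact h2 ▸ h1.leafHomeomorphic_range (Homeomorph.refl ℝ)
  · obtain ⟨γ, h1, h2⟩ := exists_param_kronecker hbox hf ha hirr hc hq
    exact h2 ▸ h1.leafHomeomorphic_range (Homeomorph.refl ℝ)

include hirr in
theorem isLeaf_iff (l : Set (KroneckerNyikos a p c f)) :
    (kroneckerFoliation hbox hf ha hc).IsLeaf l ↔ l ∈ leafSets a p c f := by
  have key : ∀ l ∈ leafSets a p c f,
      IsOpen[(kroneckerFoliation hbox hf ha hc).leafTopology] l ∧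
        @IsPathConnected _ (kroneckerFoliation hbox hf ha hc).leafTopology l := by
    rintro l (rfl | rfl | ⟨q, hq, rfl⟩)
    · have h := isLeafParam_longLeaf hbox hf ha hirr hc
      rw [← range_longLeaf hirr]
      exact ⟨h.isOpen_range, h.isPathConnected_range⟩
    · obtain ⟨γ, h, -, h2⟩ := exists_param_right hbox hf ha hirr hc
      rw [← h2]
      exact ⟨h.isOpen_range, h.isPathConnected_range⟩
    · obtain ⟨γ, h, h2⟩ := exists_param_kronecker hbox hf ha hirr hc hq
      rw [← h2]
      exact ⟨h.isOpen_range, h.isPathConnected_range⟩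
  exact Foliation.isLeaf_iff_of_partition _ (fun l hl => (key l hl).1) (fun l hl => (key l hl).2)
    leafSets_cover (leafSets_eq_of_inter hirr) l

/-! ### Minimality and the long leaf -/

include hbox hf hirr in
theorem dense_of_mem_leafSets {l : Set (KroneckerNyikos a p c f)} (hl : l ∈ leafSets a p c f) :
    Dense l := by
  rcases hl with rfl | rfl | ⟨q, -, rfl⟩
  · exact (dense_union hbox hf (dense_kroneckerFlow_lt hirr p 0)).mono
      (union_mono subset_rfl (empty_subset _))
  · exact dense_union hbox hf (dense_kroneckerFlow_gt hirr p 0)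
  · refine (dense_union hbox hf (dense_kroneckerFlow_gt hirr q 0)).mono
      (union_mono ?_ subset_rfl)
    rintro x ⟨t, -, h⟩
    exact ⟨t, h⟩

include hirr in
theorem not_isEmbedded_longLeaf : ¬ (kroneckerFoliation hbox hf ha hc).IsEmbedded
    (union {x | ∃ t < 0, x = kroneckerFlow a t p} univ : Set (KroneckerNyikos a p c f)) := by
  intro hemb
  obtain ⟨m, hm⟩ := CountableOrdinal.exists_isMin
  -- The fraction `1/4` corresponds to flow time `2 - 4 = -2`. The part of the leaf beyond `x₀` is
  -- open in the leaf; if it were the trace of an open set `O` of the surface, then `O`, which is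
  -- non-empty because of `x₁`, would contain orbit points of time below `-2`, and these have
  -- fraction below `1/4`.
  let x₀ : ClosedLongRay := point m ⟨1 / 4, by norm_num, by norm_num⟩
  let x₁ : OpenLongRay := ⟨point m ⟨3 / 8, by norm_num, by norm_num⟩, fun h => by
    have := (isMin_iff.1 h).2
    simp at this⟩
  have hx₁ : IsTail x₁.1 := ⟨hm, by simp only [x₁, frac_point]; norm_num⟩
  have hU : IsOpen {x : OpenLongRay | x₀ < x.1} := isOpen_Ioi.preimage continuous_subtype_val
  have hparam := isLeafParam_longLeaf hbox hf ha hirr hc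
  have hV := hparam.isOpen_image hU
  have hV' : IsOpen[(kroneckerFoliation hbox hf ha hc).intrinsicTopology
      (union {x | ∃ t < 0, x = kroneckerFlow a t p} univ : Set (KroneckerNyikos a p c f))]
      (Subtype.val ⁻¹' (longLeaf a p c f '' {x : OpenLongRay | x₀ < x.1})) := ⟨_, hV, rfl⟩
  have hind := @IsInducing.eq_induced _ _ ((kroneckerFoliation hbox hf ha hc).intrinsicTopology _)
    _ _ (@IsEmbedding.toIsInducing _ _ (_) _ _ hemb)
  rw [hind] at hV'
  obtain ⟨O, hO, hOV⟩ := hV'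
  have hrange : ∀ x : OpenLongRay, longLeaf a p c f x ∈
      (union {x | ∃ t < 0, x = kroneckerFlow a t p} univ : Set (KroneckerNyikos a p c f)) :=
    fun x => range_longLeaf hirr ▸ mem_range_self x
  have hmem : ∀ x : OpenLongRay, longLeaf a p c f x ∈ O ↔ x₀ < x.1 := fun x =>
    (Set.ext_iff.1 hOV ⟨_, hrange x⟩).trans (longLeaf_injective hirr).mem_set_image
  have hne : (longLeaf a p c f x₁) ∈ O := (hmem x₁).2
    (ClosedLongRay.lt_iff.2 (Or.inr ⟨rfl, by simp only [x₀, x₁, frac_point]; norm_num⟩))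
  obtain ⟨z, hzO, hz⟩ := (dense_union (c := c) hbox hf
    (dense_kroneckerFlow_lt hirr p (-2))).inter_open_nonempty O hO ⟨_, hne⟩
  rcases eq_ofPoint_or_ofRay z with ⟨⟨q, hq⟩, rfl⟩ | ⟨x, rfl⟩
  · obtain ⟨t, ht, rfl⟩ := hz
    obtain ⟨x, hx⟩ : (ofPoint ⟨_, hq⟩ : KroneckerNyikos a p c f) ∈ range (longLeaf a p c f) := by
      rw [range_longLeaf hirr]
      exact ⟨t, lt_trans ht (by norm_num), rfl⟩
    rw [← hx, hmem] at hzO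
    by_cases tx : IsTail x.1
    · rw [longLeaf_of_isTail hirr tx 0] at hx
      have h1 := kroneckerFlow_injective hirr p (congrArg Subtype.val (ofPoint_injective hx))
      rw [longHeight_of_isTail tx] at h1
      have hpos := tx.frac_pos x.2
      have h2 : 1 / 4 < x.1.frac := by
        rcases ClosedLongRay.lt_iff.1 hzO with h | h
        · exact absurd (tx.1 h.le) h.not_ge
        · exact h.2
      have h3 : 1 / x.1.frac < 4 := by
        rw [div_lt_iff₀ hpos]
        linarith
      linarith
    · rw [longLeaf_of_not_isTail tx] at hx
      exact ofPoint_ne_ofRay hx.symm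
  · exact absurd hz (by simp)

include hbox hf ha hirr hc in
theorem isSurface : IsSurface (KroneckerNyikos a p c f) where
  connected := by
    obtain ⟨γ, -, h1, h2⟩ := exists_param_right hbox hf ha hirr hc
    have hd : DenseRange γ := by
      rw [DenseRange, h2]
      exact dense_of_mem_leafSets hbox hf hirr (Or.inr (Or.inl rfl))
    have := hd.preconnectedSpace h1
    exact { toNonempty := ⟨γ 0⟩ }
  hausdorff := t2Space hbox.isOpenEmbedding hbox.map_zero hf
  locallyEuclidean := nonempty_chartedSpace_of_charts fun z =>
    (baseAtlas_cover hbox hf ha hc z).imp fun _ h => h.2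

end Nyikosization

open Nyikosization in
theorem mainTheorem6 (a : ℝ) (ha : Irrational a) (p : Torus) :
    ∃ (φ : ℝ × ℝ → Torus) (f : CountableOrdinal → ℕ → ℕ),
      IsKroneckerBox a p φ ∧ IsNyikosSequence f ∧
      IsSurface (Nyikosization p φ f) ∧
      ¬ TopologicalSpace.MetrizableSpace (Nyikosization p φ f) ∧
      ∃ F : Foliation (Nyikosization p φ f),
        F.IsMinimal ∧
        (∃ l : Set (Nyikosization p φ f),
          l = Nyikosization.union {x | ∃ t < 0, x = kroneckerFlow a t p} Set.univ ∧
          F.IsLeaf l ∧ F.IsLong l ∧ F.LeafHomeomorphic l OpenLongRay ∧ ¬ F.IsEmbedded l ∧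
          ∀ l' : Set (Nyikosization p φ f), F.IsLeaf l' → l' ≠ l → F.LeafHomeomorphic l' ℝ) ∧
        (∀ l : Set (Nyikosization p φ f), F.IsLeaf l ↔
          (l = Nyikosization.union {x | ∃ t < 0, x = kroneckerFlow a t p} Set.univ ∨
            l = Nyikosization.union {x | ∃ t > 0, x = kroneckerFlow a t p} ∅ ∨
            ∃ q : Torus, (∀ t : ℝ, kroneckerFlow a t q ≠ p) ∧
              l = Nyikosization.union {x | ∃ t : ℝ, x = kroneckerFlow a t q} ∅)) := by
  obtain ⟨f, hf⟩ := exists_isNyikosSequence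
  -- The largest width permitted by `isKroneckerBox_kroneckerBox`.
  have hc : 0 < 1 / (8 * (1 + |a|)) := by positivity
  have hbox := isKroneckerBox_kroneckerBox ha.ne_zero p hc (le_of_eq (by field_simp))
  have hlong : (kroneckerFoliation hbox hf ha.ne_zero hc).LeafHomeomorphic
      (union {x | ∃ t < 0, x = kroneckerFlow a t p} univ) OpenLongRay := by
    rw [← range_longLeaf ha]
    exact (isLeafParam_longLeaf hbox hf ha.ne_zero ha hc).leafHomeomorphic_range (.refl _)
  refine ⟨_, f, hbox, hf, isSurface hbox hf ha.ne_zero ha hc, not_metrizableSpace,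
    kroneckerFoliation hbox hf ha.ne_zero hc, fun l hl => ?_, ⟨_, rfl, ?_, ⟨?_, ?_⟩, hlong, ?_,
      fun l' hl' hne => ?_⟩, isLeaf_iff hbox hf ha.ne_zero ha hc⟩
  · exact dense_of_mem_leafSets hbox hf ha ((isLeaf_iff hbox hf ha.ne_zero ha hc l).1 hl)
  · exact (isLeaf_iff hbox hf ha.ne_zero ha hc _).2 (Or.inl rfl)
  · rintro ⟨g⟩
    obtain ⟨g'⟩ := hlong
    exact ClosedLongRay.not_homeomorph_metricSpace.false
      (@Homeomorph.trans _ _ _ _ (_) _ (@Homeomorph.symm _ _ (_) _ g') g)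
  · rintro ⟨g⟩
    obtain ⟨g'⟩ := hlong
    exact ClosedLongRay.not_homeomorph_metricSpace.false
      (@Homeomorph.trans _ _ _ _ (_) _ (@Homeomorph.symm _ _ (_) _ g') g)
  · exact not_isEmbedded_longLeaf hbox hf ha.ne_zero ha hc
  · exact leafHomeomorphic_real hbox hf ha.ne_zero ha hc
      ((isLeaf_iff hbox hf ha.ne_zero ha hc l').1 hl') hne

end
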